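/- **Setting.** There are $n$ parties $0,\dots,n-1$ with $n>3f$, of which at most $f$ are faulty (Byzantine, arbitrary behaviour), joined by authenticated point-to-point channels (every party also has a channel to itself). There is a time $GST\ge 0$, unknown to the parties, and a known $\Delta>0$: a message sent at time $s$ between nonfaulty parties arrives by $\max(s,GST)+\Delta$; from $GST$ on the local clocks show the time, before they may show anything. All parties start at time $0$; local computation takes no time. A *word* holds one counter, identifier, value, clock reading or null marker; the size of a message is the number of its fields, including its tag. **Algorithm (IT-HS), party $i$ with input $x_i$.** Variables: $view\gets 1$; $lock\gets0$, $lock\_val\gets x_i$; $key3\gets 0$, $key3\_val\gets x_i$; for $m=1,2$: $key_m\gets0$, $key_m\_val\gets x_i$, $prev\_key_m\gets-1$; arrays $highest\_request[j]\gets0$, $highest\_abort[j]\gets0$. The primary of view $v$ is party $v \bmod n$. Of every kind of view message, and of $done$ messages, only the first one from each sender is kept; view messages of other views are ignored, and the information about the messages received in a view is freed when the view changes. *Broadcasting* a view message means sending it to each party $j$ as soon as $highest\_request[j]=view$. - *Starting a view*: send $\langle request,view\rangle$ to all; broadcast $\langle proof,key_1,key_1\_val,prev\_key_1,view\rangle$;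 once $highest\_request[primary]=view$, send $\langle suggest,key3,key3\_val,key_2,key_2\_val,prev\_key_2,view\rangle$ to the primary; when the local clock has advanced by $11\Delta$ in the view, send $\langle abort,view\rangle$ to all. On $\langle request,v\rangle$ from $j$: $highest\_request[j]\gets\max(highest\_request[j],v)$. - *Primary*: a suggestion $(k_3,v_3,k_2,v_2,p_2)$ of a party is accepted if $k_3=0$, or if $k_3<view$ and at least $f+1$ parties sent suggestions whose last three components $(k,w,p)$ satisfy $p<k<view$ and ($k_3\le p$, or $k_3\le k$ and $w=v_3$). Once the suggestions of $n-f$ parties are accepted, it broadcasts (once per view) $\langle propose,k_3,v_3,view\rangle$ for some accepted suggestion with maximal $k_3$. - *Echo*: having received $\langle propose,k,x,view\rangle$ from the primary, broadcast $\langle echo,x,view\rangle$ (once per view) as soon as $lock=0$, or $x=lock\_val$, or $lock\le k<view$ and $f+1$ parties sent proofs $(k_1,v_1,p_1)$ with $p_1<k_1<view$ and ($lock\le p_1$, or $lock\le k_1$ and $v_1\ne lock\_val$). - *Further rounds*, each at most once per view, on $n-f$ messages of the view with the same value $x$: on $echo$, broadcast $\langle key1,x,view\rangle$; on $key1$, broadcast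 $\langle key2,x,view\rangle$; with these, for $m=1$, resp. $m=2$: if $key_m\_val\ne x$ then $prev\_key_m\gets key_m$, $key_m\_val\gets x$; then $key_m\gets view$. On $key2$, broadcast $\langle key3,x,view\rangle$ and set $key3\gets view$, $key3\_val\gets x$. On $key3$, broadcast $\langle lock,x,view\rangle$ and set $lock\gets view$, $lock\_val\gets x$. On $lock$, send $\langle done,x\rangle$ to all, unless some $done$ message was sent before. - *Done*: on $\langle done,x\rangle$ from $f+1$ parties, send $\langle done,x\rangle$ to all unless some $done$ message was sent before; on $\langle done,x\rangle$ from $n-f$ parties, decide $x$ and terminate. - *Abort*: on $\langle abort,v\rangle$ from $j$ with $highest\_abort[j]<v$: set $highest\_abort[j]\gets v$; let $u$ be the $(f+1)$-st largest entry of $highest\_abort$; if $u>highest\_abort[i]$, send $\langle abort,u\rangle$ to all and set $highest\_abort[i]\gets u$; let $w$ be the $(n-f)$-th largest entry; if $w\ge view$, start view $w+1$. - *Reboots*: at any time a party may reboot, which erases all its memory except the persistent part: $view$, the lock, key and previous-key variables, the view messages of the current view that it has sent or has to send, its $done$ message, the highest view for which it sent an $abort$, and its decision. Unless it has terminated, it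 then restarts the timer of its view and sends $\langle recover,view\rangle$ and $\langle request,view\rangle$ to all. A party that receives $\langle recover,v\rangle$ from $j$, even after terminating, sends $j$ its last $done$, $request$ and highest $abort$ and, if its own view is $v$, the messages of this view that are meant for $j$. **Theorem.** There is an absolute constant $C$ such that in every execution: 1. *(Communication)* Every message sent by a nonfaulty party has at most $7$ words. For all parties $i,j$ with $i$ nonfaulty and every view $v$: the messages other than $abort$ messages that $i$ sends to $j$ while its $view$ is $v$ have at most $C(1+r_v)$ words in total, and the messages $\langle abort,v\rangle$ that $i$ sends to $j$ at most $C(1+r)$. Here $r$ is the number of reboots of $i$ plus the number of $recover$ messages of $j$ received by $i$, and $r_v$ counts those among them that occur while $i$ is in view $v$. (Without reboots and $recover$ messages, the bound is the constant $C$.) 2. *(Memory)* At all times a nonfaulty party uses at most $Cn$ words of memory, of which at most $C$ are persistent. All the rest may be erased by reboots, at any times: still no two nonfaulty parties decide different values, and if no party is faulty and all have the same input, no other value is decided. 3. *(Optimistic responsiveness)* Let $0<\delta<\Delta$ and suppose that every message between nonfaulty parties sent at time $s$ in fact arrives by $\max(s,GST)+\delta$. Let $v\ge1$ be a view with a nonfaulty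 primary and let $T$ be the first time at which some nonfaulty party has $view\ge v$. If $T\ge GST$, and if every reboot of a nonfaulty party at a time $s\le T+C\delta$ satisfies $\max(s,GST)+2\delta\le T$ (recoveries are complete when the view starts; there is no condition if there are no reboots), then all nonfaulty parties decide and terminate by time $T+C\delta$. -/

import Mathlib

noncomputable section

namespace ITHS

open scoped Classical

/-! ## Words and messages

Parties are the elements of `Fin n`; values are elements of an arbitrary type `V`.  A word holds one
counter, identifier, value or clock reading, or a null marker. -/

inductive Word (V : Type*) where
  | null
  | counter (z : ℤ)
  | value (x : V)
  | clock (t : ℝ)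

/-- The triple `(key, key_val, prev_key)`, used for `key1` and for `key2`. -/
structure KeyRec (V : Type*) where
  key : ℤ
  val : V
  prev : ℤ

/-- The contents `key3, key3_val, key2, key2_val, prev_key2` of a `suggest` message. -/
structure Suggestion (V : Type*) where
  key3 : ℤ
  val3 : V
  key2 : KeyRec V

/-- The all-to-all rounds of a view that follow the proposal. -/
inductive Round where
  | echo
  | key1
  | key2
  | key3
  | lock

inductive Msg (V : Type*) where
  | request (view : ℕ)
  | suggest (s : Suggestion V) (view : ℕ)
  | propose (key : ℤ) (val : V) (view : ℕ)
  | proof (r : KeyRec V) (view : ℕ)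
  /-- The messages `⟨echo, val, view⟩`, `⟨key1, val, view⟩`, ..., `⟨lock, val, view⟩`. -/
  | vote (r : Round) (val : V) (view : ℕ)
  | done (val : V)
  | abort (view : ℕ)
  /-- Sent after a reboot, to ask for the messages that were erased. -/
  | recover (view : ℕ)

variable {n : ℕ} {V : Type*}

def KeyRec.encode (r : KeyRec V) : List (Word V) :=
  [.counter r.key, .value r.val, .counter r.prev]

def Suggestion.encode (s : Suggestion V) : List (Word V) :=
  [.counter s.key3, .value s.val3] ++ s.key2.encode

def Round.tag : Round → ℤ
  | .echo => 10
  | .key1 => 11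
  | .key2 => 12
  | .key3 => 13
  | .lock => 14

/-- A message as a sequence of words: a tag, followed by its fields. -/
def Msg.encode : Msg V → List (Word V)
  | .request v => [.counter 0, .counter v]
  | .suggest s v => [.counter 1] ++ s.encode ++ [.counter v]
  | .propose k x v => [.counter 2, .counter k, .value x, .counter v]
  | .proof r v => [.counter 3] ++ r.encode ++ [.counter v]
  | .vote r x v => [.counter r.tag, .value x, .counter v]
  | .done x => [.counter 4, .value x]
  | .abort v => [.counter 5, .counter v]
  | .recover v => [.counter 6, .counter v]

/-- The size of a message in words. -/
def Msg.words (m : Msg V) : ℕ := m.encode.length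

def Msg.IsAbort : Msg V → Prop
  | .abort _ => True
  | _ => False

/-! ## The memory of a party -/

/-- The part of the memory that survives a reboot. -/
structure Persistent (V : Type*) where
  view : ℕ
  lock : ℤ
  lockVal : V
  key3 : ℤ
  key3Val : V
  key2 : KeyRec V
  key1 : KeyRec V
  /-- The messages sent, or to be sent as soon as the recipients join, in the current view. -/
  sentSuggest : Option (Suggestion V)
  sentProof : Option (KeyRec V)
  sentPropose : Option (ℤ × V)
  sentVote : Round → Option V
  /-- The `done` message that was sent, if any. -/
  doneSent : Option V
  /-- The highest view for which an `abort` message was sent; `0` if there was none. -/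
  lastAbort : ℕ
  /-- The value decided upon; a party with a decision has terminated. -/
  decided : Option V

/-- The part of the memory that a reboot erases.  The fields from `suggestFrom` on belong to the
current view and are freed when the view changes; for every sender and every kind of message only
the first message is kept. -/
structure Transient (n : ℕ) (V : Type*) where
  highestRequest : Fin n → ℕ
  highestAbort : Fin n → ℕ
  doneFrom : Fin n → Option V
  /-- The local time at which the current view is to be aborted; `none` once that has been done. -/
  deadline : Option ℝ
  suggestFrom : Fin n → Option (Suggestion V)
  proofFrom : Fin n → Option (KeyRec V)
  proposal : Option (ℤ × V)
  voteFrom : Round → Fin n → Option V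

structure State (n : ℕ) (V : Type*) where
  pers : Persistent V
  tran : Transient n V

def encodeOption {α : Type*} (enc : α → List (Word V)) : Option α → List (Word V)
  | none => [.null]
  | some a => enc a

def encodeArray {α : Type*} (enc : α → List (Word V)) (a : Fin n → α) : List (Word V) :=
  (List.ofFn a).flatMap enc

def Round.all : List Round := [.echo, .key1, .key2, .key3, .lock]

def Persistent.encode (p : Persistent V) : List (Word V) :=
  [.counter p.view, .counter p.lock, .value p.lockVal, .counter p.key3, .value p.key3Val]
    ++ p.key2.encode ++ p.key1.encode
    ++ encodeOption Suggestion.encode p.sentSuggest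
    ++ encodeOption KeyRec.encode p.sentProof
    ++ encodeOption (fun q => [.counter q.1, .value q.2]) p.sentPropose
    ++ Round.all.flatMap (fun r => encodeOption (fun x => [.value x]) (p.sentVote r))
    ++ encodeOption (fun x => [.value x]) p.doneSent
    ++ [.counter p.lastAbort]
    ++ encodeOption (fun x => [.value x]) p.decided

def Transient.encode (t : Transient n V) : List (Word V) :=
  encodeArray (fun v : ℕ => [.counter v]) t.highestRequest
    ++ encodeArray (fun v : ℕ => [.counter v]) t.highestAbort
    ++ encodeArray (encodeOption (fun x => [.value x])) t.doneFrom
    ++ encodeOption (fun d => [.clock d]) t.deadline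
    ++ encodeArray (encodeOption Suggestion.encode) t.suggestFrom
    ++ encodeArray (encodeOption KeyRec.encode) t.proofFrom
    ++ encodeOption (fun q => [.counter q.1, .value q.2]) t.proposal
    ++ Round.all.flatMap (fun r => encodeArray (encodeOption (fun x => [.value x])) (t.voteFrom r))

/-- The persistent memory in use, in words. -/
def State.persistentWords (s : State n V) : ℕ := s.pers.encode.length

/-- The whole memory in use, in words. -/
def State.totalWords (s : State n V) : ℕ := s.pers.encode.length + s.tran.encode.length

def Transient.empty : Transient n V where
  highestRequest := fun _ => 0
  highestAbort := fun _ => 0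
  doneFrom := fun _ => none
  deadline := none
  suggestFrom := fun _ => none
  proofFrom := fun _ => none
  proposal := none
  voteFrom := fun _ _ => none

/-! ## The algorithm

Every handler maps a local state to the next local state and the list of the messages sent, each
with its recipient. -/

abbrev Eff (n : ℕ) (V : Type*) := State n V × List (Fin n × Msg V)

def Eff.andThen (e : Eff n V) (h : State n V → Eff n V) : Eff n V :=
  ((h e.1).1, e.2 ++ (h e.1).2)

/-- Primaries are chosen in a round-robin fashion. -/
abbrev IsPrimary (i : Fin n) (view : ℕ) : Prop := i.val = view % n

def toAll (m : Msg V) : List (Fin n × Msg V) := (List.finRange n).map fun j => (j, m)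

/-- The message `m`, to those parties that have joined the current view.  Parties that join later
get it when they join, see `onRequest`. -/
def toJoined (s : State n V) (m : Msg V) : List (Fin n × Msg V) :=
  ((List.finRange n).filter fun j => s.tran.highestRequest j = s.pers.view).map fun j => (j, m)

/-- The messages of the current view that party `j` is to get. -/
def currentMsgs (p : Persistent V) (j : Fin n) : List (Msg V) :=
  (p.sentProof.toList.map fun r => Msg.proof r p.view)
    ++ (p.sentPropose.toList.map fun q => Msg.propose q.1 q.2 p.view)
    ++ (Round.all.flatMap fun r => (p.sentVote r).toList.map fun x => Msg.vote r x p.view)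
    ++ (if IsPrimary j p.view then p.sentSuggest.toList.map fun s => Msg.suggest s p.view else [])

/-- The number of parties from which the value `x` was received. -/
def count (a : Fin n → Option V) (x : V) : ℕ :=
  (Finset.univ.filter fun j => a j = some x).card

/-- The `k`-th largest entry of an array: the largest one with at least `k` entries above or equal. -/
def kthLargest (k : ℕ) (a : Fin n → ℕ) : ℕ :=
  (Finset.univ.filter fun j => k ≤ (Finset.univ.filter fun l => a j ≤ a l).card).sup a

/-- Record that `x` was accepted in view `v`, remembering when the previous value was last set. -/
def KeyRec.update (r : KeyRec V) (x : V) (v : ℕ) : KeyRec V :=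
  if r.val = x then { r with key := v } else { key := v, val := x, prev := r.key }

abbrev SupportsKey (key : ℤ) (val : V) (r : KeyRec V) : Prop :=
  key ≤ r.prev ∨ (key ≤ r.key ∧ val = r.val)

abbrev SupportsOpening (lock : ℤ) (lockVal : V) (r : KeyRec V) : Prop :=
  lock ≤ r.prev ∨ (lock ≤ r.key ∧ r.val ≠ lockVal)

/-- `accept_key` -/
def AcceptKey (f : ℕ) (s : State n V) (key : ℤ) (val : V) : Prop :=
  f + 1 ≤ (Finset.univ.filter fun j => ∃ g ∈ s.tran.suggestFrom j,
    g.key2.prev < g.key2.key ∧ g.key2.key < s.pers.view ∧ SupportsKey key val g.key2).card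

/-- `open_lock` -/
def OpenLock (f : ℕ) (s : State n V) : Prop :=
  f + 1 ≤ (Finset.univ.filter fun j => ∃ r ∈ s.tran.proofFrom j,
    r.prev < r.key ∧ r.key < s.pers.view ∧ SupportsOpening s.pers.lock s.pers.lockVal r).card

/-- The parties whose suggestions have been accepted. -/
def accepted (f : ℕ) (s : State n V) : Finset (Fin n) :=
  Finset.univ.filter fun j => ∃ g ∈ s.tran.suggestFrom j,
    g.key3 = 0 ∨ (g.key3 < s.pers.view ∧ AcceptKey f s g.key3 g.val3)

/-- The parties whose suggestions have been accepted and have a maximal key among those. -/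
def best (f : ℕ) (s : State n V) : Finset (Fin n) :=
  (accepted f s).filter fun j => ∃ g ∈ s.tran.suggestFrom j,
    ∀ l ∈ accepted f s, ∀ g' ∈ s.tran.suggestFrom l, g'.key3 ≤ g.key3

def trySuggest (s : State n V) : Eff n V :=
  if s.pers.sentSuggest = none ∧
      ∃ j : Fin n, IsPrimary j s.pers.view ∧ s.tran.highestRequest j = s.pers.view then
    let g : Suggestion V := ⟨s.pers.key3, s.pers.key3Val, s.pers.key2⟩
    ({ s with pers.sentSuggest := some g },
      ((List.finRange n).filter fun j => IsPrimary j s.pers.view).map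
        fun j => (j, Msg.suggest g s.pers.view))
  else (s, [])

/-- Start view `v` at local time `now`. -/
def enterView (Δ now : ℝ) (v : ℕ) (s : State n V) : Eff n V :=
  let s' : State n V :=
    { pers := { s.pers with
        view := v
        sentSuggest := none
        sentProof := some s.pers.key1
        sentPropose := none
        sentVote := fun _ => none }
      tran := { (Transient.empty : Transient n V) with
        highestRequest := s.tran.highestRequest
        highestAbort := s.tran.highestAbort
        doneFrom := s.tran.doneFrom
        deadline := some (now + 11 * Δ) } }
  Eff.andThen (s', toAll (.request v) ++ toJoined s' (.proof s.pers.key1 v)) trySuggest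

/-- The beginning of the algorithm, with input `x`.  The number `0` stands for a lock or a key that
has not been set, so the first view is view `1`. -/
def startParty (Δ now : ℝ) (x : V) : Eff n V :=
  enterView Δ now 1
    { pers :=
        { view := 0, lock := 0, lockVal := x, key3 := 0, key3Val := x
          key2 := ⟨0, x, -1⟩, key1 := ⟨0, x, -1⟩
          sentSuggest := none, sentProof := none, sentPropose := none, sentVote := fun _ => none
          doneSent := none, lastAbort := 0, decided := none }
      tran := Transient.empty }

def onRequest (j : Fin n) (v : ℕ) (s : State n V) : Eff n V :=
  if s.tran.highestRequest j < v then
    let s' := { s with tran.highestRequest := Function.update s.tran.highestRequest j v }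
    if v = s.pers.view then
      Eff.andThen (s', (currentMsgs s.pers j).map fun m => (j, m)) trySuggest
    else (s', [])
  else (s, [])

/-- The rule by which the primary proposes.  If there are several accepted suggestions with a
maximal key, `pick` chooses one of them. -/
def tryPropose (f : ℕ) (pick : Finset (Fin n) → Fin n) (s : State n V) : Eff n V :=
  if s.pers.sentPropose = none ∧ n - f ≤ (accepted f s).card then
    match s.tran.suggestFrom (pick (best f s)) with
    | some g =>
      ({ s with pers.sentPropose := some (g.key3, g.val3) },
        toJoined s (.propose g.key3 g.val3 s.pers.view))
    | none => (s, [])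
  else (s, [])

def onSuggest (f : ℕ) (i : Fin n) (pick : Finset (Fin n) → Fin n) (j : Fin n)
    (g : Suggestion V) (v : ℕ) (s : State n V) : Eff n V :=
  if v = s.pers.view ∧ IsPrimary i v ∧ s.tran.suggestFrom j = none then
    tryPropose f pick
      { s with tran.suggestFrom := Function.update s.tran.suggestFrom j (some g) }
  else (s, [])

/-- `send_all_upon_join(⟨r, x, view⟩)` -/
def sendVote (r : Round) (x : V) (s : State n V) : Eff n V :=
  ({ s with pers.sentVote := Function.update s.pers.sentVote r (some x) },
    toJoined s (.vote r x s.pers.view))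

def tryEcho (f : ℕ) (s : State n V) : Eff n V :=
  match s.tran.proposal with
  | some (key, x) =>
    if s.pers.sentVote .echo = none ∧
        (s.pers.lock = 0 ∨ x = s.pers.lockVal ∨
          (key < s.pers.view ∧ s.pers.lock ≤ key ∧ OpenLock f s)) then
      sendVote .echo x s
    else (s, [])
  | none => (s, [])

def onPropose (f : ℕ) (j : Fin n) (key : ℤ) (x : V) (v : ℕ) (s : State n V) : Eff n V :=
  if v = s.pers.view ∧ IsPrimary j v ∧ s.tran.proposal = none then
    tryEcho f { s with tran.proposal := some (key, x) }
  else (s, [])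

def onProof (f : ℕ) (j : Fin n) (r : KeyRec V) (v : ℕ) (s : State n V) : Eff n V :=
  if v = s.pers.view ∧ s.tran.proofFrom j = none then
    tryEcho f { s with tran.proofFrom := Function.update s.tran.proofFrom j (some r) }
  else (s, [])

/-- Send `⟨done, x⟩`, if no `done` message has been previously sent. -/
def sendDone (x : V) (s : State n V) : Eff n V :=
  if s.pers.doneSent = none then ({ s with pers.doneSent := some x }, toAll (.done x)) else (s, [])

/-- The reaction to `n - f` messages of round `r` of the current view with the same value `x`. -/
def onQuorum (f : ℕ) (r : Round) (x : V) (s : State n V) : Eff n V :=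
  match r with
  | .echo =>
    if s.pers.sentVote .key1 = none then
      sendVote .key1 x { s with pers.key1 := s.pers.key1.update x s.pers.view }
    else (s, [])
  | .key1 =>
    if s.pers.sentVote .key2 = none then
      sendVote .key2 x { s with pers.key2 := s.pers.key2.update x s.pers.view }
    else (s, [])
  | .key2 =>
    if s.pers.sentVote .key3 = none then
      sendVote .key3 x { s with pers.key3 := s.pers.view, pers.key3Val := x }
    else (s, [])
  | .key3 =>
    if s.pers.sentVote .lock = none then
      Eff.andThen
        (sendVote .lock x { s with pers.lock := s.pers.view, pers.lockVal := x }) (tryEcho f)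
    else (s, [])
  | .lock => sendDone x s

def onVote (f : ℕ) (r : Round) (j : Fin n) (x : V) (v : ℕ) (s : State n V) : Eff n V :=
  if v = s.pers.view ∧ s.tran.voteFrom r j = none then
    let s' := { s with
      tran.voteFrom := Function.update s.tran.voteFrom r
        (Function.update (s.tran.voteFrom r) j (some x)) }
    if n - f ≤ count (s'.tran.voteFrom r) x then onQuorum f r x s' else (s', [])
  else (s, [])

def onDone (f : ℕ) (j : Fin n) (x : V) (s : State n V) : Eff n V :=
  if s.tran.doneFrom j = none then
    let s' := { s with tran.doneFrom := Function.update s.tran.doneFrom j (some x) }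
    let e := if f + 1 ≤ count s'.tran.doneFrom x then sendDone x s' else (s', [])
    if n - f ≤ count s'.tran.doneFrom x then ({ e.1 with pers.decided := some x }, e.2) else e
  else (s, [])

def onAbort (f : ℕ) (Δ now : ℝ) (i j : Fin n) (v : ℕ) (s : State n V) : Eff n V :=
  if s.tran.highestAbort j < v then
    let a := Function.update s.tran.highestAbort j v
    let u := kthLargest (f + 1) a
    let e : Eff n V :=
      if a i < u then
        ({ s with
            tran.highestAbort := Function.update a i u
            pers.lastAbort := max s.pers.lastAbort u }, toAll (.abort u))
      else ({ s with tran.highestAbort := a }, [])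
    let w := kthLargest (n - f) e.1.tran.highestAbort
    if s.pers.view ≤ w then Eff.andThen e (enterView Δ now (w + 1)) else e
  else (s, [])

/-- The reply to a rebooted party that is in view `v`: the last `done`, `request` and `abort`
messages and, if the own view is `v` as well, the messages of this view. -/
def onRecover (j : Fin n) (v : ℕ) (s : State n V) : Eff n V :=
  (s, ((s.pers.doneSent.toList.map Msg.done) ++ [Msg.request s.pers.view]
    ++ (if s.pers.lastAbort = 0 then [] else [Msg.abort s.pers.lastAbort])
    ++ (if v = s.pers.view then currentMsgs s.pers j else [])).map fun m => (j, m))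

/-- Party `i` receives the message `m` from party `j` at local time `now`.  A party that has
terminated only replies to rebooted parties. -/
def receive (f : ℕ) (Δ now : ℝ) (pick : Finset (Fin n) → Fin n) (i j : Fin n) (m : Msg V)
    (s : State n V) : Eff n V :=
  match m with
  | .recover v => onRecover j v s
  | m =>
    if s.pers.decided = none then
      match m with
      | .request v => onRequest j v s
      | .suggest g v => onSuggest f i pick j g v s
      | .propose k x v => onPropose f j k x v s
      | .proof r v => onProof f j r v s
      | .vote r x v => onVote f r j x v s
      | .done x => onDone f j x s
      | .abort v => onAbort f Δ now i j v s
      | .recover _ => (s, [])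
    else (s, [])

/-- The timer of the current view. -/
def onTimer (now : ℝ) (s : State n V) : Eff n V :=
  if s.pers.decided = none ∧ ∃ d ∈ s.tran.deadline, d ≤ now then
    ({ s with tran.deadline := none, pers.lastAbort := max s.pers.lastAbort s.pers.view },
      toAll (.abort s.pers.view))
  else (s, [])

/-- A reboot erases the transient memory.  The party then continues in the view that it was in. -/
def onReboot (Δ now : ℝ) (s : State n V) : Eff n V :=
  if s.pers.decided = none then
    ({ s with tran := { Transient.empty with deadline := some (now + 11 * Δ) } },
      toAll (.recover s.pers.view) ++ toAll (.request s.pers.view))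
  else ({ s with tran := Transient.empty }, [])

inductive Action (n : ℕ) (V : Type*) where
  | idle
  /-- The message `m`, with sender `src`, reaches `dst`. -/
  | deliver (src dst : Fin n) (m : Msg V)
  | timer (i : Fin n)
  | reboot (i : Fin n)

/-- The effect of an action on party `i`. -/
def perform (f : ℕ) (Δ now : ℝ) (pick : Finset (Fin n) → Fin n) (i : Fin n) (s : State n V) :
    Action n V → Eff n V
  | .idle => (s, [])
  | .deliver src dst m => if dst = i then receive f Δ now pick i src m s else (s, [])
  | .timer j => if j = i then onTimer now s else (s, [])
  | .reboot j => if j = i then onReboot Δ now s else (s, [])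

/-! ## Executions in partial synchrony -/

/-- The data of an execution: a sequence of events.  Event `k` happens at time `time k`, it consists
of the action `act k`, `state k i` is the state of party `i` right after it, and `sends k i` are the
messages that party `i` sends in it. Event `0` is the beginning of the execution. -/
structure Execution (n : ℕ) (V : Type*) where
  faulty : Finset (Fin n)
  gst : ℝ
  /-- `clock i t` is what the local clock of party `i` shows at time `t`. -/
  clock : Fin n → ℝ → ℝ
  time : ℕ → ℝ
  act : ℕ → Action n V
  pick : ℕ → Finset (Fin n) → Fin n
  state : ℕ → Fin n → State n V
  sends : ℕ → Fin n → List (Fin n × Msg V)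

/-- All messages between nonfaulty parties that are sent from the time `gst` on arrive within `δ`
time, and those sent previously arrive within `δ` time after `gst`. -/
def Execution.DeliversWithin (E : Execution n V) (δ : ℝ) : Prop :=
  ∀ k, ∀ i ∉ E.faulty, ∀ j ∉ E.faulty, ∀ m, (j, m) ∈ E.sends k i →
    ∃ k' > k, E.act k' = .deliver i j m ∧ E.time k' ≤ max (E.time k) E.gst + δ

/-- `E` is an execution of the algorithm with inputs `x` in a partially synchronous system with
authenticated channels, at most `f` Byzantine parties and known delay bound `Δ`.  Faulty parties are
not constrained at all: whatever they like may be delivered in their name. -/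
structure IsRun (f : ℕ) (Δ : ℝ) (x : Fin n → V) (E : Execution n V) : Prop where
  card_faulty : E.faulty.card ≤ f
  gst_nonneg : 0 ≤ E.gst
  /-- From `gst` on, the clocks are synchronized; before, they show anything. -/
  clock_sync : ∀ i ∉ E.faulty, ∀ t, E.gst ≤ t → E.clock i t = t
  time_zero : E.time 0 = 0
  time_mono : Monotone E.time
  time_unbounded : ∀ t, ∃ k, t < E.time k
  pick_mem : ∀ k S, S.Nonempty → E.pick k S ∈ S
  act_zero : E.act 0 = .idle
  start : ∀ i ∉ E.faulty,
    (E.state 0 i, E.sends 0 i) = startParty Δ (E.clock i (E.time 0)) (x i)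
  step : ∀ k, ∀ i ∉ E.faulty,
    (E.state (k + 1) i, E.sends (k + 1) i) =
      perform f Δ (E.clock i (E.time (k + 1))) (E.pick (k + 1)) i (E.state k i) (E.act (k + 1))
  /-- Only what a nonfaulty party has sent to `j` can arrive at `j` in its name. -/
  authentic : ∀ k, ∀ i ∉ E.faulty, ∀ j m, E.act k = .deliver i j m →
    ∃ k' < k, (j, m) ∈ E.sends k' i
  delivery : E.DeliversWithin Δ
  /-- From `gst` on, no time passes while the timer of a running party is due. -/
  timers : ∀ k t, E.gst ≤ t → E.time k ≤ t → t < E.time (k + 1) → ∀ i ∉ E.faulty,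
    (E.state k i).pers.decided = none →
      ∀ d ∈ (E.state k i).tran.deadline, E.clock i t < d

/-! ## Complexity measures -/

/-- The number of words in the messages other than `abort` messages that party `i` sends to party
`j` while the variable `view` of `i` equals `v`, in the events up to `K`. -/
def Execution.viewWords (E : Execution n V) (i j : Fin n) (v K : ℕ) : ℕ :=
  ∑ k ∈ Finset.range (K + 1),
    (((E.sends k i).filter fun q =>
      q.1 = j ∧ ¬ q.2.IsAbort ∧ (E.state k i).pers.view = v).map fun q => q.2.words).sum

/-- The number of words in the messages `⟨abort, v⟩` that party `i` sends to party `j`, in the events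
up to `K`. -/
def Execution.abortWords (E : Execution n V) (i j : Fin n) (v K : ℕ) : ℕ :=
  ∑ k ∈ Finset.range (K + 1),
    (((E.sends k i).filter fun q => q = (j, .abort v)).map fun q => q.2.words).sum

/-- Event `k` is a reboot of party `i`, or the arrival at `i` of a request of the rebooted party `j`
for the messages that `i` sent. -/
def Execution.IsRecovery (E : Execution n V) (i j : Fin n) (k : ℕ) : Prop :=
  E.act k = .reboot i ∨ ∃ u, E.act k = .deliver j i (.recover u)

/-- The number of recovery events up to `K`. -/
def Execution.recoveries (E : Execution n V) (i j : Fin n) (K : ℕ) : ℕ :=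
  ((Finset.range (K + 1)).filter fun k => E.IsRecovery i j k).card

/-- The number of recovery events up to `K` that happen while the view of `i` is `v`. -/
def Execution.recoveriesInView (E : Execution n V) (i j : Fin n) (v K : ℕ) : ℕ :=
  ((Finset.range (K + 1)).filter fun k =>
    E.IsRecovery i j k ∧ (E.state k i).pers.view = v).card

/-- View `v` starts with event `k`: this is the first event after which the view of some nonfaulty
party is at least `v`. -/
def Execution.StartsAt (E : Execution n V) (v k : ℕ) : Prop :=
  (∃ i ∉ E.faulty, v ≤ (E.state k i).pers.view) ∧
    ∀ k' < k, ∀ i ∉ E.faulty, (E.state k' i).pers.view < v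

end ITHS

end

noncomputable section

namespace ITHS

open scoped Classical

variable {n : ℕ} {V : Type*}

/-! ## Sizes of messages and of the memory -/

/-! The memory of a party is treated in two layers. The persistent layer changes only by guarded
elementary steps (`PStep`), each caused by what the transient layer holds. The transient layer
holds, for nonfaulty senders, only messages that the persistent memory of the sender once showed
(`TranSound`). The safety invariant `PSound` speaks of the histories of persistent memories alone,
so reboots, which leave the persistent layer as it is, cannot hurt it.

Agreement rests on quorum intersection: since n > 3f, two sets of n - f parties share a nonfaulty
party, so each round of each view has at most one value with a quorum. A `done` message goes back to
a quorum of lock votes, say for a in view v. If a later view had an echo quorum for another value, a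
common nonfaulty party would have echoed it while holding a lock from view v or later, which by
induction is a lock on a. To open this lock it needs a proof of some nonfaulty party, whose `key1`
record witnesses an echo quorum for a value other than a in a view at least v. That quorum is older,
so induction over the events excludes it (`IsRun.eq_of_lock_quorum`).

A record (key, val, prev) replaces the unbounded history of accepted values. A party that accepted z
in view u supports z at u ever after: either its value is still z with a key at least u, or prev is
at least u, and then two different values have had quorums since u (`RecSound.update`,
`SupportsKey.update`). Of two different values one differs from any given locked value, which is
what opening a lock requires.

Liveness in a view with a nonfaulty primary uses the chain lock, key3, key2, key1: each level is set
on a quorum of votes of the level below. Hence the suggestions of all nonfaulty parties are accepted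
(`IsPromptView.sentPropose_ne_none`), the maximal suggested key is at least every earlier lock, and
the record that justified it leads to proofs that open the locks on other values
(`IsPromptView.canEcho`). Counted in periods of length δ after the start T of the view, all parties
have entered it after 2, joined after 3, the primary has proposed after 4, echoes are out after 5,
the further rounds take one period each, `done` messages are out after 10 and all have decided after
12. No timer of the view interferes before T + 11Δ. If somebody decides before period 10 ends, f + 1
nonfaulty parties have sent `done`, and two further periods suffice as well.

Communication is bounded by a potential: every message slot of a view is filled once and each party
joins once, so a constant budget pays for everything except recoveries, each of which adds at most a
constant. -/

theorem Msg.words_le_seven (m : Msg V) : m.words ≤ 7 := by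
  cases m <;> simp [Msg.words, Msg.encode, Suggestion.encode, KeyRec.encode]

theorem length_encodeOption_le {α : Type*} {enc : α → List (Word V)} {c : ℕ}
    (h : ∀ a, (enc a).length ≤ c) (hc : 1 ≤ c) (o : Option α) :
    (encodeOption enc o).length ≤ c := by
  cases o with
  | none => simpa [encodeOption] using hc
  | some a => exact h a

theorem length_encodeArray_le {α : Type*} {enc : α → List (Word V)} {c : ℕ}
    (h : ∀ a, (enc a).length ≤ c) (a : Fin n → α) :
    (encodeArray enc a).length ≤ n * c := by
  have := List.sum_le_card_nsmul ((List.ofFn a).map fun b => (enc b).length) c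
    (by simp only [List.mem_map]; rintro x ⟨b, -, rfl⟩; exact h b)
  simpa [encodeArray, List.length_flatMap] using this

/-- The summands are five scalar fields, two key records of 3 words, a suggestion of 5, a proof of
3, a proposal of 2, five votes, and one word each for `doneSent`, `lastAbort` and `decided`. -/
theorem State.persistentWords_le (s : State n V) : s.persistentWords ≤ 29 := by
  have h1 := length_encodeOption_le (V := V) (enc := Suggestion.encode) (c := 5)
    (by simp [Suggestion.encode, KeyRec.encode]) (by simp) s.pers.sentSuggest
  have h2 := length_encodeOption_le (V := V) (enc := KeyRec.encode) (c := 3)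
    (by simp [KeyRec.encode]) (by simp) s.pers.sentProof
  have h3 := length_encodeOption_le (V := V)
    (enc := fun q : ℤ × V => [.counter q.1, .value q.2]) (c := 2) (by simp) (by simp)
    s.pers.sentPropose
  have h4 (o : Option V) := length_encodeOption_le (V := V) (enc := fun x : V => [.value x]) (c := 1)
    (by simp) (by simp) o
  have h5 := h4 (s.pers.sentVote .echo)
  have h6 := h4 (s.pers.sentVote .key1)
  have h7 := h4 (s.pers.sentVote .key2)
  have h8 := h4 (s.pers.sentVote .key3)
  have h9 := h4 (s.pers.sentVote .lock)
  have h10 := h4 s.pers.doneSent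
  have h11 := h4 s.pers.decided
  simp only [State.persistentWords, Persistent.encode, KeyRec.encode, Round.all, List.length_append,
    List.length_cons, List.length_nil, List.flatMap_cons, List.flatMap_nil] at *
  omega

/-- The arrays take 16n words, the deadline and the proposal 3, the persistent part 29; positivity
of n absorbs the additive constants. -/
theorem State.totalWords_le (hn : 0 < n) (s : State n V) : s.totalWords ≤ 50 * n := by
  have h0 := s.persistentWords_le
  have h1 := length_encodeArray_le (V := V) (enc := encodeOption Suggestion.encode) (c := 5)
    (length_encodeOption_le (by simp [Suggestion.encode, KeyRec.encode]) (by simp))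
    s.tran.suggestFrom
  have h2 := length_encodeArray_le (V := V) (enc := encodeOption KeyRec.encode) (c := 3)
    (length_encodeOption_le (by simp [KeyRec.encode]) (by simp)) s.tran.proofFrom
  have h3 := length_encodeOption_le (V := V)
    (enc := fun q : ℤ × V => [.counter q.1, .value q.2]) (c := 2) (by simp) (by simp)
    s.tran.proposal
  have h4 (a : Fin n → Option V) := length_encodeArray_le (V := V)
    (enc := encodeOption fun x : V => [.value x]) (c := 1)
    (length_encodeOption_le (by simp) (by simp)) a
  have h5 := h4 (s.tran.voteFrom .echo)
  have h6 := h4 (s.tran.voteFrom .key1)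
  have h7 := h4 (s.tran.voteFrom .key2)
  have h8 := h4 (s.tran.voteFrom .key3)
  have h9 := h4 (s.tran.voteFrom .lock)
  have h10 := h4 s.tran.doneFrom
  have h11 (a : Fin n → ℕ) := length_encodeArray_le (V := V)
    (enc := fun v : ℕ => [.counter v]) (c := 1) (by simp) a
  have h12 := h11 s.tran.highestRequest
  have h13 := h11 s.tran.highestAbort
  have h14 := length_encodeOption_le (V := V) (enc := fun d : ℝ => [.clock d]) (c := 1)
    (by simp) (by simp) s.tran.deadline
  simp only [State.persistentWords, State.totalWords, Transient.encode, Round.all,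
    List.length_append, List.flatMap_cons, List.flatMap_nil, List.length_nil] at *
  omega

/-! ## Counting -/

/-- Turns order statistics into counting, the only form in which they are used. Positivity of t
matters because the supremum over an empty set is 0. -/
theorem le_kthLargest_iff {k : ℕ} {a : Fin n → ℕ} {t : ℕ} (ht : 0 < t) (hk : 0 < k) :
    t ≤ kthLargest k a ↔ k ≤ (Finset.univ.filter fun l => t ≤ a l).card := by
  constructor
  · intro h
    rw [kthLargest, Finset.le_sup_iff (by simpa using ht)] at h
    obtain ⟨j, hj, hjt⟩ := h
    refine le_trans (Finset.mem_filter.1 hj).2 (Finset.card_le_card fun l hl => ?_)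
    simp only [Finset.mem_filter, Finset.mem_univ, true_and] at hl ⊢
    omega
  · intro h
    have hne : (Finset.univ.filter fun l => t ≤ a l).Nonempty :=
      Finset.card_pos.1 (by omega)
    -- The smallest entry that is at least t has all the k counted entries above or equal to it.
    obtain ⟨j, hj, hmin⟩ := Finset.exists_min_image _ a hne
    simp only [Finset.mem_filter, Finset.mem_univ, true_and] at hj hmin
    rw [kthLargest, Finset.le_sup_iff (by simpa using ht)]
    refine ⟨j, ?_, hj⟩
    simp only [Finset.mem_filter, Finset.mem_univ, true_and]
    refine h.trans (Finset.card_le_card fun l hl => ?_)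
    simp only [Finset.mem_filter, Finset.mem_univ, true_and] at hl ⊢
    exact hmin l hl

theorem kthLargest_zero (k : ℕ) : kthLargest k (fun _ : Fin n => 0) = 0 := by
  simp [kthLargest]

theorem exists_notMem_of_card_lt {α : Type*} {A F : Finset α} (h : F.card < A.card) :
    ∃ j ∈ A, j ∉ F := by
  by_contra! hc
  exact absurd (Finset.card_le_card hc) (by omega)

/-- Two quorums of `n - f` parties share a nonfaulty party. -/
theorem exists_common_notMem {f : ℕ} (hf : 3 * f < n) {F A B : Finset (Fin n)} (hF : F.card ≤ f)
    (hA : n - f ≤ A.card) (hB : n - f ≤ B.card) : ∃ j, j ∈ A ∧ j ∈ B ∧ j ∉ F := by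
  have h1 := Finset.card_union_add_card_inter A B
  have h2 : (A ∪ B).card ≤ n := by simpa using Finset.card_le_univ (A ∪ B)
  obtain ⟨j, hj, hjF⟩ := exists_notMem_of_card_lt (A := A ∩ B) (F := F) (by omega)
  exact ⟨j, (Finset.mem_inter.1 hj).1, (Finset.mem_inter.1 hj).2, hjF⟩

/-- Since n - 2f > f, every quorum contains enough nonfaulty parties to trigger the rules with
threshold f + 1. -/
theorem succ_le_card_sdiff {f : ℕ} (hf : 3 * f < n) {F A : Finset (Fin n)} (hF : F.card ≤ f)
    (hA : n - f ≤ A.card) : f + 1 ≤ (A \ F).card := by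
  have := Finset.le_card_sdiff F A
  omega

/-- The nonfaulty parties form a quorum on their own, so progress never depends on a faulty party.
-/
theorem sub_le_card_compl {f : ℕ} {F : Finset (Fin n)} (hF : F.card ≤ f) :
    n - f ≤ (Finset.univ \ F).card := by
  have := Finset.le_card_sdiff F Finset.univ
  simp only [Finset.card_univ, Fintype.card_fin] at this
  omega

/-! ## Parts of the memory that the handlers leave alone -/

@[simp] theorem trySuggest_tran (s : State n V) : (trySuggest s).1.tran = s.tran := by
  unfold trySuggest; split_ifs <;> rfl

@[simp] theorem sendVote_tran (r : Round) (x : V) (s : State n V) :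
    (sendVote r x s).1.tran = s.tran := rfl

@[simp] theorem tryEcho_tran (f : ℕ) (s : State n V) : (tryEcho f s).1.tran = s.tran := by
  unfold tryEcho; split <;> [split_ifs <;> rfl; rfl]

@[simp] theorem tryPropose_tran (f : ℕ) (pick : Finset (Fin n) → Fin n) (s : State n V) :
    (tryPropose f pick s).1.tran = s.tran := by
  unfold tryPropose; split_ifs <;> [split <;> rfl; rfl]

@[simp] theorem sendDone_tran (x : V) (s : State n V) : (sendDone x s).1.tran = s.tran := by
  unfold sendDone; split_ifs <;> rfl

@[simp] theorem onQuorum_tran (f : ℕ) (r : Round) (x : V) (s : State n V) :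
    (onQuorum f r x s).1.tran = s.tran := by
  unfold onQuorum
  cases r <;> simp only <;> (try split_ifs) <;> simp [Eff.andThen]

@[simp] theorem trySuggest_view (s : State n V) : (trySuggest s).1.pers.view = s.pers.view := by
  unfold trySuggest; split_ifs <;> rfl

@[simp] theorem sendVote_view (r : Round) (x : V) (s : State n V) :
    (sendVote r x s).1.pers.view = s.pers.view := rfl

@[simp] theorem tryEcho_view (f : ℕ) (s : State n V) :
    (tryEcho f s).1.pers.view = s.pers.view := by
  unfold tryEcho; split <;> [split_ifs <;> rfl; rfl]

@[simp] theorem tryPropose_view (f : ℕ) (pick : Finset (Fin n) → Fin n) (s : State n V) :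
    (tryPropose f pick s).1.pers.view = s.pers.view := by
  unfold tryPropose; split_ifs <;> [split <;> rfl; rfl]

@[simp] theorem sendDone_view (x : V) (s : State n V) :
    (sendDone x s).1.pers.view = s.pers.view := by
  unfold sendDone; split_ifs <;> rfl

@[simp] theorem onQuorum_view (f : ℕ) (r : Round) (x : V) (s : State n V) :
    (onQuorum f r x s).1.pers.view = s.pers.view := by
  unfold onQuorum
  cases r <;> simp only <;> (try split_ifs) <;> simp [Eff.andThen]

/-! ## Handlers in stages -/

/-- Here and below the handlers are cut into a recording of the message and a reaction to the
recorded state. The reactions are then analysed once, and the `_eq` lemmas hold by definition. -/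
def recordVote (r : Round) (j : Fin n) (x : V) (s : State n V) : State n V :=
  { s with
    tran.voteFrom := Function.update s.tran.voteFrom r
      (Function.update (s.tran.voteFrom r) j (some x)) }

theorem onVote_eq (f : ℕ) (r : Round) (j : Fin n) (x : V) (v : ℕ) (s : State n V) :
    onVote f r j x v s =
      if v = s.pers.view ∧ s.tran.voteFrom r j = none then
        if n - f ≤ count ((recordVote r j x s).tran.voteFrom r) x then
          onQuorum f r x (recordVote r j x s)
        else (recordVote r j x s, [])
      else (s, []) := rfl

def recordSuggest (j : Fin n) (g : Suggestion V) (s : State n V) : State n V :=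
  { s with tran.suggestFrom := Function.update s.tran.suggestFrom j (some g) }

theorem onSuggest_eq (f : ℕ) (i : Fin n) (pick : Finset (Fin n) → Fin n) (j : Fin n)
    (g : Suggestion V) (v : ℕ) (s : State n V) :
    onSuggest f i pick j g v s =
      if v = s.pers.view ∧ IsPrimary i v ∧ s.tran.suggestFrom j = none then
        tryPropose f pick (recordSuggest j g s)
      else (s, []) := rfl

def recordProposal (q : ℤ × V) (s : State n V) : State n V := { s with tran.proposal := some q }

theorem onPropose_eq (f : ℕ) (j : Fin n) (key : ℤ) (x : V) (v : ℕ) (s : State n V) :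
    onPropose f j key x v s =
      if v = s.pers.view ∧ IsPrimary j v ∧ s.tran.proposal = none then
        tryEcho f (recordProposal (key, x) s)
      else (s, []) := rfl

def recordProof (j : Fin n) (r : KeyRec V) (s : State n V) : State n V :=
  { s with tran.proofFrom := Function.update s.tran.proofFrom j (some r) }

theorem onProof_eq (f : ℕ) (j : Fin n) (r : KeyRec V) (v : ℕ) (s : State n V) :
    onProof f j r v s =
      if v = s.pers.view ∧ s.tran.proofFrom j = none then tryEcho f (recordProof j r s)
      else (s, []) := rfl

def recordDone (j : Fin n) (x : V) (s : State n V) : State n V :=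
  { s with tran.doneFrom := Function.update s.tran.doneFrom j (some x) }

/-- The reaction to `⟨done, x⟩` up to the decision. -/
def amplifyDone (f : ℕ) (j : Fin n) (x : V) (s : State n V) : Eff n V :=
  if f + 1 ≤ count (recordDone j x s).tran.doneFrom x then sendDone x (recordDone j x s)
  else (recordDone j x s, [])

def State.decide (x : V) (s : State n V) : State n V := { s with pers.decided := some x }

theorem onDone_eq (f : ℕ) (j : Fin n) (x : V) (s : State n V) :
    onDone f j x s =
      if s.tran.doneFrom j = none then
        if n - f ≤ count (recordDone j x s).tran.doneFrom x then
          ((amplifyDone f j x s).1.decide x, (amplifyDone f j x s).2)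
        else amplifyDone f j x s
      else (s, []) := rfl

@[simp] theorem amplifyDone_tran (f : ℕ) (j : Fin n) (x : V) (s : State n V) :
    (amplifyDone f j x s).1.tran = (recordDone j x s).tran := by
  unfold amplifyDone; split_ifs <;> simp

@[simp] theorem amplifyDone_view (f : ℕ) (j : Fin n) (x : V) (s : State n V) :
    (amplifyDone f j x s).1.pers.view = s.pers.view := by
  unfold amplifyDone; split_ifs <;> simp [recordDone]

def setAborts (a : Fin n → ℕ) (s : State n V) : State n V := { s with tran.highestAbort := a }

def raiseAbort (i : Fin n) (a : Fin n → ℕ) (u : ℕ) (s : State n V) : State n V :=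
  { s with
    tran.highestAbort := Function.update a i u
    pers.lastAbort := max s.pers.lastAbort u }

/-- The reaction to `⟨abort, v⟩` up to the change of the view. -/
def amplifyAbort (f : ℕ) (i j : Fin n) (v : ℕ) (s : State n V) : Eff n V :=
  if (Function.update s.tran.highestAbort j v) i <
      kthLargest (f + 1) (Function.update s.tran.highestAbort j v) then
    (raiseAbort i (Function.update s.tran.highestAbort j v)
      (kthLargest (f + 1) (Function.update s.tran.highestAbort j v)) s,
      toAll (.abort (kthLargest (f + 1) (Function.update s.tran.highestAbort j v))))
  else (setAborts (Function.update s.tran.highestAbort j v) s, [])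

theorem onAbort_eq (f : ℕ) (Δ now : ℝ) (i j : Fin n) (v : ℕ) (s : State n V) :
    onAbort f Δ now i j v s =
      if s.tran.highestAbort j < v then
        if s.pers.view ≤ kthLargest (n - f) (amplifyAbort f i j v s).1.tran.highestAbort then
          Eff.andThen (amplifyAbort f i j v s) (enterView Δ now
            (kthLargest (n - f) (amplifyAbort f i j v s).1.tran.highestAbort + 1))
        else amplifyAbort f i j v s
      else (s, []) := rfl

@[simp] theorem amplifyAbort_view (f : ℕ) (i j : Fin n) (v : ℕ) (s : State n V) :
    (amplifyAbort f i j v s).1.pers.view = s.pers.view := by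
  unfold amplifyAbort; split_ifs <;> rfl

def recordRequest (j : Fin n) (v : ℕ) (s : State n V) : State n V :=
  { s with tran.highestRequest := Function.update s.tran.highestRequest j v }

theorem onRequest_eq (j : Fin n) (v : ℕ) (s : State n V) :
    onRequest j v s =
      if s.tran.highestRequest j < v then
        if v = s.pers.view then
          Eff.andThen (recordRequest j v s, (currentMsgs s.pers j).map fun m => (j, m)) trySuggest
        else (recordRequest j v s, [])
      else (s, []) := rfl

/-- The state right after view `v` was entered. -/
def freshState (Δ now : ℝ) (v : ℕ) (s : State n V) : State n V :=
  { pers := { s.pers with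
      view := v
      sentSuggest := none
      sentProof := some s.pers.key1
      sentPropose := none
      sentVote := fun _ => none }
    tran := { (Transient.empty : Transient n V) with
      highestRequest := s.tran.highestRequest
      highestAbort := s.tran.highestAbort
      doneFrom := s.tran.doneFrom
      deadline := some (now + 11 * Δ) } }

theorem enterView_eq (Δ now : ℝ) (v : ℕ) (s : State n V) :
    enterView Δ now v s =
      Eff.andThen (freshState Δ now v s,
        toAll (.request v) ++ toJoined (freshState Δ now v s) (.proof s.pers.key1 v))
        trySuggest := rfl

@[simp] theorem enterView_tran (Δ now : ℝ) (v : ℕ) (s : State n V) :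
    (enterView Δ now v s).1.tran = (freshState Δ now v s).tran := by
  simp [enterView_eq, Eff.andThen]

@[simp] theorem enterView_view (Δ now : ℝ) (v : ℕ) (s : State n V) :
    (enterView Δ now v s).1.pers.view = v := by
  simp [enterView_eq, Eff.andThen, freshState]

/-! ## The persistent memory changes in elementary steps -/

/-- The condition under which the proposal `(key, x)` is echoed. -/
def CanEcho (f : ℕ) (s : State n V) (key : ℤ) (x : V) : Prop :=
  s.pers.lock = 0 ∨ x = s.pers.lockVal ∨ (key < s.pers.view ∧ s.pers.lock ≤ key ∧ OpenLock f s)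

/-- The elementary changes of the persistent memory of party `i`, each with its cause, where `t` is
the transient memory and `fired` says that the timer is due. -/
inductive PStep (f : ℕ) (i : Fin n) (fired : Prop) (t : Transient n V) :
    Persistent V → Persistent V → Prop
  | enter (p : Persistent V) (v : ℕ) (hv : p.view < v)
      (hw : v = kthLargest (n - f) t.highestAbort + 1) :
      PStep f i fired t p { p with
        view := v
        sentSuggest := none
        sentProof := some p.key1
        sentPropose := none
        sentVote := fun _ => none }
  | suggest (p : Persistent V) (h : p.sentSuggest = none) :
      PStep f i fired t p { p with sentSuggest := some ⟨p.key3, p.key3Val, p.key2⟩ }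
  | propose (p : Persistent V) (j : Fin n) (g : Suggestion V) (h : p.sentPropose = none)
      (hc : n - f ≤ (accepted f ⟨p, t⟩).card) (hj : j ∈ best f ⟨p, t⟩)
      (hg : t.suggestFrom j = some g) :
      PStep f i fired t p { p with sentPropose := some (g.key3, g.val3) }
  | echo (p : Persistent V) (key : ℤ) (x : V) (h : p.sentVote .echo = none)
      (hp : t.proposal = some (key, x)) (hc : CanEcho f ⟨p, t⟩ key x) :
      PStep f i fired t p { p with sentVote := Function.update p.sentVote .echo (some x) }
  | key1 (p : Persistent V) (x : V) (h : p.sentVote .key1 = none)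
      (hq : n - f ≤ count (t.voteFrom .echo) x) :
      PStep f i fired t p { p with
        key1 := p.key1.update x p.view
        sentVote := Function.update p.sentVote .key1 (some x) }
  | key2 (p : Persistent V) (x : V) (h : p.sentVote .key2 = none)
      (hq : n - f ≤ count (t.voteFrom .key1) x) :
      PStep f i fired t p { p with
        key2 := p.key2.update x p.view
        sentVote := Function.update p.sentVote .key2 (some x) }
  | key3 (p : Persistent V) (x : V) (h : p.sentVote .key3 = none)
      (hq : n - f ≤ count (t.voteFrom .key2) x) :
      PStep f i fired t p { p with
        key3 := p.view
        key3Val := x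
        sentVote := Function.update p.sentVote .key3 (some x) }
  | lock (p : Persistent V) (x : V) (h : p.sentVote .lock = none)
      (hq : n - f ≤ count (t.voteFrom .key3) x) :
      PStep f i fired t p { p with
        lock := p.view
        lockVal := x
        sentVote := Function.update p.sentVote .lock (some x) }
  | done (p : Persistent V) (x : V) (h : p.doneSent = none)
      (hq : n - f ≤ count (t.voteFrom .lock) x ∨ f + 1 ≤ count t.doneFrom x) :
      PStep f i fired t p { p with doneSent := some x }
  | decide (p : Persistent V) (x : V) (h : p.decided = none)
      (hq : n - f ≤ count t.doneFrom x) (hd : p.doneSent ≠ none) :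
      PStep f i fired t p { p with decided := some x }
  | abort (p : Persistent V) (u : ℕ)
      (hu : (fired ∧ u = p.view) ∨
        f + 1 ≤ (Finset.univ.filter fun j => j ≠ i ∧ u ≤ t.highestAbort j).card) :
      PStep f i fired t p { p with lastAbort := max p.lastAbort u }

/-- All elementary steps of one event refer to the same transient memory t, in the applications the
one after the event. This is legitimate because messages are recorded before the rules are applied,
and because the abort array, which justifies a change of view, survives that change. -/
abbrev PSteps (f : ℕ) (i : Fin n) (fired : Prop) (t : Transient n V) :
    Persistent V → Persistent V → Prop :=
  Relation.ReflTransGen (PStep f i fired t)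

theorem best_nonempty {f : ℕ} {s : State n V} (h : (accepted f s).Nonempty) :
    (best f s).Nonempty := by
  have key : ∀ l ∈ accepted f s, ∃ g, s.tran.suggestFrom l = some g := by
    intro l hl
    obtain ⟨g, hg, -⟩ := (Finset.mem_filter.1 hl).2
    exact ⟨g, hg⟩
  -- The default 0 is never used: every accepted party has a recorded suggestion.
  obtain ⟨j, hj, hmax⟩ := Finset.exists_max_image (accepted f s)
    (fun j => ((s.tran.suggestFrom j).map Suggestion.key3).getD 0) h
  obtain ⟨g, hg⟩ := key j hj
  refine ⟨j, Finset.mem_filter.2 ⟨hj, g, hg, fun l hl g' hg' => ?_⟩⟩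
  have := hmax l hl
  rw [Option.mem_def] at hg'
  simpa [hg, hg'] using this

section Steps

variable {f : ℕ} {i : Fin n} {fired : Prop}

theorem trySuggest_steps (t : Transient n V) (s : State n V) :
    PSteps f i fired t s.pers (trySuggest s).1.pers := by
  unfold trySuggest
  split_ifs with h
  · exact .single (.suggest s.pers h.1)
  · exact .refl

theorem tryPropose_steps {pick : Finset (Fin n) → Fin n} (hn : 0 < n - f)
    (hpick : ∀ S : Finset (Fin n), S.Nonempty → pick S ∈ S) (s : State n V) :
    PSteps f i fired s.tran s.pers (tryPropose f pick s).1.pers := by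
  unfold tryPropose
  split_ifs with h
  · split
    · next g hg =>
      have hne : (accepted f s).Nonempty := Finset.card_pos.1 (hn.trans_le h.2)
      exact .single (.propose s.pers _ g h.1 h.2 (hpick _ (best_nonempty hne)) hg)
    · exact .refl
  · exact .refl

theorem tryEcho_steps (s : State n V) :
    PSteps f i fired s.tran s.pers (tryEcho f s).1.pers := by
  unfold tryEcho
  split
  · next key x hp =>
    split_ifs with h
    · exact .single (.echo s.pers key x h.1 hp h.2)
    · exact .refl
  · exact .refl

theorem sendDone_steps {x : V} {s : State n V}
    (hq : n - f ≤ count (s.tran.voteFrom .lock) x ∨ f + 1 ≤ count s.tran.doneFrom x) :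
    PSteps f i fired s.tran s.pers (sendDone x s).1.pers := by
  unfold sendDone
  split_ifs with h
  · exact .single (.done s.pers x h hq)
  · exact .refl

theorem onQuorum_steps {r : Round} {x : V} {s : State n V}
    (hq : n - f ≤ count (s.tran.voteFrom r) x) :
    PSteps f i fired s.tran s.pers (onQuorum f r x s).1.pers := by
  unfold onQuorum
  cases r <;> simp only
  · split_ifs with h
    exacts [.single (.key1 s.pers x h hq), .refl]
  · split_ifs with h
    exacts [.single (.key2 s.pers x h hq), .refl]
  · split_ifs with h
    exacts [.single (.key3 s.pers x h hq), .refl]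
  · split_ifs with h
    -- The new lock may permit the echo of a proposal that was refused before, hence a possible
    -- second step.
    · exact .head (.lock s.pers x h hq)
        (tryEcho_steps (sendVote .lock x
          { s with pers.lock := s.pers.view, pers.lockVal := x }).1)
    · exact .refl
  · exact sendDone_steps (.inl hq)

theorem enterView_steps {Δ now : ℝ} {v : ℕ} {s : State n V} (hv : s.pers.view < v)
    (hw : v = kthLargest (n - f) s.tran.highestAbort + 1) :
    PSteps f i fired (enterView Δ now v s).1.tran s.pers (enterView Δ now v s).1.pers := by
  rw [enterView_tran]
  exact .head (.enter s.pers v hv hw) (trySuggest_steps _ (freshState Δ now v s))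

theorem amplifyAbort_steps {j : Fin n} {v : ℕ} {s : State n V} {t : Transient n V}
    (ht : t.highestAbort = (amplifyAbort f i j v s).1.tran.highestAbort) :
    PSteps f i fired t s.pers (amplifyAbort f i j v s).1.pers := by
  unfold amplifyAbort at *
  split_ifs at * with hau
  · refine .single (.abort s.pers _ (.inr ?_))
    set a := Function.update s.tran.highestAbort j v
    have := (le_kthLargest_iff (a := a) (k := f + 1) (t := kthLargest (f + 1) a) (by omega)
      (by omega)).1 le_rfl
    refine this.trans (Finset.card_le_card fun l hl => ?_)
    simp only [Finset.mem_filter, Finset.mem_univ, true_and] at hl ⊢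
    -- The own entry is below the amplified view, so the f + 1 witnesses are other parties, and
    -- raising the own entry does not touch them.
    have hli : l ≠ i := by rintro rfl; omega
    refine ⟨hli, ?_⟩
    rw [ht]
    simpa [hli, raiseAbort] using hl
  · exact .refl

theorem onAbort_steps {Δ now : ℝ} {j : Fin n} {v : ℕ} {s : State n V} :
    PSteps f i fired (onAbort f Δ now i j v s).1.tran s.pers
      (onAbort f Δ now i j v s).1.pers := by
  rw [onAbort_eq]
  split_ifs with h hw
  · refine (amplifyAbort_steps (j := j) (v := v) ?_).trans (enterView_steps ?_ rfl)
    · simp [Eff.andThen, freshState]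
    · simp only [amplifyAbort_view]; omega
  · exact amplifyAbort_steps rfl
  · exact .refl

theorem onDone_steps {j : Fin n} {x : V} {s : State n V} (hf : f + 1 ≤ n - f)
    (hd : s.pers.decided = none) :
    PSteps f i fired (onDone f j x s).1.tran s.pers (onDone f j x s).1.pers := by
  have key : PSteps f i fired (recordDone j x s).tran s.pers (amplifyDone f j x s).1.pers := by
    unfold amplifyDone
    split_ifs with h2
    · exact sendDone_steps (s := recordDone j x s) (.inr h2)
    · exact .refl
  rw [onDone_eq]
  split_ifs with h h3
  · simp only [State.decide, amplifyDone_tran]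
    refine key.tail (.decide _ x ?_ h3 ?_)
    · simp only [amplifyDone, sendDone]
      split_ifs <;> exact hd
    -- A quorum of `done` messages exceeds the threshold f + 1 of amplification, so a deciding party
    -- has sent its own `done`.
    · simp only [amplifyDone, if_pos (hf.trans h3), sendDone]
      split_ifs with h4
      · simp
      · exact h4
  · rw [amplifyDone_tran]
    exact key
  · exact .refl

theorem receive_steps {Δ now : ℝ} {pick : Finset (Fin n) → Fin n} {j : Fin n} {m : Msg V}
    {s : State n V} (hf : f + 1 ≤ n - f)
    (hpick : ∀ S : Finset (Fin n), S.Nonempty → pick S ∈ S) :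
    PSteps f i fired (receive f Δ now pick i j m s).1.tran s.pers
      (receive f Δ now pick i j m s).1.pers := by
  unfold receive
  cases m <;> simp only
  case recover => exact .refl
  all_goals split_ifs with hd
  all_goals try exact .refl
  · rw [onRequest_eq]
    split_ifs
    · simp only [Eff.andThen, trySuggest_tran]
      exact trySuggest_steps _ (recordRequest _ _ s)
    · exact .refl
    · exact .refl
  · unfold onSuggest
    split_ifs
    · rw [tryPropose_tran]
      exact tryPropose_steps (by omega) hpick _
    · exact .refl
  · unfold onPropose
    split_ifs
    · rw [tryEcho_tran]
      exact tryEcho_steps _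
    · exact .refl
  · unfold onProof
    split_ifs
    · rw [tryEcho_tran]
      exact tryEcho_steps _
    · exact .refl
  · rw [onVote_eq]
    split_ifs with h h2
    · rw [onQuorum_tran]
      exact onQuorum_steps h2
    · exact .refl
    · exact .refl
  · exact onDone_steps hf hd
  · exact onAbort_steps

end Steps

/-- Every event is a sequence of elementary steps. -/
theorem perform_steps {f : ℕ} {Δ now : ℝ} {pick : Finset (Fin n) → Fin n} {i : Fin n}
    {s : State n V} (a : Action n V) (hf : f + 1 ≤ n - f)
    (hpick : ∀ S : Finset (Fin n), S.Nonempty → pick S ∈ S) :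
    PSteps f i (a = .timer i ∧ ∃ d ∈ s.tran.deadline, d ≤ now) (perform f Δ now pick i s a).1.tran
      s.pers (perform f Δ now pick i s a).1.pers := by
  unfold perform
  cases a <;> simp only
  · exact .refl
  · split_ifs
    · exact receive_steps hf hpick
    · exact .refl
  · split_ifs with hi
    · subst hi
      unfold onTimer
      split_ifs with h
      · exact .single (.abort s.pers _ (.inl ⟨⟨rfl, h.2⟩, rfl⟩))
      · exact .refl
    · exact .refl
  · split_ifs
    · unfold onReboot
      split_ifs <;> exact .refl
    · exact .refl

/-! ## Changes of the transient memory -/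

/-- The array `highest_abort` of party `i` after the arrival of `⟨abort, v⟩` from `j`. -/
def raisedAborts (f : ℕ) (i j : Fin n) (v : ℕ) (a : Fin n → ℕ) : Fin n → ℕ :=
  if (Function.update a j v) i < kthLargest (f + 1) (Function.update a j v) then
    Function.update (Function.update a j v) i (kthLargest (f + 1) (Function.update a j v))
  else Function.update a j v

theorem amplifyAbort_tran (f : ℕ) (i j : Fin n) (v : ℕ) (s : State n V) :
    (amplifyAbort f i j v s).1.tran =
      { s.tran with highestAbort := raisedAborts f i j v s.tran.highestAbort } := by
  unfold amplifyAbort raisedAborts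
  split_ifs <;> rfl

theorem le_raisedAborts {f : ℕ} {i j : Fin n} {v : ℕ} {a : Fin n → ℕ} (h : a j < v) (l : Fin n) :
    a l ≤ raisedAborts f i j v a l := by
  have h1 : a l ≤ Function.update a j v l := by
    by_cases hl : l = j
    · subst hl; simpa using h.le
    · simp [hl]
  unfold raisedAborts
  split_ifs with h2
  · by_cases hl : l = i
    · subst hl; simpa using h1.trans h2.le
    · simpa [hl] using h1
  · exact h1

theorem le_raisedAborts_self {f : ℕ} {i j : Fin n} {v : ℕ} {a : Fin n → ℕ} :
    v ≤ raisedAborts f i j v a j := by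
  unfold raisedAborts
  split_ifs with h2
  · by_cases hl : j = i
    · subst hl
      simp only [Function.update_self] at h2 ⊢
      exact h2.le
    · simp [hl]
  · simp

/-- Raising the own entry to u, the (f+1)-st largest value, creates no entry above u, so the
(f+1)-st largest value stays at most u and amplification need not be repeated. -/
theorem kthLargest_raisedAborts_le {f : ℕ} {i j : Fin n} {v : ℕ} {a : Fin n → ℕ} :
    kthLargest (f + 1) (raisedAborts f i j v a) ≤ raisedAborts f i j v a i := by
  unfold raisedAborts
  set b := Function.update a j v
  split_ifs with h
  · by_contra! hc
    simp only [Function.update_self] at hc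
    set u := kthLargest (f + 1) b with hu
    have h1 := (le_kthLargest_iff (t := u + 1) (k := f + 1) (a := Function.update b i u) (by omega)
      (by omega)).1 hc
    have h2 : u + 1 ≤ kthLargest (f + 1) b := by
      refine (le_kthLargest_iff (by omega) (by omega)).2 (h1.trans (Finset.card_le_card ?_))
      intro l hl
      simp only [Finset.mem_filter, Finset.mem_univ, true_and] at hl ⊢
      by_cases hli : l = i
      · subst hli
        simp at hl
      · simpa [hli] using hl
    omega
  · omega

/-- Accounts for the origin of each entry, so that the entries of nonfaulty parties can be bounded
by what these parties have announced. -/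
theorem raisedAborts_le {f : ℕ} {i j : Fin n} {v : ℕ} {s : State n V} (l : Fin n) :
    raisedAborts f i j v s.tran.highestAbort l ≤ s.tran.highestAbort l ∨
      (l = j ∧ raisedAborts f i j v s.tran.highestAbort l = v) ∨
      (l = i ∧ raisedAborts f i j v s.tran.highestAbort l ≤
        (amplifyAbort f i j v s).1.pers.lastAbort) := by
  unfold raisedAborts amplifyAbort
  split_ifs with h2
  · by_cases hl : l = i
    · subst hl; simp [raiseAbort]
    · by_cases hlj : l = j
      · subst hlj; simp [hl]
      · simp [hl, hlj]
  · by_cases hlj : l = j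
    · subst hlj; simp
    · simp [hlj]

@[simp] theorem trySuggest_lastAbort (s : State n V) :
    (trySuggest s).1.pers.lastAbort = s.pers.lastAbort := by
  unfold trySuggest; split_ifs <;> rfl

@[simp] theorem enterView_lastAbort (Δ now : ℝ) (v : ℕ) (s : State n V) :
    (enterView Δ now v s).1.pers.lastAbort = s.pers.lastAbort := by
  simp [enterView_eq, Eff.andThen, freshState]

/-- The possible effects of the action `a` on the transient memory and the view of party `i`. -/
inductive TStep (f : ℕ) (Δ now : ℝ) (i : Fin n) (s : State n V) :
    Action n V → State n V → Prop
  | same {a : Action n V} {s' : State n V} (ht : s'.tran = s.tran)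
      (hv : s'.pers.view = s.pers.view) : TStep f Δ now i s a s'
  | request {s' : State n V} (j : Fin n) (v : ℕ) (h : s.tran.highestRequest j < v)
      (ht : s'.tran =
        { s.tran with highestRequest := Function.update s.tran.highestRequest j v })
      (hv : s'.pers.view = s.pers.view) :
      TStep f Δ now i s (.deliver j i (.request v)) s'
  | suggest {s' : State n V} (j : Fin n) (g : Suggestion V) (h : s.tran.suggestFrom j = none)
      (hi : IsPrimary i s.pers.view)
      (ht : s'.tran = { s.tran with suggestFrom := Function.update s.tran.suggestFrom j (some g) })
      (hv : s'.pers.view = s.pers.view) :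
      TStep f Δ now i s (.deliver j i (.suggest g s.pers.view)) s'
  | propose {s' : State n V} (j : Fin n) (k : ℤ) (x : V) (h : s.tran.proposal = none)
      (hj : IsPrimary j s.pers.view)
      (ht : s'.tran = { s.tran with proposal := some (k, x) })
      (hv : s'.pers.view = s.pers.view) :
      TStep f Δ now i s (.deliver j i (.propose k x s.pers.view)) s'
  | proof {s' : State n V} (j : Fin n) (r : KeyRec V) (h : s.tran.proofFrom j = none)
      (ht : s'.tran = { s.tran with proofFrom := Function.update s.tran.proofFrom j (some r) })
      (hv : s'.pers.view = s.pers.view) :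
      TStep f Δ now i s (.deliver j i (.proof r s.pers.view)) s'
  | vote {s' : State n V} (j : Fin n) (r : Round) (x : V) (h : s.tran.voteFrom r j = none)
      (ht : s'.tran = { s.tran with
        voteFrom := Function.update s.tran.voteFrom r
          (Function.update (s.tran.voteFrom r) j (some x)) })
      (hv : s'.pers.view = s.pers.view) :
      TStep f Δ now i s (.deliver j i (.vote r x s.pers.view)) s'
  | done {s' : State n V} (j : Fin n) (x : V) (h : s.tran.doneFrom j = none)
      (ht : s'.tran = { s.tran with doneFrom := Function.update s.tran.doneFrom j (some x) })
      (hv : s'.pers.view = s.pers.view) :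
      TStep f Δ now i s (.deliver j i (.done x)) s'
  | abort {s' : State n V} (j : Fin n) (v : ℕ) (h : s.tran.highestAbort j < v)
      (hl : s'.pers.lastAbort = (amplifyAbort f i j v s).1.pers.lastAbort)
      (ht : s'.tran = { s.tran with highestAbort := raisedAborts f i j v s.tran.highestAbort })
      (hk : kthLargest (n - f) (raisedAborts f i j v s.tran.highestAbort) < s.pers.view)
      (hv : s'.pers.view = s.pers.view) :
      TStep f Δ now i s (.deliver j i (.abort v)) s'
  | enter {s' : State n V} (j : Fin n) (v : ℕ) (h : s.tran.highestAbort j < v)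
      (hl : s'.pers.lastAbort = (amplifyAbort f i j v s).1.pers.lastAbort)
      (ht : s'.tran = { (Transient.empty : Transient n V) with
        highestRequest := s.tran.highestRequest
        highestAbort := raisedAborts f i j v s.tran.highestAbort
        doneFrom := s.tran.doneFrom
        deadline := some (now + 11 * Δ) })
      (hk : s.pers.view ≤ kthLargest (n - f) (raisedAborts f i j v s.tran.highestAbort))
      (hv : s'.pers.view =
        kthLargest (n - f) (raisedAborts f i j v s.tran.highestAbort) + 1) :
      TStep f Δ now i s (.deliver j i (.abort v)) s'
  | timer {s' : State n V} (ht : s'.tran = { s.tran with deadline := none })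
      (hv : s'.pers.view = s.pers.view) : TStep f Δ now i s (.timer i) s'
  | reboot {s' : State n V} (d : Option ℝ) (hd : ∀ t ∈ d, t = now + 11 * Δ)
      (ht : s'.tran = { (Transient.empty : Transient n V) with deadline := d })
      (hp : s'.pers = s.pers) : TStep f Δ now i s (.reboot i) s'

theorem perform_tStep (f : ℕ) (Δ now : ℝ) (pick : Finset (Fin n) → Fin n) (i : Fin n)
    (s : State n V) (a : Action n V) :
    TStep f Δ now i s a (perform f Δ now pick i s a).1 := by
  unfold perform
  cases a with
  | idle => exact .same rfl rfl
  | timer j =>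
    simp only
    split_ifs with h
    · subst h
      unfold onTimer
      split_ifs
      · exact .timer rfl rfl
      · exact .same rfl rfl
    · exact .same rfl rfl
  | reboot j =>
    simp only
    split_ifs with h
    · subst h
      unfold onReboot
      split_ifs
      · exact .reboot (some (now + 11 * Δ)) (by simp) rfl rfl
      · exact .reboot none (by simp) rfl rfl
    · exact .same rfl rfl
  | deliver j k m =>
    simp only
    split_ifs with h
    swap
    · exact .same rfl rfl
    subst h
    unfold receive
    cases m <;> simp only
    case recover => exact .same rfl rfl
    all_goals split_ifs with hd
    all_goals try exact .same rfl rfl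
    · rw [onRequest_eq]
      split_ifs with h1 h2
      · refine .request j _ h1 ?_ ?_ <;> simp [Eff.andThen, recordRequest]
      · exact .request j _ h1 rfl rfl
      · exact .same rfl rfl
    · unfold onSuggest
      split_ifs with h1
      · obtain ⟨rfl, h2, h3⟩ := h1
        refine .suggest j _ h3 h2 ?_ ?_ <;> simp
      · exact .same rfl rfl
    · unfold onPropose
      split_ifs with h1
      · obtain ⟨rfl, h2, h3⟩ := h1
        refine .propose j _ _ h3 h2 ?_ ?_ <;> simp
      · exact .same rfl rfl
    · unfold onProof
      split_ifs with h1
      · obtain ⟨rfl, h2⟩ := h1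
        refine .proof j _ h2 ?_ ?_ <;> simp
      · exact .same rfl rfl
    · rw [onVote_eq]
      split_ifs with h1 h2
      · obtain ⟨rfl, h3⟩ := h1
        refine .vote j _ _ h3 ?_ ?_ <;> simp [recordVote]
      · obtain ⟨rfl, h3⟩ := h1
        exact .vote j _ _ h3 rfl rfl
      · exact .same rfl rfl
    · rw [onDone_eq]
      split_ifs with h1 h2
      · refine .done j _ h1 ?_ ?_ <;> simp [recordDone, State.decide]
      · refine .done j _ h1 ?_ ?_ <;> simp [recordDone]
      · exact .same rfl rfl
    · rw [onAbort_eq]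
      split_ifs with h1 h2
      · refine .enter j _ h1 ?_ ?_ ?_ ?_ <;>
          simp [Eff.andThen, amplifyAbort_tran, freshState] at h2 ⊢
        exact h2
      · refine .abort j _ h1 rfl ?_ ?_ ?_ <;> simp [amplifyAbort_tran] at h2 ⊢
        exact h2
      · exact .same rfl rfl

namespace TStep

variable {f : ℕ} {Δ now : ℝ} {i : Fin n} {s s' : State n V} {a : Action n V}

/-- Entering a view empties the array, so a filled entry certifies that the view did not change in
this step. Recorded votes therefore always belong to the current view. -/
theorem voteFrom_eq (h : TStep f Δ now i s a s') {r : Round} {j : Fin n} {x : V}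
    (hx : s'.tran.voteFrom r j = some x) :
    s'.pers.view = s.pers.view ∧
      (s.tran.voteFrom r j = some x ∨ a = .deliver j i (.vote r x s'.pers.view)) := by
  cases h with
  | vote j' r' x' h ht hv =>
    rw [ht] at hx
    simp only [Function.update_apply] at hx
    split_ifs at hx with h1
    · subst h1
      simp only [Function.update_apply] at hx
      split_ifs at hx with h2
      · subst h2; exact ⟨hv, .inr (by simp_all)⟩
      · exact ⟨hv, .inl hx⟩
    · exact ⟨hv, .inl hx⟩
  | _ => simp_all [Transient.empty]

theorem proofFrom_eq (h : TStep f Δ now i s a s') {j : Fin n} {r : KeyRec V}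
    (hx : s'.tran.proofFrom j = some r) :
    s'.pers.view = s.pers.view ∧
      (s.tran.proofFrom j = some r ∨ a = .deliver j i (.proof r s'.pers.view)) := by
  cases h with
  | proof j' r' h ht hv =>
    rw [ht] at hx
    simp only [Function.update_apply] at hx
    split_ifs at hx with h1
    · subst h1; exact ⟨hv, .inr (by simp_all)⟩
    · exact ⟨hv, .inl hx⟩
  | _ => simp_all [Transient.empty]

theorem suggestFrom_eq (h : TStep f Δ now i s a s') {j : Fin n} {g : Suggestion V}
    (hx : s'.tran.suggestFrom j = some g) :
    s'.pers.view = s.pers.view ∧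
      (s.tran.suggestFrom j = some g ∨ a = .deliver j i (.suggest g s'.pers.view)) := by
  cases h with
  | suggest j' r' h hi ht hv =>
    rw [ht] at hx
    simp only [Function.update_apply] at hx
    split_ifs at hx with h1
    · subst h1; exact ⟨hv, .inr (by simp_all)⟩
    · exact ⟨hv, .inl hx⟩
  | _ => simp_all [Transient.empty]

theorem proposal_eq (h : TStep f Δ now i s a s') {q : ℤ × V}
    (hx : s'.tran.proposal = some q) :
    s'.pers.view = s.pers.view ∧ (s.tran.proposal = some q ∨
      ∃ j, IsPrimary j s'.pers.view ∧ a = .deliver j i (.propose q.1 q.2 s'.pers.view)) := by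
  cases h with
  | propose j' k x h hi ht hv =>
    rw [ht] at hx
    simp only [Option.some.injEq] at hx
    subst hx
    refine ⟨hv, .inr ⟨j', ?_, ?_⟩⟩
    · rw [hv]; exact hi
    · rw [hv]
  | _ => simp_all [Transient.empty]

theorem doneFrom_eq (h : TStep f Δ now i s a s') {j : Fin n} {x : V}
    (hx : s'.tran.doneFrom j = some x) :
    s.tran.doneFrom j = some x ∨ a = .deliver j i (.done x) := by
  cases h with
  | done j' r' h ht hv =>
    rw [ht] at hx
    simp only [Function.update_apply] at hx
    split_ifs at hx with h1
    · subst h1; right; simp_all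
    · exact .inl hx
  | _ => simp_all [Transient.empty]

theorem highestRequest_le (h : TStep f Δ now i s a s') (j : Fin n) :
    s'.tran.highestRequest j ≤ s.tran.highestRequest j ∨
      a = .deliver j i (.request (s'.tran.highestRequest j)) := by
  cases h with
  | request j' v h ht hv =>
    rw [ht]
    simp only [Function.update_apply]
    split_ifs with h1
    · subst h1; simp
    · exact .inl le_rfl
  | _ => simp_all [Transient.empty]

theorem highestAbort_le (h : TStep f Δ now i s a s') (j : Fin n) :
    s'.tran.highestAbort j ≤ s.tran.highestAbort j ∨
      a = .deliver j i (.abort (s'.tran.highestAbort j)) ∨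
      (j = i ∧ s'.tran.highestAbort j ≤ s'.pers.lastAbort) := by
  cases h with
  | abort j' v h hl ht hk hv =>
    rw [ht, hl]
    rcases raisedAborts_le (f := f) (i := i) (j := j') (v := v) (s := s) j with h | ⟨rfl, h⟩ | h
    · exact .inl h
    · right; left; simp [h]
    · exact .inr (.inr h)
  | enter j' v h hl ht hk hv =>
    rw [ht, hl]
    rcases raisedAborts_le (f := f) (i := i) (j := j') (v := v) (s := s) j with h | ⟨rfl, h⟩ | h
    · exact .inl h
    · right; left; simp [h]
    · exact .inr (.inr h)
  | _ => simp_all [Transient.empty]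

theorem deadline_eq (h : TStep f Δ now i s a s') {d : ℝ} (hd : s'.tran.deadline = some d) :
    (s'.pers.view = s.pers.view ∧ s.tran.deadline = some d) ∨ d = now + 11 * Δ := by
  cases h with
  | reboot d' hd' ht hp => right; exact hd' d (by simpa [ht] using hd)
  | enter j v h hl ht hk hv => right; simpa [ht, eq_comm] using hd
  | _ => simp_all

/-! Without reboots nothing that was received is forgotten, except when the view changes. -/

theorem voteFrom_mono (h : TStep f Δ now i s a s') (ha : a ≠ .reboot i)
    (hv : s'.pers.view = s.pers.view) {r : Round} {j : Fin n} (hx : s.tran.voteFrom r j ≠ none) :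
    s'.tran.voteFrom r j ≠ none := by
  cases h with
  | vote j' r' x' h ht hv =>
    rw [ht]
    by_cases h1 : r = r'
    · subst h1
      by_cases h2 : j = j'
      · subst h2; simp
      · simpa [h2] using hx
    · simpa [h1] using hx
  | enter j v h hl ht hk hv' => omega
  | reboot => exact absurd rfl ha
  | _ => simp_all

theorem proofFrom_mono (h : TStep f Δ now i s a s') (ha : a ≠ .reboot i)
    (hv : s'.pers.view = s.pers.view) {j : Fin n} (hx : s.tran.proofFrom j ≠ none) :
    s'.tran.proofFrom j ≠ none := by
  cases h with
  | proof j' r' h ht hv =>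
    rw [ht]
    by_cases h2 : j = j'
    · subst h2; simp
    · simpa [h2] using hx
  | enter j v h hl ht hk hv' => omega
  | reboot => exact absurd rfl ha
  | _ => simp_all

theorem suggestFrom_mono (h : TStep f Δ now i s a s') (ha : a ≠ .reboot i)
    (hv : s'.pers.view = s.pers.view) {j : Fin n} (hx : s.tran.suggestFrom j ≠ none) :
    s'.tran.suggestFrom j ≠ none := by
  cases h with
  | suggest j' r' h hi ht hv =>
    rw [ht]
    by_cases h2 : j = j'
    · subst h2; simp
    · simpa [h2] using hx
  | enter j v h hl ht hk hv' => omega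
  | reboot => exact absurd rfl ha
  | _ => simp_all

theorem proposal_mono (h : TStep f Δ now i s a s') (ha : a ≠ .reboot i)
    (hv : s'.pers.view = s.pers.view) (hx : s.tran.proposal ≠ none) :
    s'.tran.proposal ≠ none := by
  cases h with
  | enter j v h hl ht hk hv' => omega
  | reboot => exact absurd rfl ha
  | _ => simp_all

theorem doneFrom_mono (h : TStep f Δ now i s a s') (ha : a ≠ .reboot i)
    {j : Fin n} (hx : s.tran.doneFrom j ≠ none) : s'.tran.doneFrom j ≠ none := by
  cases h with
  | done j' r' h ht hv =>
    rw [ht]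
    by_cases h2 : j = j'
    · subst h2; simp
    · simpa [h2] using hx
  | reboot => exact absurd rfl ha
  | _ => simp_all

theorem highestRequest_mono (h : TStep f Δ now i s a s') (ha : a ≠ .reboot i) (j : Fin n) :
    s.tran.highestRequest j ≤ s'.tran.highestRequest j := by
  cases h with
  | request j' v h ht hv =>
    rw [ht]
    by_cases h2 : j = j'
    · subst h2; simpa using h.le
    · simp [h2]
  | reboot => exact absurd rfl ha
  | _ => simp_all

theorem highestAbort_mono (h : TStep f Δ now i s a s') (ha : a ≠ .reboot i) (j : Fin n) :
    s.tran.highestAbort j ≤ s'.tran.highestAbort j := by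
  cases h with
  | abort j' v h hl ht hk hv => rw [ht]; exact le_raisedAborts h j
  | enter j' v h hl ht hk hv => rw [ht]; exact le_raisedAborts h j
  | reboot => exact absurd rfl ha
  | _ => simp_all

end TStep

/-! ## Monotonicity of the persistent memory -/

/-- What the persistent memory shows about a message that was sent. -/
def Persistent.Backs (p : Persistent V) : Msg V → Prop
  | .request u => u = p.view
  | .suggest g u => u = p.view ∧ p.sentSuggest = some g
  | .propose k x u => u = p.view ∧ p.sentPropose = some (k, x)
  | .proof r u => u = p.view ∧ p.sentProof = some r
  | .vote r x u => u = p.view ∧ p.sentVote r = some x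
  | .done x => p.doneSent = some x
  | .abort u => u ≤ p.lastAbort
  | .recover _ => True

section PStep

variable {f : ℕ} {i : Fin n} {fired : Prop} {t : Transient n V} {p p' : Persistent V}

theorem PStep.view_le (h : PStep f i fired t p p') : p.view ≤ p'.view := by
  cases h <;> first | exact le_rfl | exact le_of_lt ‹_›

theorem PSteps.view_le (h : PSteps f i fired t p p') : p.view ≤ p'.view := by
  induction h with
  | refl => exact le_rfl
  | tail _ h ih => exact ih.trans h.view_le

theorem PSteps.lastAbort_le (h : PSteps f i fired t p p') : p.lastAbort ≤ p'.lastAbort := by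
  induction h with
  | refl => exact le_rfl
  | tail _ h ih => refine ih.trans ?_; cases h <;> simp

theorem PSteps.doneSent_eq (h : PSteps f i fired t p p') {x : V} (hx : p.doneSent = some x) :
    p'.doneSent = some x := by
  induction h with
  | refl => exact hx
  | tail _ h ih => cases h <;> simp_all

theorem PSteps.decided_eq (h : PSteps f i fired t p p') {x : V} (hx : p.decided = some x) :
    p'.decided = some x := by
  induction h with
  | refl => exact hx
  | tail _ h ih => cases h <;> simp_all

/-- The guards of the steps demand that a message slot is empty before it is filled, so within a
view no slot is overwritten; `lastAbort` only grows. -/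
theorem PStep.backs (h : PStep f i fired t p p') (hv : p'.view = p.view) {m : Msg V}
    (hm : p.Backs m) : p'.Backs m := by
  cases h
  case enter v hlt hw => simp only at hv; omega
  all_goals cases m <;> simp only [Persistent.Backs] at hm ⊢ <;> first | exact hm | skip
  all_goals first
    | (obtain ⟨h1, h2⟩ := hm; simp_all; done)
    | (refine ⟨hm.1, ?_⟩
       rw [Function.update_of_ne, hm.2]
       rintro rfl
       simp_all)
    | simp_all

theorem PSteps.backs (h : PSteps f i fired t p p') (hv : p'.view = p.view) {m : Msg V}
    (hm : p.Backs m) : p'.Backs m := by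
  induction h with
  | refl => exact hm
  | tail h1 h ih =>
    have h2 := PSteps.view_le h1
    have h3 := h.view_le
    exact h.backs (by omega) (ih (by omega))

end PStep

/-! ## The messages sent -/

theorem mem_toAll {j : Fin n} {m m' : Msg V} : (j, m) ∈ toAll m' ↔ m = m' := by
  simp [toAll, eq_comm]

theorem mem_toJoined {s : State n V} {j : Fin n} {m m' : Msg V} :
    (j, m) ∈ toJoined s m' ↔ s.tran.highestRequest j = s.pers.view ∧ m = m' := by
  simp [toJoined, eq_comm]

/-- The messages that are sent to `j` when it joins the view. -/
def Msg.IsMeantFor (j : Fin n) : Msg V → Prop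
  | .suggest _ u => IsPrimary j u
  | .propose _ _ _ => True
  | .proof _ _ => True
  | .vote _ _ _ => True
  | _ => False

theorem Round.mem_all (r : Round) : r ∈ Round.all := by cases r <;> simp [Round.all]

theorem mem_currentMsgs {p : Persistent V} {j : Fin n} {m : Msg V} :
    m ∈ currentMsgs p j ↔ m.IsMeantFor j ∧ p.Backs m := by
  unfold currentMsgs
  have hite : ∀ l : List (Msg V), (m ∈ if IsPrimary j p.view then l else []) ↔
      IsPrimary j p.view ∧ m ∈ l := by
    intro l
    split_ifs with h
    · exact ⟨fun h' => ⟨h, h'⟩, fun h' => h'.2⟩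
    · exact ⟨fun h' => by simp at h', fun h' => absurd h'.1 h⟩
  simp only [List.mem_append, hite]
  cases m <;>
    simp [Msg.IsMeantFor, Persistent.Backs, Round.mem_all, and_comm, eq_comm]
  rintro rfl; simp

/-- This traces messages to the memory of their sender, so that histories can be read off the states
and the lists of sent messages are no longer needed for safety. -/
def Eff.Sound (e : Eff n V) : Prop := ∀ q ∈ e.2, e.1.pers.Backs q.2

/-- The recipients that have joined get all the new messages of the view. -/
def Eff.Covers (s : State n V) (e : Eff n V) : Prop :=
  ∀ j m, s.tran.highestRequest j = s.pers.view → m ∈ currentMsgs e.1.pers j →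
    m ∈ currentMsgs s.pers j ∨ (j, m) ∈ e.2

/-- The last `done` and the highest `abort` are sent to all. -/
structure Eff.Announces (s : State n V) (e : Eff n V) : Prop where
  done : ∀ x, e.1.pers.doneSent = some x → s.pers.doneSent = some x ∨ ∀ j, (j, Msg.done x) ∈ e.2
  abort : e.1.pers.lastAbort = s.pers.lastAbort ∨
    ∀ j, (j, Msg.abort e.1.pers.lastAbort) ∈ e.2

structure Eff.Good (s : State n V) (e : Eff n V) : Prop where
  sound : e.Sound
  covers : e.Covers s
  announces : e.Announces s

namespace Eff.Good

theorem refl (s : State n V) : Eff.Good s (s, []) where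
  sound := by simp [Eff.Sound]
  covers := fun j m _ h => .inl h
  announces := ⟨fun x h => .inl h, .inl rfl⟩

theorem of_pers {s s' : State n V} {e : Eff n V} (h : Eff.Good s' e) (hp : s'.pers = s.pers)
    (hr : s'.tran.highestRequest = s.tran.highestRequest) : Eff.Good s e where
  sound := h.sound
  covers := fun j m h1 h2 => by
    rw [← hp]
    exact h.covers j m (by rw [hr, hp]; exact h1) h2
  announces := ⟨fun x hx => by rw [← hp]; exact h.announces.done x hx,
    by rw [← hp]; exact h.announces.abort⟩

end Eff.Good

theorem trySuggest_good (s : State n V) : Eff.Good s (trySuggest s) := by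
  unfold trySuggest
  split_ifs with h
  swap
  · exact .refl s
  obtain ⟨h1, j, h2, h3⟩ := h
  refine ⟨?_, ?_, ?_⟩
  · rintro ⟨l, m⟩ hq
    simp only [List.mem_map, List.mem_filter, Prod.mk.injEq] at hq
    obtain ⟨a, -, rfl, rfl⟩ := hq
    simp [Persistent.Backs]
  · intro l m hl hm
    rw [mem_currentMsgs] at hm ⊢
    cases m <;> simp only [Persistent.Backs, Msg.IsMeantFor] at hm ⊢ <;> try exact .inl hm
    obtain ⟨hl', rfl, hg⟩ := hm
    right
    simp only [Option.some.injEq] at hg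
    simpa [hg] using hl'
  · exact ⟨fun x h => .inl h, .inl rfl⟩

/-- Meant for s' obtained from s by updating keys or locks. These updates do not affect the messages
of the view, since `sentProof` and `sentSuggest` hold copies made when the messages were formed. -/
theorem sendVote_good_of_pers {r : Round} {x : V} {s s' : State n V} (h : s.pers.sentVote r = none)
    (ht : s'.tran = s.tran) (hv : s'.pers.view = s.pers.view)
    (h1 : s'.pers.sentSuggest = s.pers.sentSuggest) (h2 : s'.pers.sentProof = s.pers.sentProof)
    (h3 : s'.pers.sentPropose = s.pers.sentPropose) (h4 : s'.pers.sentVote = s.pers.sentVote)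
    (h5 : s'.pers.doneSent = s.pers.doneSent) (h6 : s'.pers.lastAbort = s.pers.lastAbort) :
    Eff.Good s (sendVote r x s') := by
  unfold sendVote
  refine ⟨?_, ?_, ?_⟩
  · rintro ⟨l, m⟩ hq
    obtain ⟨-, rfl⟩ := mem_toJoined.1 hq
    simp [Persistent.Backs]
  · intro l m hl hm
    rw [mem_currentMsgs] at hm ⊢
    rw [mem_toJoined]
    cases m <;>
      simp only [Persistent.Backs, Msg.IsMeantFor, h1, h2, h3, hv, false_and, ht] at hm ⊢ <;>
      try exact .inl hm
    next r' x' u =>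
    obtain ⟨-, rfl, hx⟩ := hm
    by_cases hr : r' = r
    · subst hr
      simp only [Function.update_self, Option.some.injEq] at hx
      subst hx
      exact .inr ⟨hl, rfl⟩
    · left
      rw [Function.update_of_ne hr, h4] at hx
      exact ⟨trivial, rfl, hx⟩
  · exact ⟨fun x hx => .inl (by rw [← h5]; exact hx), .inl h6⟩

theorem tryEcho_good (f : ℕ) (s : State n V) : Eff.Good s (tryEcho f s) := by
  unfold tryEcho
  split
  · split_ifs with h
    · exact sendVote_good_of_pers h.1 rfl rfl rfl rfl rfl rfl rfl rfl
    · exact .refl s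
  · exact .refl s

theorem tryPropose_good (f : ℕ) (pick : Finset (Fin n) → Fin n) (s : State n V) :
    Eff.Good s (tryPropose f pick s) := by
  unfold tryPropose
  split_ifs with h
  swap
  · exact .refl s
  split
  swap
  · exact .refl s
  next g hg =>
  refine ⟨?_, ?_, ?_⟩
  · rintro ⟨l, m⟩ hq
    obtain ⟨-, rfl⟩ := mem_toJoined.1 hq
    simp [Persistent.Backs]
  · intro l m hl hm
    rw [mem_currentMsgs] at hm ⊢
    rw [mem_toJoined]
    cases m <;> simp only [Persistent.Backs, Msg.IsMeantFor] at hm ⊢ <;> try exact .inl hm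
    obtain ⟨-, rfl, hx⟩ := hm
    simp only [Option.some.injEq, Prod.mk.injEq] at hx
    obtain ⟨rfl, rfl⟩ := hx
    exact .inr ⟨hl, rfl⟩
  · exact ⟨fun x h => .inl h, .inl rfl⟩

theorem sendDone_good (x : V) (s : State n V) : Eff.Good s (sendDone x s) := by
  unfold sendDone
  split_ifs with h
  · refine ⟨?_, ?_, ?_⟩
    · rintro ⟨l, m⟩ hq
      obtain rfl := mem_toAll.1 hq
      simp [Persistent.Backs]
    · intro l m hl hm
      rw [mem_currentMsgs] at hm ⊢
      cases m <;> simp only [Persistent.Backs, Msg.IsMeantFor, false_and] at hm ⊢ <;> exact .inl hm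
    · refine ⟨fun y hy => .inr fun j => ?_, .inl rfl⟩
      rw [mem_toAll]
      simp only [Option.some.injEq] at hy
      rw [hy]
  · exact .refl s

/-- Composition of effects within a view. -/
theorem Eff.Good.andThen {f : ℕ} {i : Fin n} {fired : Prop} {s : State n V} {e : Eff n V}
    {h : State n V → Eff n V} (he : Eff.Good s e) (hh : Eff.Good e.1 (h e.1))
    (hs : PSteps f i fired e.1.tran e.1.pers (h e.1).1.pers)
    (hv : (h e.1).1.pers.view = e.1.pers.view) (hv' : e.1.pers.view = s.pers.view)
    (hr : e.1.tran.highestRequest = s.tran.highestRequest) : Eff.Good s (e.andThen h) := by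
  refine ⟨?_, ?_, ?_⟩
  · intro q hq
    rcases List.mem_append.1 hq with hq | hq
    · exact hs.backs hv (he.sound q hq)
    · exact hh.sound q hq
  · intro j m hj hm
    rcases hh.covers j m (by rw [hr, hv', hj]) hm with h1 | h1
    · rcases he.covers j m hj h1 with h2 | h2
      · exact .inl h2
      · exact .inr (List.mem_append_left _ h2)
    · exact .inr (List.mem_append_right _ h1)
  · refine ⟨fun x hx => ?_, ?_⟩
    · rcases hh.announces.done x hx with h1 | h1
      · rcases he.announces.done x h1 with h2 | h2
        · exact .inl h2
        · exact .inr fun j => List.mem_append_left _ (h2 j)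
      · exact .inr fun j => List.mem_append_right _ (h1 j)
    · rcases hh.announces.abort with h1 | h1
      · have h3 : (e.andThen h).1.pers.lastAbort = e.1.pers.lastAbort := h1
        rw [h3]
        rcases he.announces.abort with h2 | h2
        · exact .inl h2
        · exact .inr fun j => List.mem_append_left _ (h2 j)
      · exact .inr fun j => List.mem_append_right _ (h1 j)

theorem onQuorum_good (f : ℕ) (i : Fin n) (r : Round) (x : V) (s : State n V) :
    Eff.Good s (onQuorum f r x s) := by
  unfold onQuorum
  cases r <;> simp only
  · split_ifs with h
    exacts [sendVote_good_of_pers h rfl rfl rfl rfl rfl rfl rfl rfl, .refl s]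
  · split_ifs with h
    exacts [sendVote_good_of_pers h rfl rfl rfl rfl rfl rfl rfl rfl, .refl s]
  · split_ifs with h
    exacts [sendVote_good_of_pers h rfl rfl rfl rfl rfl rfl rfl rfl, .refl s]
  · split_ifs with h
    · refine Eff.Good.andThen (f := f) (i := i) (fired := False)
        (sendVote_good_of_pers h rfl rfl rfl rfl rfl rfl rfl rfl) (tryEcho_good f _)
        (tryEcho_steps (sendVote .lock x
          { s with pers.lock := s.pers.view, pers.lockVal := x }).1) (by simp) rfl rfl
    · exact .refl s
  · exact sendDone_good x s

theorem enterView_sound (i : Fin n) (Δ now : ℝ) (v : ℕ) (s : State n V) :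
    (enterView Δ now v s).Sound := by
  rw [enterView_eq]
  intro q hq
  rcases List.mem_append.1 hq with hq | hq
  · refine PSteps.backs (trySuggest_steps (f := 0) (i := i) (fired := False)
      (freshState Δ now v s).tran (freshState Δ now v s)) (by simp) ?_
    obtain ⟨j, m⟩ := q
    rcases List.mem_append.1 hq with hq | hq
    · obtain rfl := mem_toAll.1 hq
      simp [Persistent.Backs, freshState]
    · obtain ⟨-, rfl⟩ := mem_toJoined.1 hq
      simp [Persistent.Backs, freshState]
  · exact (trySuggest_good _).sound q hq

/-- On entering a view, the parties that have joined get all the messages meant for them. -/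
theorem enterView_covers {Δ now : ℝ} {v : ℕ} {s : State n V} {j : Fin n} {m : Msg V}
    (hj : s.tran.highestRequest j = v) (hm : m ∈ currentMsgs (enterView Δ now v s).1.pers j) :
    (j, m) ∈ (enterView Δ now v s).2 := by
  rw [enterView_eq] at hm ⊢
  rcases (trySuggest_good (freshState Δ now v s)).covers j m hj hm with h | h
  · refine List.mem_append_left _ (List.mem_append_right _ ?_)
    rw [mem_currentMsgs] at h
    rw [mem_toJoined]
    refine ⟨hj, ?_⟩
    cases m <;> simp_all [Persistent.Backs, freshState, Msg.IsMeantFor]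
  · exact List.mem_append_right _ h

@[simp] theorem trySuggest_doneSent (s : State n V) :
    (trySuggest s).1.pers.doneSent = s.pers.doneSent := by
  unfold trySuggest; split_ifs <;> rfl

theorem mem_enterView_request {Δ now : ℝ} {v : ℕ} {s : State n V} (j : Fin n) :
    (j, .request v) ∈ (enterView Δ now v s).2 := by
  rw [enterView_eq]
  exact List.mem_append_left _ (List.mem_append_left _ (mem_toAll.2 rfl))

/-- The properties of the messages sent in the transition from `s` to `e`. -/
structure SendSpec (i : Fin n) (s : State n V) (a : Action n V) (e : Eff n V) : Prop where
  sound : e.Sound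
  covers : ∀ j m, e.1.tran.highestRequest j = e.1.pers.view → m ∈ currentMsgs e.1.pers j →
    (e.1.pers.view = s.pers.view ∧ s.tran.highestRequest j = s.pers.view ∧
      m ∈ currentMsgs s.pers j) ∨ (j, m) ∈ e.2
  announces : e.Announces s
  request : e.1.pers.view ≠ s.pers.view → ∀ j, (j, .request e.1.pers.view) ∈ e.2
  reply : ∀ j u, a = .deliver j i (.recover u) →
    (∀ x, s.pers.doneSent = some x → (j, .done x) ∈ e.2) ∧
    (s.pers.lastAbort ≠ 0 → (j, .abort s.pers.lastAbort) ∈ e.2)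

theorem Eff.Good.sendSpec {i : Fin n} {s : State n V} {a : Action n V} {e : Eff n V}
    (h : Eff.Good s e) (hr : e.1.tran.highestRequest = s.tran.highestRequest)
    (hv : e.1.pers.view = s.pers.view) (ha : ∀ j u, a ≠ .deliver j i (.recover u)) :
    SendSpec i s a e where
  sound := h.sound
  covers := fun j m hj hm => by
    rw [hr, hv] at hj
    rcases h.covers j m hj hm with h1 | h1
    · exact .inl ⟨hv, hj, h1⟩
    · exact .inr h1
  announces := h.announces
  request := fun h => absurd hv h
  reply := fun j u h => absurd h (ha j u)

theorem amplifyAbort_good {f : ℕ} {i j : Fin n} {v : ℕ} {s : State n V} :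
    Eff.Good s (amplifyAbort f i j v s) := by
  unfold amplifyAbort
  split_ifs with h
  · refine ⟨?_, fun j m _ h => .inl h, fun x h => .inl h, ?_⟩
    · rintro ⟨l, m⟩ hq
      obtain rfl := mem_toAll.1 hq
      simp [Persistent.Backs, raiseAbort]
    · simp only [mem_toAll, raiseAbort, Msg.abort.injEq]
      rcases max_choice s.pers.lastAbort
        (kthLargest (f + 1) (Function.update s.tran.highestAbort j v)) with h | h
      · exact .inl h
      · exact .inr fun _ => h
  · exact (Eff.Good.refl _).of_pers rfl rfl

theorem onAbort_sendSpec {f : ℕ} {Δ now : ℝ} {i j : Fin n} {v : ℕ} {s : State n V} :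
    SendSpec i s (.deliver j i (.abort v)) (onAbort f Δ now i j v s) := by
  rw [onAbort_eq]
  have hg := amplifyAbort_good (f := f) (i := i) (j := j) (v := v) (s := s)
  split_ifs with h hw
  · set w := kthLargest (n - f) (amplifyAbort f i j v s).1.tran.highestAbort
    refine ⟨?_, ?_, ?_, ?_, by simp⟩
    · rintro ⟨l, m⟩ hq
      rcases List.mem_append.1 hq with hq | hq
      -- Messages sent before the change of view are still backed after it: they are `abort`
      -- messages, and `lastAbort` is not reset.
      · have h1 := hg.sound _ hq
        unfold amplifyAbort at hq
        split_ifs at hq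
        · obtain rfl := mem_toAll.1 hq
          simpa [Persistent.Backs, Eff.andThen] using h1
        · simp at hq
      · exact enterView_sound i _ _ _ _ _ hq
    · intro l m hl hm
      right
      refine List.mem_append_right _ (enterView_covers ?_ hm)
      simpa [Eff.andThen, freshState] using hl
    · refine ⟨fun x hx => ?_, ?_⟩
      · have h2 : (amplifyAbort f i j v s).1.pers.doneSent = some x := by
          simpa [Eff.andThen, enterView_eq, freshState] using hx
        rcases hg.announces.done x h2 with h3 | h3
        · exact .inl h3
        · exact .inr fun l => List.mem_append_left _ (h3 l)
      · have h2 : (Eff.andThen (amplifyAbort f i j v s)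
            (enterView Δ now (w + 1))).1.pers.lastAbort =
            (amplifyAbort f i j v s).1.pers.lastAbort := by simp [Eff.andThen]
        rw [h2]
        rcases hg.announces.abort with h3 | h3
        · exact .inl h3
        · exact .inr fun l => List.mem_append_left _ (h3 l)
    · intro _ l
      have h2 : (Eff.andThen (amplifyAbort f i j v s)
            (enterView Δ now (w + 1))).1.pers.view = w + 1 := by simp [Eff.andThen]
      rw [h2]
      exact List.mem_append_right _ (mem_enterView_request l)
  · exact hg.sendSpec (by simp [amplifyAbort_tran]) (by simp) (by simp)
  · exact (Eff.Good.refl s).sendSpec rfl rfl (by simp)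

theorem onRequest_sendSpec {i j : Fin n} {v : ℕ} {s : State n V} :
    SendSpec i s (.deliver j i (.request v)) (onRequest j v s) := by
  rw [onRequest_eq]
  split_ifs with h hv
  · subst hv
    have hg := trySuggest_good (recordRequest j s.pers.view s)
    have hss := trySuggest_steps (f := 0) (i := i) (fired := False)
      s.tran (recordRequest j s.pers.view s)
    refine ⟨?_, ?_, ?_, by simp [Eff.andThen, recordRequest], by simp⟩
    · rintro ⟨l, m⟩ hq
      rcases List.mem_append.1 hq with hq | hq
      · refine hss.backs (by simp) ?_
        simp only [List.mem_map, Prod.mk.injEq] at hq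
        obtain ⟨m', hm', rfl, rfl⟩ := hq
        exact (mem_currentMsgs.1 hm').2
      · exact hg.sound _ hq
    · intro l m hl hm
      simp only [Eff.andThen, trySuggest_tran, trySuggest_view] at hl hm ⊢
      rcases hg.covers l m hl hm with h1 | h1
      · by_cases hlj : l = j
        · subst hlj
          exact .inr (List.mem_append_left _ (List.mem_map.2 ⟨m, h1, rfl⟩))
        · left
          refine ⟨rfl, ?_, h1⟩
          simpa [recordRequest, hlj] using hl
      · exact .inr (List.mem_append_right _ h1)
    · refine ⟨fun x hx => .inl ?_, .inl ?_⟩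
      · simpa [Eff.andThen, recordRequest] using hx
      · simp [Eff.andThen, recordRequest]
  · refine ⟨by simp [Eff.Sound], fun l m hl hm => .inl ⟨rfl, ?_, hm⟩,
      ⟨fun x h => .inl h, .inl rfl⟩, by simp [recordRequest], by simp⟩
    -- A request for another view does not make its sender a member of the current one.
    by_cases hlj : l = j
    · subst hlj
      exact absurd (by simpa [recordRequest] using hl) hv
    · simpa [recordRequest, hlj] using hl
  · exact (Eff.Good.refl s).sendSpec rfl rfl (by simp)

theorem onDone_good {f : ℕ} {j : Fin n} {x : V} {s : State n V} :
    Eff.Good s (onDone f j x s) := by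
  have hg : Eff.Good s (amplifyDone f j x s) := by
    unfold amplifyDone
    split_ifs
    · exact (sendDone_good x _).of_pers rfl rfl
    · exact (Eff.Good.refl _).of_pers rfl rfl
  rw [onDone_eq]
  split_ifs with h1 h2
  · refine ⟨fun q hq => ?_, fun l m hl hm => hg.covers l m hl hm, hg.announces.1, hg.announces.2⟩
    have := hg.sound q hq
    cases hm : q.2 <;> simp_all [Persistent.Backs, State.decide]
  · exact hg
  · exact .refl s

theorem onRecover_sendSpec {i j : Fin n} {v : ℕ} {s : State n V} :
    SendSpec i s (.deliver j i (.recover v)) (onRecover j v s) := by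
  refine ⟨?_, fun l m hl hm => .inl ⟨rfl, hl, hm⟩, ⟨fun x h => .inl h, .inl rfl⟩,
    fun h => absurd rfl h, ?_⟩
  · rintro ⟨l, m⟩ hq
    simp only [onRecover, List.mem_map, Prod.mk.injEq, List.mem_append] at hq ⊢
    obtain ⟨m', hm', rfl, rfl⟩ := hq
    rcases hm' with ((hm' | hm') | hm') | hm'
    · simp only [Option.mem_toList] at hm'
      obtain ⟨y, hy, rfl⟩ := hm'
      exact hy
    · simp only [List.mem_singleton] at hm'
      subst hm'
      rfl
    · split_ifs at hm'
      · simp at hm'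
      · simp only [List.mem_singleton] at hm'
        subst hm'
        exact le_rfl
    · split_ifs at hm'
      · exact (mem_currentMsgs.1 hm').2
      · simp at hm'
  · intro j' u h
    simp only [Action.deliver.injEq] at h
    obtain ⟨rfl, -, -⟩ := h
    refine ⟨fun x hx => ?_, fun h => ?_⟩
    · simp [onRecover, hx]
    · simp [onRecover, h]

theorem perform_sendSpec (f : ℕ) (Δ now : ℝ) (pick : Finset (Fin n) → Fin n) (i : Fin n)
    {s : State n V} (a : Action n V) (hv : 0 < s.pers.view) :
    SendSpec i s a (perform f Δ now pick i s a) := by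
  unfold perform
  cases a with
  | idle => exact (Eff.Good.refl s).sendSpec rfl rfl (by simp)
  | timer j =>
    simp only
    split_ifs with h
    · unfold onTimer
      split_ifs
      · refine Eff.Good.sendSpec ⟨?_, fun l m hl hm => .inl hm, fun x h => .inl h, ?_⟩ rfl rfl
          (by simp)
        · rintro ⟨l, m⟩ hq
          obtain rfl := mem_toAll.1 hq
          simp [Persistent.Backs]
        · simp only [mem_toAll, Msg.abort.injEq]
          rcases max_choice s.pers.lastAbort s.pers.view with h | h
          · exact .inl h
          · exact .inr fun _ => h
      · exact (Eff.Good.refl s).sendSpec rfl rfl (by simp)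
    · exact (Eff.Good.refl s).sendSpec rfl rfl (by simp)
  | reboot j =>
    simp only
    split_ifs with h
    · unfold onReboot
      split_ifs
      · refine ⟨?_, ?_, ⟨fun x h => .inl h, .inl rfl⟩, fun h => absurd rfl h, by simp⟩
        · rintro ⟨l, m⟩ hq
          rcases List.mem_append.1 hq with hq | hq
          · obtain rfl := mem_toAll.1 hq
            trivial
          · obtain rfl := mem_toAll.1 hq
            rfl
        · intro l m hl hm
          -- After a reboot all entries of `highestRequest` are 0 while views are positive, so no
          -- party counts as joined.
          exact absurd hl hv.ne
      · refine ⟨by simp [Eff.Sound], fun l m hl hm => absurd hl hv.ne, ⟨fun x h => .inl h, .inl rfl⟩,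
          fun h => absurd rfl h, by simp⟩
    · exact (Eff.Good.refl s).sendSpec rfl rfl (by simp)
  | deliver j k m =>
    simp only
    split_ifs with h
    swap
    · refine (Eff.Good.refl s).sendSpec rfl rfl ?_
      rintro j u h'
      simp_all
    subst h
    unfold receive
    cases m <;> simp only
    case recover => exact onRecover_sendSpec
    all_goals split_ifs with hd
    all_goals try exact (Eff.Good.refl s).sendSpec rfl rfl (by simp)
    · exact onRequest_sendSpec
    · rw [onSuggest_eq]
      split_ifs with h1
      · refine ((tryPropose_good f pick (recordSuggest _ _ s)).of_pers (s := s) rfl rfl).sendSpec ?_ ?_ ?_ <;>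
          simp [recordSuggest]
      · exact (Eff.Good.refl s).sendSpec rfl rfl (by simp)
    · rw [onPropose_eq]
      split_ifs with h1
      · refine ((tryEcho_good f (recordProposal _ s)).of_pers (s := s) rfl rfl).sendSpec ?_ ?_ ?_ <;>
          simp [recordProposal]
      · exact (Eff.Good.refl s).sendSpec rfl rfl (by simp)
    · rw [onProof_eq]
      split_ifs with h1
      · refine ((tryEcho_good f (recordProof _ _ s)).of_pers (s := s) rfl rfl).sendSpec ?_ ?_ ?_ <;>
          simp [recordProof]
      · exact (Eff.Good.refl s).sendSpec rfl rfl (by simp)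
    · rw [onVote_eq]
      split_ifs with h1 h2
      · refine ((onQuorum_good f k _ _ (recordVote _ _ _ s)).of_pers (s := s) rfl rfl).sendSpec ?_ ?_ ?_ <;>
          simp [recordVote]
      · refine ((Eff.Good.refl (recordVote _ _ _ s)).of_pers (s := s) rfl rfl).sendSpec rfl rfl ?_
        simp
      · exact (Eff.Good.refl s).sendSpec rfl rfl (by simp)
    · refine onDone_good.sendSpec ?_ ?_ (by simp)
      · rw [onDone_eq]; split_ifs <;> simp [recordDone, State.decide]
      · rw [onDone_eq]; split_ifs <;> simp [State.decide]
    · exact onAbort_sendSpec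

/-! ## Rules that have fired -/

/-- The party has reacted to a quorum in round `r`. -/
def Persistent.Reacted (p : Persistent V) : Round → Prop
  | .echo => p.sentVote .key1 ≠ none
  | .key1 => p.sentVote .key2 ≠ none
  | .key2 => p.sentVote .key3 ≠ none
  | .key3 => p.sentVote .lock ≠ none
  | .lock => p.doneSent ≠ none

/-- No rule of the algorithm is waiting to be applied by party `i`. -/
structure Settled (f : ℕ) (i : Fin n) (s : State n V) : Prop where
  suggest : ∀ j, IsPrimary j s.pers.view → s.tran.highestRequest j = s.pers.view →
    s.pers.sentSuggest ≠ none
  propose : n - f ≤ (accepted f s).card → s.pers.sentPropose ≠ none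
  echo : ∀ key x, s.tran.proposal = some (key, x) → CanEcho f s key x →
    s.pers.sentVote .echo ≠ none
  quorum : ∀ r x, n - f ≤ count (s.tran.voteFrom r) x → s.pers.Reacted r
  done : ∀ x, f + 1 ≤ count s.tran.doneFrom x → s.pers.doneSent ≠ none
  decide : ∀ x, n - f ≤ count s.tran.doneFrom x → s.pers.decided ≠ none
  abort : kthLargest (f + 1) s.tran.highestAbort ≤ s.tran.highestAbort i
  view : kthLargest (n - f) s.tran.highestAbort < s.pers.view

theorem count_none {x : V} : count (fun _ : Fin n => none) x = 0 := by
  simp [count]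

/-- Consequently a message with value x can enable threshold rules for x only. -/
theorem count_update_of_ne {a : Fin n → Option V} {j : Fin n} {x y : V} (h : y ≠ x) :
    count (Function.update a j (some x)) y ≤ count a y := by
  refine Finset.card_le_card fun l hl => ?_
  simp only [Finset.mem_filter, Finset.mem_univ, true_and, Function.update_apply] at hl ⊢
  split_ifs at hl with hlj
  · exact absurd (Option.some.inj hl).symm h
  · exact hl

theorem accepted_empty {f : ℕ} {s : State n V} (h : ∀ j, s.tran.suggestFrom j = none) :
    accepted f s = ∅ := by
  simp [accepted, h]

section

variable {f : ℕ} {i : Fin n}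

theorem Persistent.Reacted.mono {fired : Prop} {t : Transient n V} {p p' : Persistent V} {r : Round}
    (h : PSteps f i fired t p p') (hv : p'.view = p.view) (hr : p.Reacted r) : p'.Reacted r := by
  have key : ∀ r', p.sentVote r' ≠ none → p'.sentVote r' ≠ none := by
    intro r' h1
    obtain ⟨x, hx⟩ := Option.ne_none_iff_exists'.1 h1
    have := (PSteps.backs h hv (m := .vote r' x p.view) ⟨rfl, hx⟩).2
    simp [this]
  cases r <;> try exact key _ hr
  obtain ⟨x, hx⟩ := Option.ne_none_iff_exists'.1 hr
  simp [Persistent.Reacted, PSteps.doneSent_eq h hx]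

theorem trySuggest_settles {s : State n V} {j : Fin n}
    (hj : IsPrimary j (trySuggest s).1.pers.view)
    (hr : (trySuggest s).1.tran.highestRequest j = (trySuggest s).1.pers.view) :
    (trySuggest s).1.pers.sentSuggest ≠ none := by
  rw [trySuggest_view] at hj hr
  rw [trySuggest_tran] at hr
  unfold trySuggest
  split_ifs with h
  · simp
  · exact fun hs => h ⟨hs, j, hj, hr⟩

theorem tryEcho_settles {s : State n V} {key : ℤ} {x : V}
    (hp : (tryEcho f s).1.tran.proposal = some (key, x))
    (hc : CanEcho f (tryEcho f s).1 key x) : (tryEcho f s).1.pers.sentVote .echo ≠ none := by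
  rw [tryEcho_tran] at hp
  unfold tryEcho at hc ⊢
  simp only [hp] at hc ⊢
  split_ifs at hc ⊢ with h
  · simp [sendVote]
  · exact fun hs => h ⟨hs, hc⟩

theorem tryPropose_settles {pick : Finset (Fin n) → Fin n} {s : State n V} (hn : 0 < n - f)
    (hpick : ∀ S : Finset (Fin n), S.Nonempty → pick S ∈ S)
    (hc : n - f ≤ (accepted f (tryPropose f pick s).1).card) :
    (tryPropose f pick s).1.pers.sentPropose ≠ none := by
  unfold tryPropose at hc ⊢
  split_ifs at hc ⊢ with h
  · have hne : (accepted f s).Nonempty := Finset.card_pos.1 (hn.trans_le h.2)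
    obtain ⟨g, hg, -⟩ := (Finset.mem_filter.1 (hpick (best f s) (best_nonempty hne))).2
    have hg' : s.tran.suggestFrom (pick (best f s)) = some g := hg
    simp only [hg']
    simp
  · exact fun hs => h ⟨hs, hc⟩

theorem onQuorum_reacted (i : Fin n) {r : Round} {x : V} {s : State n V} :
    (onQuorum f r x s).1.pers.Reacted r := by
  unfold onQuorum
  cases r <;> simp only
  · split_ifs with h
    · simp [sendVote, Persistent.Reacted]
    · exact h
  · split_ifs with h
    · simp [sendVote, Persistent.Reacted]
    · exact h
  · split_ifs with h
    · simp [sendVote, Persistent.Reacted]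
    · exact h
  · split_ifs with h
    · refine Persistent.Reacted.mono (r := .key3) (f := f) (i := i) (fired := False)
        (tryEcho_steps (sendVote .lock x
          { s with pers.lock := s.pers.view, pers.lockVal := x }).1) (by simp [Eff.andThen]) ?_
      simp [sendVote, Persistent.Reacted]
    · exact h
  · unfold sendDone
    split_ifs with h
    · simp [Persistent.Reacted]
    · exact h

theorem accepted_congr {s s' : State n V} (h : s'.tran.suggestFrom = s.tran.suggestFrom)
    (hv : s'.pers.view = s.pers.view) : accepted f s' = accepted f s := by
  unfold accepted AcceptKey
  rw [h, hv]

/-- A step within a view keeps a state settled if the rules concerned by it are applied. -/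
theorem Settled.step {s s' : State n V} (h : Settled f i s)
    (hp : PSteps f i False s'.tran s.pers s'.pers) (hv : s'.pers.view = s.pers.view)
    (h1 : s'.tran.highestRequest = s.tran.highestRequest ∨
      ∀ j, IsPrimary j s'.pers.view → s'.tran.highestRequest j = s'.pers.view →
        s'.pers.sentSuggest ≠ none)
    (h2 : s'.tran.suggestFrom = s.tran.suggestFrom ∨
      (n - f ≤ (accepted f s').card → s'.pers.sentPropose ≠ none))
    (h3 : (s'.tran.proposal = s.tran.proposal ∧ s'.tran.proofFrom = s.tran.proofFrom ∧
        s'.pers.lock = s.pers.lock ∧ s'.pers.lockVal = s.pers.lockVal) ∨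
      ∀ key x, s'.tran.proposal = some (key, x) → CanEcho f s' key x →
        s'.pers.sentVote .echo ≠ none)
    (h4 : s'.tran.voteFrom = s.tran.voteFrom ∨
      ∀ r x, n - f ≤ count (s'.tran.voteFrom r) x → s'.pers.Reacted r)
    (h5 : s'.tran.doneFrom = s.tran.doneFrom ∨
      ((∀ x, f + 1 ≤ count s'.tran.doneFrom x → s'.pers.doneSent ≠ none) ∧
        ∀ x, n - f ≤ count s'.tran.doneFrom x → s'.pers.decided ≠ none))
    (h6 : s'.tran.highestAbort = s.tran.highestAbort ∨
      (kthLargest (f + 1) s'.tran.highestAbort ≤ s'.tran.highestAbort i ∧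
        kthLargest (n - f) s'.tran.highestAbort < s'.pers.view)) : Settled f i s' := by
  have hbacks {m : Msg V} (hm : s.pers.Backs m) : s'.pers.Backs m := PSteps.backs hp hv hm
  have hne {α : Type _} {o : Option α} (ho : o ≠ none) : ∃ a, o = some a :=
    Option.ne_none_iff_exists'.1 ho
  refine ⟨?_, ?_, ?_, ?_, ?_, ?_, ?_, ?_⟩
  · rcases h1 with h1 | h1
    · intro j hj hr
      rw [hv] at hj hr
      rw [h1] at hr
      obtain ⟨g, hg⟩ := hne (h.suggest j hj hr)
      have := (hbacks (m := .suggest g s.pers.view) ⟨rfl, hg⟩).2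
      simp [this]
    · exact h1
  · rcases h2 with h2 | h2
    · intro hc
      rw [accepted_congr h2 hv] at hc
      obtain ⟨⟨k, x⟩, hq⟩ := hne (h.propose hc)
      have := (hbacks (m := .propose k x s.pers.view) ⟨rfl, hq⟩).2
      simp [this]
    · exact h2
  · rcases h3 with ⟨h3, h3', h3l, h3v⟩ | h3
    · intro key x hq hc
      have hc' : CanEcho f s key x := by
        simpa only [CanEcho, OpenLock, h3', h3l, h3v, hv] using hc
      obtain ⟨y, hy⟩ := hne (h.echo key x (by rw [← h3]; exact hq) hc')
      have := (hbacks (m := .vote .echo y s.pers.view) ⟨rfl, hy⟩).2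
      simp [this]
    · exact h3
  · rcases h4 with h4 | h4
    · intro r x hc
      rw [h4] at hc
      exact (h.quorum r x hc).mono hp hv
    · exact h4
  · rcases h5 with h5 | h5
    · intro x hc
      rw [h5] at hc
      obtain ⟨y, hy⟩ := hne (h.done x hc)
      simp [PSteps.doneSent_eq hp hy]
    · exact h5.1
  · rcases h5 with h5 | h5
    · intro x hc
      rw [h5] at hc
      obtain ⟨y, hy⟩ := hne (h.decide x hc)
      simp [PSteps.decided_eq hp hy]
    · exact h5.2
  · rcases h6 with h6 | h6
    · rw [h6]; exact h.abort
    · exact h6.1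
  · rcases h6 with h6 | h6
    · rw [h6, hv]; exact h.view
    · exact h6.2

theorem trySuggest_pers (s : State n V) :
    (trySuggest s).1.pers = { s.pers with sentSuggest := (trySuggest s).1.pers.sentSuggest } := by
  unfold trySuggest; split_ifs <;> rfl

/-- The arrays of the view are empty, so the quorum rules hold vacuously as n - f is positive; the
suggestion has just been tried; the rules on `done` and `abort` carry over from the hypotheses. -/
theorem enterView_settled {Δ now : ℝ} {v : ℕ} {s : State n V} (hn : 0 < n - f)
    (h5 : ∀ x, f + 1 ≤ count s.tran.doneFrom x → s.pers.doneSent ≠ none)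
    (h6 : ∀ x, n - f ≤ count s.tran.doneFrom x → s.pers.decided ≠ none)
    (h7 : kthLargest (f + 1) s.tran.highestAbort ≤ s.tran.highestAbort i)
    (h8 : kthLargest (n - f) s.tran.highestAbort < v) :
    Settled f i (enterView Δ now v s).1 := by
  rw [enterView_eq]
  simp only [Eff.andThen]
  have hp := trySuggest_pers (freshState Δ now v s)
  refine ⟨fun j => trySuggest_settles, ?_, ?_, ?_, ?_, ?_, ?_, ?_⟩
  · rw [accepted_empty (fun j => by simp [freshState, Transient.empty]), Finset.card_empty]
    omega
  · simp [freshState, Transient.empty]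
  · intro r x h
    simp only [trySuggest_tran, freshState, Transient.empty, count_none] at h
    omega
  · rw [hp]; simpa [freshState] using h5
  · rw [hp]; simpa [freshState] using h6
  · simpa [freshState] using h7
  · simpa [freshState] using h8

theorem onQuorum_lock_eq {r : Round} {x : V} {s : State n V} (hr : r ≠ .key3) :
    (onQuorum f r x s).1.pers.lock = s.pers.lock ∧
      (onQuorum f r x s).1.pers.lockVal = s.pers.lockVal := by
  unfold onQuorum sendDone
  cases r <;> simp only <;> (try split_ifs) <;> simp [sendVote] at hr ⊢

/-- Round `key3` is the only one that changes the lock and with it the echo condition. The handler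
therefore tries the echo again after locking. -/
theorem onQuorum_settles {x : V} {s : State n V}
    (h : ∀ key y, s.tran.proposal = some (key, y) → CanEcho f s key y →
      s.pers.sentVote .echo ≠ none) {key : ℤ} {y : V}
    (hp : (onQuorum f .key3 x s).1.tran.proposal = some (key, y))
    (hc : CanEcho f (onQuorum f .key3 x s).1 key y) :
    (onQuorum f .key3 x s).1.pers.sentVote .echo ≠ none := by
  rw [onQuorum_tran] at hp
  unfold onQuorum at hc ⊢
  simp only at hc ⊢
  split_ifs at hc ⊢ with h1
  · exact tryEcho_settles (by simpa [sendVote] using hp) hc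
  · exact h key y hp hc

theorem onVote_settled {r : Round} {j : Fin n} {x : V} {v : ℕ} {s : State n V}
    (h : Settled f i s) : Settled f i (onVote f r j x v s).1 := by
  rw [onVote_eq]
  -- Any quorum other than one for x in round r was complete before this message, and has been
  -- reacted to.
  have hcount : s.tran.voteFrom r j = none → ∀ r' y, (r' = r → y ≠ x) →
      n - f ≤ count ((recordVote r j x s).tran.voteFrom r') y → s.pers.Reacted r' := by
    intro hn r' y hy hc
    refine h.quorum r' y (hc.trans ?_)
    by_cases hr : r' = r
    · subst hr
      simp only [recordVote, Function.update_self]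
      exact count_update_of_ne (hy rfl)
    · simp [recordVote, hr]
  split_ifs with h1 h2
  · have hst := onQuorum_steps (i := i) (fired := False) (s := recordVote r j x s) h2
    refine h.step (by rw [onQuorum_tran]; exact hst) (by simp [recordVote])
      (.inl (by simp [recordVote])) (.inl (by simp [recordVote])) ?_ (.inr ?_)
      (.inl (by simp [recordVote])) (.inl (by simp [recordVote]))
    · by_cases hr : r = .key3
      · subst hr
        right
        intro key y
        exact onQuorum_settles (s := recordVote .key3 j x s) h.echo
      · left
        have := onQuorum_lock_eq (f := f) (x := x) (s := recordVote r j x s) hr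
        exact ⟨by simp [recordVote], by simp [recordVote], this.1, this.2⟩
    · intro r' y hc
      rw [onQuorum_tran] at hc
      by_cases hy : r' = r → y ≠ x
      · exact (hcount h1.2 r' y hy hc).mono hst (by simp [recordVote])
      · push Not at hy
        obtain ⟨rfl, rfl⟩ := hy
        exact onQuorum_reacted i
  · refine h.step .refl rfl (.inl rfl) (.inl rfl) (.inl ⟨rfl, rfl, rfl, rfl⟩) (.inr ?_)
      (.inl rfl) (.inl rfl)
    intro r' y hc
    by_cases hy : r' = r → y ≠ x
    · exact hcount h1.2 r' y hy hc
    · push Not at hy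
      obtain ⟨rfl, rfl⟩ := hy
      exact absurd hc h2
  · exact h

theorem onDone_settled {j : Fin n} {x : V} {s : State n V} (hf : f + 1 ≤ n - f)
    (hd : s.pers.decided = none) (h : Settled f i s) : Settled f i (onDone f j x s).1 := by
  have hst := onDone_steps (f := f) (i := i) (fired := False) (j := j) (x := x) (s := s) hf hd
  have hcount : s.tran.doneFrom j = none → ∀ y ≠ x,
      count (recordDone j x s).tran.doneFrom y ≤ count s.tran.doneFrom y :=
    fun _ y hy => count_update_of_ne hy
  have hlock : (amplifyDone f j x s).1.pers.lock = s.pers.lock ∧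
      (amplifyDone f j x s).1.pers.lockVal = s.pers.lockVal := by
    unfold amplifyDone sendDone
    split_ifs <;> exact ⟨rfl, rfl⟩
  have hdone : ∀ y, s.tran.doneFrom j = none → f + 1 ≤ count (recordDone j x s).tran.doneFrom y →
      (amplifyDone f j x s).1.pers.doneSent ≠ none := by
    intro y hj hc
    by_cases hy : y = x
    · subst hy
      simp only [amplifyDone, if_pos hc, sendDone]
      split_ifs with h4
      · simp
      · exact h4
    · have := h.done y (hc.trans (hcount hj y hy))
      unfold amplifyDone sendDone
      split_ifs with h3 h4
      · simp
      · exact this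
      · exact this
  rw [onDone_eq] at hst ⊢
  split_ifs at hst ⊢ with h1 h2
  · refine h.step hst (by simp [State.decide]) (.inl (by simp [State.decide, recordDone]))
      (.inl (by simp [State.decide, recordDone]))
      (.inl ⟨by simp [State.decide, recordDone], by simp [State.decide, recordDone], hlock⟩)
      (.inl (by simp [State.decide, recordDone])) (.inr ⟨?_, fun y _ => by simp [State.decide]⟩)
      (.inl (by simp [State.decide, recordDone]))
    intro y hc
    exact hdone y h1 (by simpa [State.decide] using hc)
  · refine h.step hst (by simp) (.inl (by simp [recordDone]))
      (.inl (by simp [recordDone])) (.inl ⟨by simp [recordDone], by simp [recordDone], hlock⟩)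
      (.inl (by simp [recordDone])) (.inr ⟨?_, ?_⟩) (.inl (by simp [recordDone]))
    · intro y hc
      exact hdone y h1 (by simpa using hc)
    · intro y hc
      rw [amplifyDone_tran] at hc
      by_cases hy : y = x
      · subst hy
        exact absurd hc h2
      -- A quorum for another value would have been complete earlier, and the party would have
      -- decided already.
      · exact absurd hd (h.decide y (hc.trans (hcount h1 y hy)))
  · exact h

theorem amplifyAbort_pers (f : ℕ) (i j : Fin n) (v : ℕ) (s : State n V) :
    (amplifyAbort f i j v s).1.pers =
      { s.pers with lastAbort := (amplifyAbort f i j v s).1.pers.lastAbort } := by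
  unfold amplifyAbort; split_ifs <;> rfl

theorem onAbort_settled {Δ now : ℝ} {j : Fin n} {v : ℕ} {s : State n V} (hn : 0 < n - f)
    (h : Settled f i s) : Settled f i (onAbort f Δ now i j v s).1 := by
  have hst := amplifyAbort_steps (f := f) (i := i) (fired := False) (j := j) (v := v) (s := s) rfl
  have ht := amplifyAbort_tran f i j v s
  have hp := amplifyAbort_pers f i j v s
  rw [onAbort_eq]
  split_ifs with h1 h2
  · refine enterView_settled hn ?_ ?_ ?_ (by omega)
    · rw [ht, hp]; exact h.done
    · rw [ht, hp]; exact h.decide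
    · rw [ht]; exact kthLargest_raisedAborts_le
  · refine h.step hst (by simp) (.inl (by rw [ht])) (.inl (by rw [ht]))
      (.inl ⟨by rw [ht], by rw [ht], by rw [hp], by rw [hp]⟩) (.inl (by rw [ht]))
      (.inl (by rw [ht])) (.inr ⟨?_, ?_⟩)
    · rw [ht]; exact kthLargest_raisedAborts_le
    · rw [amplifyAbort_view]; omega
  · exact h

theorem onRequest_settled {j : Fin n} {v : ℕ} {s : State n V}
    (h : Settled f i s) : Settled f i (onRequest j v s).1 := by
  rw [onRequest_eq]
  split_ifs with h1 h2
  · simp only [Eff.andThen]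
    have hp := trySuggest_pers (recordRequest j v s)
    refine h.step (trySuggest_steps _ (recordRequest j v s)) (by simp [recordRequest])
      (.inr fun j => trySuggest_settles) (.inl (by simp [recordRequest]))
      (.inl ⟨by simp [recordRequest], by simp [recordRequest], ?_, ?_⟩)
      (.inl (by simp [recordRequest])) (.inl (by simp [recordRequest]))
      (.inl (by simp [recordRequest]))
    · rw [hp]; rfl
    · rw [hp]; rfl
  · refine h.step .refl rfl (.inr ?_) (.inl rfl) (.inl ⟨rfl, rfl, rfl, rfl⟩) (.inl rfl)
      (.inl rfl) (.inl rfl)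
    intro l hl hr
    by_cases hlj : l = j
    · subst hlj
      exact absurd (by simpa [recordRequest] using hr) h2
    · exact h.suggest l hl (by simpa [recordRequest, hlj] using hr)
  · exact h

theorem receive_settled {Δ now : ℝ} {pick : Finset (Fin n) → Fin n} {j : Fin n} {m : Msg V}
    {s : State n V} (hf : f + 1 ≤ n - f)
    (hpick : ∀ S : Finset (Fin n), S.Nonempty → pick S ∈ S) (h : Settled f i s) :
    Settled f i (receive f Δ now pick i j m s).1 := by
  unfold receive
  cases m <;> simp only
  case recover => exact h
  all_goals split_ifs with hd
  all_goals try exact h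
  · exact onRequest_settled h
  · rw [onSuggest_eq]
    split_ifs
    · refine h.step (s' := (tryPropose f pick (recordSuggest j _ s)).1)
        (by rw [tryPropose_tran]; exact tryPropose_steps (by omega) hpick (recordSuggest j _ s))
        (by simp [recordSuggest]) (.inl (by simp [recordSuggest]))
        (.inr (tryPropose_settles (by omega) hpick))
        (.inl ⟨by simp [recordSuggest], by simp [recordSuggest], ?_, ?_⟩)
        (.inl (by simp [recordSuggest])) (.inl (by simp [recordSuggest]))
        (.inl (by simp [recordSuggest]))
      · unfold tryPropose; split_ifs <;> [split <;> rfl; rfl]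
      · unfold tryPropose; split_ifs <;> [split <;> rfl; rfl]
    · exact h
  · rw [onPropose_eq]
    split_ifs
    · exact h.step (s' := (tryEcho f (recordProposal _ s)).1)
        (by rw [tryEcho_tran]; exact tryEcho_steps (recordProposal _ s))
        (by simp [recordProposal]) (.inl (by simp [recordProposal]))
        (.inl (by simp [recordProposal])) (.inr fun key x => tryEcho_settles)
        (.inl (by simp [recordProposal])) (.inl (by simp [recordProposal]))
        (.inl (by simp [recordProposal]))
    · exact h
  · rw [onProof_eq]
    split_ifs
    · exact h.step (s' := (tryEcho f (recordProof j _ s)).1)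
        (by rw [tryEcho_tran]; exact tryEcho_steps (recordProof j _ s))
        (by simp [recordProof]) (.inl (by simp [recordProof]))
        (.inl (by simp [recordProof])) (.inr fun key x => tryEcho_settles)
        (.inl (by simp [recordProof])) (.inl (by simp [recordProof]))
        (.inl (by simp [recordProof]))
    · exact h
  · exact onVote_settled h
  · exact onDone_settled hf hd h
  · exact onAbort_settled (by omega) h

theorem perform_settled {Δ now : ℝ} {pick : Finset (Fin n) → Fin n} {s : State n V}
    (a : Action n V) (hf : f + 1 ≤ n - f)
    (hpick : ∀ S : Finset (Fin n), S.Nonempty → pick S ∈ S) (h : Settled f i s) :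
    Settled f i (perform f Δ now pick i s a).1 := by
  unfold perform
  cases a with
  | idle => exact h
  | timer j =>
    simp only
    split_ifs
    · unfold onTimer
      split_ifs
      · exact ⟨h.1, h.2, h.3, fun r x hr => by cases r <;> exact h.4 _ x hr, h.5, h.6, h.7, h.8⟩
      · exact h
    · exact h
  | deliver j k m =>
    simp only
    split_ifs
    · exact receive_settled hf hpick h
    · exact h
  | reboot j =>
    simp only
    split_ifs
    · have hv : 0 < s.pers.view := by have := h.view; omega
      -- With the received messages erased no rule is enabled: every threshold is positive, and
      -- nobody has joined the (positive) view.
      have key : ∀ s' : State n V, s'.pers = s.pers → s'.tran.highestRequest = (fun _ => 0) →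
          s'.tran.highestAbort = (fun _ => 0) → s'.tran.suggestFrom = (fun _ => none) →
          s'.tran.proposal = none → s'.tran.voteFrom = (fun _ _ => none) →
          s'.tran.doneFrom = (fun _ => none) → Settled f i s' := by
        intro s' hp h1 h2 h3 h4 h5 h6
        refine ⟨?_, ?_, ?_, ?_, ?_, ?_, ?_, ?_⟩
        · intro j _ hr
          rw [h1, hp] at hr
          exact absurd hr hv.ne
        · rw [accepted_empty (by simp [h3]), Finset.card_empty]
          omega
        · simp [h4]
        · intro r x hc
          rw [h5, count_none] at hc
          omega
        · intro x hc
          rw [h6, count_none] at hc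
          omega
        · intro x hc
          rw [h6, count_none] at hc
          omega
        · rw [h2, kthLargest_zero]
        · rw [h2, kthLargest_zero, hp]
          exact hv
      unfold onReboot
      split_ifs <;> exact key _ rfl rfl rfl rfl rfl rfl rfl
    · exact h

end

/-! ## Messages received -/

section Receipt

variable {f : ℕ} {Δ now : ℝ} {pick : Finset (Fin n) → Fin n} {i j : Fin n} {s : State n V}

/-- The entry need not be the message just delivered, since only the first one of each sender is
kept. For a nonfaulty sender its content is recovered later from `TranSound` and the uniqueness of
what that sender sends. -/
theorem perform_vote {r : Round} {x : V} (hd : s.pers.decided = none) :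
    (perform f Δ now pick i s (.deliver j i (.vote r x s.pers.view))).1.tran.voteFrom r j ≠ none := by
  simp only [perform, receive, hd, if_true, onVote_eq, true_and]
  split_ifs with h1 h2
  · simp [recordVote]
  · simp [recordVote]
  · exact h1

theorem perform_proof {r : KeyRec V} (hd : s.pers.decided = none) :
    (perform f Δ now pick i s (.deliver j i (.proof r s.pers.view))).1.tran.proofFrom j ≠ none := by
  simp only [perform, receive, hd, if_true, onProof_eq, true_and]
  split_ifs with h1
  · simp [recordProof]
  · exact h1

theorem perform_suggest {g : Suggestion V} (hd : s.pers.decided = none)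
    (hi : IsPrimary i s.pers.view) :
    (perform f Δ now pick i s
      (.deliver j i (.suggest g s.pers.view))).1.tran.suggestFrom j ≠ none := by
  simp only [perform, receive, hd, if_true, onSuggest_eq, true_and]
  split_ifs with h1
  · simp [recordSuggest]
  · exact fun h => h1 ⟨hi, h⟩

theorem perform_propose {k : ℤ} {x : V} (hd : s.pers.decided = none)
    (hj : IsPrimary j s.pers.view) :
    (perform f Δ now pick i s
      (.deliver j i (.propose k x s.pers.view))).1.tran.proposal ≠ none := by
  simp only [perform, receive, hd, if_true, onPropose_eq, true_and]
  split_ifs with h1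
  · simp [recordProposal]
  · exact fun h => h1 ⟨hj, h⟩

theorem perform_done {x : V} (hd : s.pers.decided = none) :
    (perform f Δ now pick i s (.deliver j i (.done x))).1.tran.doneFrom j ≠ none := by
  simp only [perform, receive, hd, if_true, onDone_eq]
  split_ifs with h1 h2
  · simp [State.decide, recordDone]
  · simp [recordDone]
  · exact h1

theorem perform_abort {v : ℕ} (hd : s.pers.decided = none) :
    v ≤ (perform f Δ now pick i s (.deliver j i (.abort v))).1.tran.highestAbort j := by
  simp only [perform, receive, hd, if_true, onAbort_eq]
  split_ifs with h1 h2
  · simp only [Eff.andThen, enterView_tran, freshState, amplifyAbort_tran]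
    exact le_raisedAborts_self
  · simp only [amplifyAbort_tran]
    exact le_raisedAborts_self
  · simp only
    omega

theorem perform_request {v : ℕ} (hd : s.pers.decided = none) :
    v ≤ (perform f Δ now pick i s (.deliver j i (.request v))).1.tran.highestRequest j := by
  simp only [perform, receive, hd, if_true, onRequest_eq]
  split_ifs with h1 h2
  · simp [Eff.andThen, recordRequest]
  · simp [recordRequest]
  · simp only
    omega

end Receipt

theorem TStep.exists_abort {f : ℕ} {Δ now : ℝ} {i : Fin n} {s s' : State n V} {a : Action n V}
    (h : TStep f Δ now i s a s') (hv : s'.pers.view ≠ s.pers.view) :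
    ∃ j v, a = .deliver j i (.abort v) := by
  cases h with
  | enter j v => exact ⟨j, v, rfl⟩
  | reboot d hd ht hp => exact absurd (by rw [hp]) hv
  | _ => exact absurd ‹_› hv

theorem TStep.aborts_of_ne {f : ℕ} {Δ now : ℝ} {i : Fin n} {s s' : State n V} {a : Action n V}
    (h : TStep f Δ now i s a s') (h1 : a ≠ .timer i) (h2 : a ≠ .reboot i)
    (h3 : ∀ j v, a ≠ .deliver j i (.abort v)) :
    s'.tran.highestAbort = s.tran.highestAbort ∧ s'.pers.view = s.pers.view ∧
      s'.tran.deadline = s.tran.deadline := by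
  cases h with
  | enter j v => exact absurd rfl (h3 j v)
  | abort j v => exact absurd rfl (h3 j v)
  | timer => exact absurd rfl h1
  | reboot => exact absurd rfl h2
  | _ => simp_all

/-! ## Communication -/

/-- The number of words in the messages to party `j` other than `abort` messages. -/
def cost (j : Fin n) (l : List (Fin n × Msg V)) : ℕ :=
  ((l.filter fun q => q.1 = j ∧ ¬ q.2.IsAbort).map fun q => q.2.words).sum

/-- The number of words in the messages `⟨abort, v⟩` to party `j`. -/
def abortCost (j : Fin n) (v : ℕ) (l : List (Fin n × Msg V)) : ℕ :=
  ((l.filter fun q => q = (j, .abort v)).map fun q => q.2.words).sum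

@[simp] theorem cost_nil (j : Fin n) : cost j ([] : List (Fin n × Msg V)) = 0 := rfl

@[simp] theorem cost_append (j : Fin n) (l l' : List (Fin n × Msg V)) :
    cost j (l ++ l') = cost j l + cost j l' := by simp [cost]

@[simp] theorem abortCost_nil (j : Fin n) (v : ℕ) :
    abortCost j v ([] : List (Fin n × Msg V)) = 0 := rfl

@[simp] theorem abortCost_append (j : Fin n) (v : ℕ) (l l' : List (Fin n × Msg V)) :
    abortCost j v (l ++ l') = abortCost j v l + abortCost j v l' := by simp [abortCost]

theorem sum_filter_words_le (P : Fin n × Msg V → Bool) (l : List (Fin n × Msg V)) :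
    ((l.filter P).map fun q => q.2.words).sum ≤ 7 * (l.filter P).length := by
  have := List.sum_le_card_nsmul ((l.filter P).map fun q => q.2.words) 7
    (by simp only [List.mem_map]; rintro x ⟨b, -, rfl⟩; exact b.2.words_le_seven)
  simpa [mul_comm] using this

theorem cost_le_length (j : Fin n) (l : List (Fin n × Msg V)) : cost j l ≤ 7 * l.length :=
  (sum_filter_words_le _ l).trans (Nat.mul_le_mul_left 7 (List.length_filter_le _ _))

theorem abortCost_le_length (j : Fin n) (v : ℕ) (l : List (Fin n × Msg V)) :
    abortCost j v l ≤ 7 * l.length :=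
  (sum_filter_words_le _ l).trans (Nat.mul_le_mul_left 7 (List.length_filter_le _ _))

theorem cost_eq_zero_of_abort {j : Fin n} {l : List (Fin n × Msg V)}
    (h : ∀ q ∈ l, q.2.IsAbort) : cost j l = 0 := by
  have : l.filter (fun q => q.1 = j ∧ ¬ q.2.IsAbort) = [] := by
    rw [List.filter_eq_nil_iff]
    intro q hq
    simp [h q hq]
  unfold cost
  rw [this]
  rfl

theorem abortCost_eq_zero {j : Fin n} {v : ℕ} {l : List (Fin n × Msg V)}
    (h : (j, Msg.abort v) ∉ l) : abortCost j v l = 0 := by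
  have : l.filter (fun q => q = (j, .abort v)) = [] := by
    rw [List.filter_eq_nil_iff]
    rintro q hq hqj
    simp only [decide_eq_true_eq] at hqj
    exact h (hqj ▸ hq)
  simp [abortCost, this]

theorem length_filter_fst_le {j : Fin n} {l : List (Fin n)} {m : Msg V} (hl : l.Nodup) :
    ((l.map fun i => (i, m)).filter fun q => q.1 = j).length ≤ 1 := by
  induction l with
  | nil => simp
  | cons a l ih =>
    rw [List.nodup_cons] at hl
    by_cases ha : a = j
    · subst ha
      have : (l.map fun i => (i, m)).filter (fun q => q.1 = a) = [] := by
        rw [List.filter_eq_nil_iff]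
        rintro q hq
        simp only [List.mem_map] at hq
        obtain ⟨b, hb, rfl⟩ := hq
        simp only [decide_eq_true_eq]
        rintro rfl
        exact hl.1 hb
      simp [this]
    · simpa [ha] using ih hl.2

theorem length_filter_le_of_imp {α : Type*} {P Q : α → Bool} (h : ∀ a, P a → Q a) (l : List α) :
    (l.filter P).length ≤ (l.filter Q).length :=
  (List.monotone_filter_right l h).length_le

theorem cost_map_le {j : Fin n} {l : List (Fin n)} {m : Msg V} (hl : l.Nodup) :
    cost j (l.map fun i => (i, m)) ≤ 7 := by
  have h1 := sum_filter_words_le (fun q => q.1 = j ∧ ¬ q.2.IsAbort) (l.map fun i => (i, m))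
  have h2 := length_filter_fst_le (j := j) (m := m) hl
  have h3 := length_filter_le_of_imp (P := fun q : Fin n × Msg V => q.1 = j ∧ ¬ q.2.IsAbort)
    (Q := fun q => q.1 = j) (by simp +contextual) (l.map fun i => (i, m))
  unfold cost
  omega

theorem abortCost_map_le {j : Fin n} {v : ℕ} {l : List (Fin n)} {m : Msg V} (hl : l.Nodup) :
    abortCost j v (l.map fun i => (i, m)) ≤ 7 := by
  have h1 := sum_filter_words_le (fun q => q = (j, .abort v)) (l.map fun i => (i, m))
  have h2 := length_filter_fst_le (j := j) (m := m) hl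
  have h3 := length_filter_le_of_imp (P := fun q : Fin n × Msg V => q = (j, .abort v))
    (Q := fun q => q.1 = j) (by simp) (l.map fun i => (i, m))
  unfold abortCost
  omega

theorem cost_toAll_le (j : Fin n) (m : Msg V) : cost j (toAll m) ≤ 7 :=
  cost_map_le (List.nodup_finRange n)

theorem abortCost_toAll_le (j : Fin n) (v : ℕ) (m : Msg V) : abortCost j v (toAll m) ≤ 7 :=
  abortCost_map_le (List.nodup_finRange n)

theorem cost_toJoined_le (j : Fin n) (s : State n V) (m : Msg V) : cost j (toJoined s m) ≤ 7 :=
  cost_map_le ((List.nodup_finRange n).filter _)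

theorem cost_eq_zero_of_ne {j : Fin n} {l : List (Fin n × Msg V)}
    (h : ∀ q ∈ l, q.1 ≠ j) : cost j l = 0 := by
  have : l.filter (fun q => q.1 = j ∧ ¬ q.2.IsAbort) = [] := by
    rw [List.filter_eq_nil_iff]
    intro q hq
    simp [h q hq]
  unfold cost
  rw [this]
  rfl

/-- One proof, one proposal, five votes and one suggestion. -/
theorem length_currentMsgs_le (p : Persistent V) (j : Fin n) : (currentMsgs p j).length ≤ 8 := by
  have key : ∀ {α : Type _} (o : Option α), o.toList.length ≤ 1 := by
    intro α o; cases o <;> simp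
  have h1 := key p.sentProof
  have h2 := key p.sentPropose
  have h3 := key p.sentSuggest
  have h4 := fun r => key (p.sentVote r)
  have h5 := h4 .echo
  have h6 := h4 .key1
  have h7 := h4 .key2
  have h8 := h4 .key3
  have h9 := h4 .lock
  unfold currentMsgs
  split_ifs <;> simp only [Round.all, List.length_append, List.length_map, List.flatMap_cons,
    List.flatMap_nil, List.length_nil] <;> omega

/-- The words that may still be sent in the slot `o`. -/
def slot {α : Type*} (o : Option α) : ℕ := if o = none then 7 else 0

@[simp] theorem slot_none {α : Type*} : slot (none : Option α) = 7 := by simp [slot]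

@[simp] theorem slot_some {α : Type*} (a : α) : slot (some a) = 0 := by simp [slot]

theorem slot_le {α : Type*} (o : Option α) : slot o ≤ 7 := by cases o <;> simp

/-- A bound for the words sent to a party when it joins view `v`, having requested view `r`. -/
def joinBudget (r v : ℕ) : ℕ := if r < v then 56 else 0

theorem joinBudget_le (r v : ℕ) : joinBudget r v ≤ 56 := by unfold joinBudget; split_ifs <;> omega

/-- A bound for what may still be sent to `j` in the current view. -/
def budget (j : Fin n) (s : State n V) : ℕ :=
  slot (s.pers.sentVote .echo) + slot (s.pers.sentVote .key1) + slot (s.pers.sentVote .key2) +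
    slot (s.pers.sentVote .key3) + slot (s.pers.sentVote .lock) + slot s.pers.sentSuggest +
    slot s.pers.sentPropose + slot s.pers.doneSent +
    joinBudget (s.tran.highestRequest j) s.pers.view

/-- Eight slots of 7 words, and again 8 · 7 = 56 for the messages handed over when `j` joins. -/
theorem budget_le (j : Fin n) (s : State n V) : budget j s ≤ 112 := by
  have h1 := slot_le s.pers.sentSuggest
  have h2 := slot_le s.pers.sentPropose
  have h3 := slot_le s.pers.doneSent
  have h4 := fun r => slot_le (s.pers.sentVote r)
  have h5 := h4 .echo
  have h6 := h4 .key1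
  have h7 := h4 .key2
  have h8 := h4 .key3
  have h9 := h4 .lock
  have h10 := joinBudget_le (s.tran.highestRequest j) s.pers.view
  unfold budget
  omega

/-- The messages of the effect `e` on `s` are covered by the budget. -/
structure Eff.Pays (j : Fin n) (s : State n V) (e : Eff n V) : Prop where
  budget : cost j e.2 + budget j e.1 ≤ ITHS.budget j s
  noAbort : ∀ q ∈ e.2, ¬ q.2.IsAbort

theorem Eff.Pays.refl (j : Fin n) (s : State n V) : Eff.Pays j s (s, []) :=
  ⟨by simp, by simp⟩

theorem Eff.Pays.andThen {j : Fin n} {s : State n V} {e : Eff n V} {h : State n V → Eff n V}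
    (h1 : e.Pays j s) (h2 : (h e.1).Pays j e.1) : (e.andThen h).Pays j s := by
  refine ⟨?_, fun q hq => ?_⟩
  · have := h1.budget
    have := h2.budget
    simp only [Eff.andThen, cost_append]
    omega
  · rcases List.mem_append.1 hq with hq | hq
    · exact h1.noAbort q hq
    · exact h2.noAbort q hq

theorem not_isAbort_toJoined {s : State n V} {m : Msg V} (hm : ¬ m.IsAbort) :
    ∀ q ∈ toJoined s m, ¬ q.2.IsAbort := by
  rintro ⟨l, m'⟩ hq
  obtain ⟨-, rfl⟩ := mem_toJoined.1 hq
  exact hm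

theorem not_isAbort_toAll {m : Msg V} (hm : ¬ m.IsAbort) :
    ∀ q ∈ (toAll m : List (Fin n × Msg V)), ¬ q.2.IsAbort := by
  rintro ⟨l, m'⟩ hq
  obtain rfl := mem_toAll.1 hq
  exact hm

/-! ### Paying for messages out of the budget -/

section

variable {j : Fin n} {s : State n V}

theorem trySuggest_pays : (trySuggest s).Pays j s := by
  unfold trySuggest
  split_ifs with h
  · refine ⟨?_, ?_⟩
    · have := cost_map_le (j := j)
        (m := Msg.suggest ⟨s.pers.key3, s.pers.key3Val, s.pers.key2⟩ s.pers.view)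
        ((List.nodup_finRange n).filter fun j => IsPrimary j s.pers.view)
      simp only [budget, h.1, slot_none, slot_some]
      omega
    · rintro ⟨l, m⟩ hq
      simp only [List.mem_map, Prod.mk.injEq] at hq
      obtain ⟨a, -, rfl, rfl⟩ := hq
      simp [Msg.IsAbort]
  · exact .refl j s

theorem sendVote_pays {r : Round} {x : V} {s' : State n V} (h : s.pers.sentVote r = none)
    (hb : budget j s' ≤ budget j s) (hs : s'.pers.sentVote = s.pers.sentVote) :
    (sendVote r x s').Pays j s := by
  refine ⟨?_, not_isAbort_toJoined (by simp [Msg.IsAbort])⟩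
  have h1 := cost_toJoined_le j s' (.vote r x s'.pers.view)
  have h2 : budget j (sendVote r x s').1 + 7 = budget j s' := by
    rw [← hs] at h
    cases r <;> simp only [sendVote, budget, h, slot_none] <;> simp <;> omega
  simp only [sendVote] at h2 ⊢
  omega

theorem tryEcho_pays {f : ℕ} : (tryEcho f s).Pays j s := by
  unfold tryEcho
  split
  · split_ifs with h
    · exact sendVote_pays h.1 le_rfl rfl
    · exact .refl j s
  · exact .refl j s

theorem tryPropose_pays {f : ℕ} {pick : Finset (Fin n) → Fin n} :
    (tryPropose f pick s).Pays j s := by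
  unfold tryPropose
  split_ifs with h
  · split
    · next g hg =>
      refine ⟨?_, not_isAbort_toJoined (by simp [Msg.IsAbort])⟩
      have h1 := cost_toJoined_le j s (.propose g.key3 g.val3 s.pers.view)
      simp only [budget, h.1, slot_none, slot_some]
      omega
    · exact .refl j s
  · exact .refl j s

theorem sendDone_pays {x : V} : (sendDone x s).Pays j s := by
  unfold sendDone
  split_ifs with h
  · refine ⟨?_, not_isAbort_toAll (by simp [Msg.IsAbort])⟩
    have h1 := cost_toAll_le j (Msg.done x)
    simp only [budget, h, slot_none, slot_some]
    omega
  · exact .refl j s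

theorem onQuorum_pays {f : ℕ} {r : Round} {x : V} : (onQuorum f r x s).Pays j s := by
  unfold onQuorum
  cases r <;> simp only
  · split_ifs with h
    exacts [sendVote_pays h le_rfl rfl, .refl j s]
  · split_ifs with h
    exacts [sendVote_pays h le_rfl rfl, .refl j s]
  · split_ifs with h
    exacts [sendVote_pays h le_rfl rfl, .refl j s]
  · split_ifs with h
    · exact Eff.Pays.andThen (e := sendVote .lock x
        { s with pers.lock := s.pers.view, pers.lockVal := x }) (sendVote_pays h le_rfl rfl)
        tryEcho_pays
    · exact .refl j s
  · exact sendDone_pays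

theorem Eff.Pays.of_state {s' : State n V} {e : Eff n V} (h : e.Pays j s')
    (hb : ITHS.budget j s' ≤ ITHS.budget j s) : e.Pays j s :=
  ⟨h.budget.trans hb, h.noAbort⟩

theorem onDone_pays {f : ℕ} {l : Fin n} {x : V} : (onDone f l x s).Pays j s := by
  have key : (amplifyDone f l x s).Pays j s := by
    unfold amplifyDone
    split_ifs
    · exact sendDone_pays.of_state (s := s) (s' := recordDone l x s) le_rfl
    · exact (Eff.Pays.refl j (recordDone l x s)).of_state (s := s) le_rfl
  rw [onDone_eq]
  split_ifs
  · exact ⟨key.budget, key.noAbort⟩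
  · exact key
  · exact .refl j s

theorem onRequest_pays {l : Fin n} {v : ℕ} : (onRequest l v s).Pays j s := by
  rw [onRequest_eq]
  split_ifs with h hv
  · refine Eff.Pays.andThen ⟨?_, ?_⟩ trySuggest_pays
    · by_cases hj : l = j
      · subst hj hv
        -- The at most eight messages of the view, of 7 words each, are paid by `joinBudget`, which
        -- drops from 56 to 0 because the recorded request reaches the current view.
        have h1 := cost_le_length l ((currentMsgs s.pers l).map fun m => (l, m))
        have h2 := length_currentMsgs_le s.pers l
        rw [List.length_map] at h1
        simp only [budget, joinBudget, recordRequest, Function.update_self, if_pos h, lt_irrefl, if_false]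
        omega
      · rw [cost_eq_zero_of_ne]
        · simp [budget, recordRequest, Function.update_of_ne (Ne.symm hj)]
        · simpa using fun _ _ => hj
    · rintro ⟨a, m⟩ hq
      simp only [List.mem_map, Prod.mk.injEq] at hq
      obtain ⟨m', hm, rfl, rfl⟩ := hq
      have := (mem_currentMsgs.1 hm).1
      cases m' <;> simp_all [Msg.IsAbort, Msg.IsMeantFor]
  · refine ⟨?_, by simp⟩
    simp only [cost_nil, zero_add, budget, joinBudget, recordRequest, Function.update_apply]
    split_ifs <;> subst_vars <;> omega
  · exact .refl j s

/-- The request and the proof cost 7 words each, and everything else is covered by a full budget: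
126 = 7 + 7 + 112. -/
theorem enterView_cost {Δ now : ℝ} {v : ℕ} :
    cost j (enterView Δ now v s).2 + budget j (enterView Δ now v s).1 ≤ 126 := by
  rw [enterView_eq]
  have h1 := (trySuggest_pays (j := j) (s := freshState Δ now v s)).budget
  have h2 := budget_le j (freshState Δ now v s)
  have h3 := cost_toAll_le j (Msg.request (V := V) v)
  have h4 := cost_toJoined_le j (freshState Δ now v s) (Msg.proof s.pers.key1 v)
  simp only [Eff.andThen, cost_append]
  omega

theorem enterView_noAbort {Δ now : ℝ} {v : ℕ} :
    ∀ q ∈ (enterView Δ now v s).2, ¬ q.2.IsAbort := by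
  rw [enterView_eq]
  intro q hq
  rcases List.mem_append.1 hq with hq | hq
  · rcases List.mem_append.1 hq with hq | hq
    · exact not_isAbort_toAll (by simp [Msg.IsAbort]) q hq
    · exact not_isAbort_toJoined (by simp [Msg.IsAbort]) q hq
  · exact (trySuggest_pays (j := q.1)).noAbort q hq

theorem cost_amplifyAbort {f : ℕ} {i l : Fin n} {v : ℕ} :
    cost j (amplifyAbort f i l v s).2 = 0 := by
  apply cost_eq_zero_of_abort
  unfold amplifyAbort
  split_ifs
  · rintro ⟨a, m⟩ hq
    obtain rfl := mem_toAll.1 hq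
    trivial
  · simp

/-- An action after which party `i` sends messages again. -/
def Action.IsRecovery (i j : Fin n) (a : Action n V) : Prop :=
  a = .reboot i ∨ ∃ u, a = .deliver j i (.recover u)

theorem length_onRecover_le {l : Fin n} {v : ℕ} : (onRecover l v s).2.length ≤ 11 := by
  have h1 := length_currentMsgs_le s.pers l
  have h2 : (s.pers.doneSent.toList).length ≤ 1 := by cases s.pers.doneSent <;> simp
  unfold onRecover
  split_ifs <;> simp <;> omega

variable {f : ℕ} {Δ now : ℝ} {pick : Finset (Fin n) → Fin n} {i : Fin n}

theorem receive_cost {l : Fin n} {m : Msg V} (hm : ∀ v, m ≠ .recover v)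
    (hv : (receive f Δ now pick i l m s).1.pers.view = s.pers.view) :
    cost j (receive f Δ now pick i l m s).2 + budget j (receive f Δ now pick i l m s).1 ≤
      budget j s := by
  unfold receive at *
  cases m <;> simp only at *
  case recover v => exact absurd rfl (hm v)
  all_goals split_ifs at * with hd
  all_goals try exact (Eff.Pays.refl j s).budget
  · exact onRequest_pays.budget
  · rw [onSuggest_eq]
    split_ifs
    · exact (tryPropose_pays.of_state (s' := recordSuggest _ _ s) le_rfl).budget
    · exact (Eff.Pays.refl j s).budget
  · rw [onPropose_eq]
    split_ifs
    · exact (tryEcho_pays.of_state (s' := recordProposal _ s) le_rfl).budget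
    · exact (Eff.Pays.refl j s).budget
  · rw [onProof_eq]
    split_ifs
    · exact (tryEcho_pays.of_state (s' := recordProof _ _ s) le_rfl).budget
    · exact (Eff.Pays.refl j s).budget
  · rw [onVote_eq]
    split_ifs
    · exact (onQuorum_pays.of_state (s' := recordVote _ _ _ s) le_rfl).budget
    · exact ((Eff.Pays.refl j (recordVote _ _ _ s)).of_state (s := s) le_rfl).budget
    · exact (Eff.Pays.refl j s).budget
  · exact onDone_pays.budget
  · rw [onAbort_eq] at hv ⊢
    split_ifs at hv ⊢ with h1 h2
    · simp only [Eff.andThen, enterView_view] at hv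
      omega
    · rw [cost_amplifyAbort, zero_add]
      unfold budget
      rw [amplifyAbort_pers, amplifyAbort_tran]
    · exact (Eff.Pays.refl j s).budget

theorem receive_cost_of_view_ne {l : Fin n} {m : Msg V}
    (hv : (receive f Δ now pick i l m s).1.pers.view ≠ s.pers.view) :
    cost j (receive f Δ now pick i l m s).2 + budget j (receive f Δ now pick i l m s).1 ≤
      126 := by
  have ht := perform_tStep f Δ now pick i s (.deliver l i m)
  have hp : perform f Δ now pick i s (.deliver l i m) = receive f Δ now pick i l m s := by
    simp [perform]
  rw [hp] at ht
  obtain ⟨l', v, ha⟩ := ht.exists_abort hv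
  simp only [Action.deliver.injEq, true_and] at ha
  obtain ⟨rfl, rfl⟩ := ha
  unfold receive at *
  simp only at *
  split_ifs at hv ⊢ with hd
  · rw [onAbort_eq] at hv ⊢
    split_ifs at hv ⊢ with h1 h2
    · simp only [Eff.andThen, cost_append, cost_amplifyAbort, zero_add]
      exact enterView_cost
    · simp at hv
    · exact absurd rfl hv
  · exact absurd rfl hv

/-- Ordinary actions are paid from the budget. A reboot sends two messages to `j` and restores at
most the 56 words for joining, as the requests are forgotten; a reply to `recover` has at most 11
messages. Both stay below 126. -/
theorem perform_cost {a : Action n V}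
    (hv : (perform f Δ now pick i s a).1.pers.view = s.pers.view) :
    cost j (perform f Δ now pick i s a).2 + budget j (perform f Δ now pick i s a).1 ≤
      budget j s + 126 * (if a.IsRecovery i j then 1 else 0) := by
  unfold perform at *
  cases a with
  | idle => simp
  | timer l =>
    simp only
    split_ifs <;> try simp; done
    all_goals
      unfold onTimer
      split_ifs
      · rw [cost_eq_zero_of_abort]
        · simp [budget]
        · rintro ⟨a, m⟩ hq
          obtain rfl := mem_toAll.1 hq
          trivial
      · simp
  | reboot l =>
    simp only
    by_cases h : l = i
    · subst h
      rw [if_pos rfl, if_pos (.inl rfl)]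
      unfold onReboot
      have h1 := cost_toAll_le j (Msg.recover (V := V) s.pers.view)
      have h2 := cost_toAll_le j (Msg.request (V := V) s.pers.view)
      split_ifs
      · simp only [cost_append]
        simp only [budget]
        have := joinBudget_le ((Transient.empty : Transient n V).highestRequest j) s.pers.view
        omega
      · simp only [cost_nil]
        simp only [budget]
        have := joinBudget_le ((Transient.empty : Transient n V).highestRequest j) s.pers.view
        omega
    · rw [if_neg h]; simp
  | deliver l k m =>
    simp only at *
    by_cases h : k = i
    swap
    · rw [if_neg h]; simp
    subst h
    rw [if_pos rfl] at *
    by_cases hm : ∃ v, m = .recover v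
    · obtain ⟨v, rfl⟩ := hm
      simp only [receive]
      by_cases hj : l = j
      · subst hj
        rw [if_pos (.inr ⟨v, rfl⟩)]
        have h1 := cost_le_length l (onRecover l v s).2
        have h2 := length_onRecover_le (l := l) (v := v) (s := s)
        have h3 : (onRecover l v s).1 = s := rfl
        rw [h3]
        omega
      · have h3 : (onRecover l v s).1 = s := rfl
        rw [h3, cost_eq_zero_of_ne]
        · omega
        · simp only [onRecover, List.mem_map]
          rintro q ⟨m', -, rfl⟩
          exact hj
    · push Not at hm
      exact (receive_cost hm hv).trans (Nat.le_add_right _ _)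

theorem perform_cost_of_view_ne {a : Action n V}
    (hv : (perform f Δ now pick i s a).1.pers.view ≠ s.pers.view) :
    cost j (perform f Δ now pick i s a).2 + budget j (perform f Δ now pick i s a).1 ≤ 126 := by
  unfold perform at *
  cases a with
  | idle => exact absurd rfl hv
  | timer l =>
    simp only at hv ⊢
    unfold onTimer at *
    split_ifs at hv ⊢ <;> exact absurd rfl hv
  | reboot l =>
    simp only at hv ⊢
    unfold onReboot at *
    split_ifs at hv ⊢ <;> exact absurd rfl hv
  | deliver l k m =>
    simp only at *
    split_ifs at hv ⊢ with h
    · subst h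
      exact receive_cost_of_view_ne hv
    · exact absurd rfl hv

/-- A bound for the words in messages `⟨abort, v⟩` to a single party that are still to be sent. -/
def abortBudget (i : Fin n) (v : ℕ) (s : State n V) : ℕ :=
  (if s.tran.highestAbort i < v then 7 else 0) +
    (if s.pers.view < v ∨ (s.pers.view = v ∧ s.tran.deadline ≠ none) then 7 else 0)

theorem abortBudget_le (i : Fin n) (v : ℕ) (s : State n V) : abortBudget i v s ≤ 14 := by
  unfold abortBudget; split_ifs <;> omega

theorem abortCost_eq_zero_of_noAbort {v : ℕ} {l : List (Fin n × Msg V)}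
    (h : ∀ q ∈ l, ¬ q.2.IsAbort) : abortCost j v l = 0 :=
  abortCost_eq_zero fun hl => h _ hl trivial

/-- Amplification sends an `abort` only for a view above the own entry and raises that entry to this
view, so without reboots it sends each one at most once. -/
theorem abortCost_amplifyAbort {l : Fin n} {u v : ℕ} (hu : s.tran.highestAbort l < u) :
    abortCost j v (amplifyAbort f i l u s).2 +
        (if raisedAborts f i l u s.tran.highestAbort i < v then 7 else 0) ≤
      (if s.tran.highestAbort i < v then 7 else 0) := by
  have hle := le_raisedAborts (f := f) (i := i) hu i
  unfold amplifyAbort raisedAborts at *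
  split_ifs at hle ⊢ with h1 h2 h3 h4
  all_goals try simp only [abortCost_nil]; omega
  · have := abortCost_toAll_le j v
      (Msg.abort (V := V) (kthLargest (f + 1) (Function.update s.tran.highestAbort l u)))
    rw [abortCost_eq_zero]
    rw [mem_toAll]
    simp only [Function.update_self] at h2
    simp only [Msg.abort.injEq]
    omega
  · exact (abortCost_toAll_le j v _).trans (by omega)
  · rw [abortCost_eq_zero]
    rw [mem_toAll]
    simp only [Function.update_self] at h2 hle
    simp only [Msg.abort.injEq]
    have : s.tran.highestAbort i ≤ Function.update s.tran.highestAbort l u i := by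
      by_cases h : i = l
      · subst h; simpa using hu.le
      · simp [h]
    omega

theorem receive_noAbort {l : Fin n} {m : Msg V} (hm : ∀ v, m ≠ .recover v)
    (hm' : ∀ v, m ≠ .abort v) : ∀ q ∈ (receive f Δ now pick i l m s).2, ¬ q.2.IsAbort := by
  unfold receive
  cases m <;> simp only
  case recover v => exact absurd rfl (hm v)
  case abort v => exact absurd rfl (hm' v)
  all_goals split_ifs with hd
  all_goals try (simp; done)
  · exact (onRequest_pays (j := i)).noAbort
  · rw [onSuggest_eq]
    split_ifs
    · exact (tryPropose_pays (j := i)).noAbort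
    · simp
  · rw [onPropose_eq]
    split_ifs
    · exact (tryEcho_pays (j := i)).noAbort
    · simp
  · rw [onProof_eq]
    split_ifs
    · exact (tryEcho_pays (j := i)).noAbort
    · simp
  · rw [onVote_eq]
    split_ifs
    · exact (onQuorum_pays (j := i)).noAbort
    · simp
    · simp
  · exact (onDone_pays (j := i)).noAbort

theorem receive_abortCost {l : Fin n} {m : Msg V} {v : ℕ} (hm : ∀ v, m ≠ .recover v) :
    abortCost j v (receive f Δ now pick i l m s).2 +
      abortBudget i v (receive f Δ now pick i l m s).1 ≤ abortBudget i v s := by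
  by_cases hm' : ∃ u, m = .abort u
  · obtain ⟨u, rfl⟩ := hm'
    simp only [receive]
    split_ifs with hd
    swap
    · simp
    rw [onAbort_eq]
    split_ifs with h1 h2
    · have h3 := abortCost_amplifyAbort (f := f) (i := i) (j := j) (v := v) h1
      have h4 := abortCost_eq_zero_of_noAbort (j := j) (v := v)
        (enterView_noAbort (Δ := Δ) (now := now) (s := (amplifyAbort f i l u s).1)
          (v := kthLargest (n - f) (amplifyAbort f i l u s).1.tran.highestAbort + 1))
      simp only [Eff.andThen, abortCost_append, h4, abortBudget, enterView_tran, enterView_view]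
      simp only [freshState, amplifyAbort_tran] at h2 ⊢
      -- The timer part of the budget cannot grow: the new view w + 1 exceeds the old one, so if its
      -- timer may still send the message for v, the old view was below v.
      generalize raisedAborts f i l u s.tran.highestAbort = A at *
      generalize kthLargest (n - f) A = w at *
      split_ifs at h3 ⊢ <;> omega
    · have h3 := abortCost_amplifyAbort (f := f) (i := i) (j := j) (v := v) h1
      simp only [abortBudget, amplifyAbort_view, amplifyAbort_tran]
      split_ifs at h3 ⊢ <;> omega
    · simp
  · push Not at hm'
    rw [abortCost_eq_zero_of_noAbort (receive_noAbort hm hm'), zero_add]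
    have ht := perform_tStep f Δ now pick i s (.deliver l i m)
    have hp : perform f Δ now pick i s (.deliver l i m) = receive f Δ now pick i l m s := by
      simp [perform]
    rw [hp] at ht
    obtain ⟨h1, h2, h3⟩ := ht.aborts_of_ne (by simp) (by simp) (by simpa using fun _ v _ => hm' v)
    unfold abortBudget
    rw [h1, h2, h3]

/-- The message for v has two sources, amplification and the timer of view v, and each is used up by
sending. A reboot forgets the own entry and restarts the timer, which restores at most 14 words. -/
theorem perform_abortCost {a : Action n V} {v : ℕ} :
    abortCost j v (perform f Δ now pick i s a).2 +
        abortBudget i v (perform f Δ now pick i s a).1 ≤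
      abortBudget i v s + 126 * (if a.IsRecovery i j then 1 else 0) := by
  unfold perform
  cases a with
  | idle => simp
  | timer l =>
    simp only
    split_ifs <;> try simp; done
    all_goals
      refine le_trans ?_ (Nat.le_add_right _ _)
      unfold onTimer
      split_ifs with h
      · simp only [abortBudget]
        have h1 := abortCost_toAll_le j v (Msg.abort (V := V) s.pers.view)
        have h2 : s.tran.deadline ≠ none := by
          obtain ⟨-, d, hd, -⟩ := h
          rw [Option.mem_def] at hd
          simp [hd]
        by_cases hv : s.pers.view = v
        · subst hv
          simp only [h2, lt_irrefl, ne_eq, not_true_eq_false, and_false, or_false, if_false,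
            false_or, not_false_eq_true, and_self, if_true]
          omega
        · rw [abortCost_eq_zero]
          · simp [hv]
          · rw [mem_toAll]
            simp [Ne.symm hv]
      · simp
  | reboot l =>
    simp only
    by_cases h : l = i
    · subst h
      rw [if_pos rfl, if_pos (.inl rfl)]
      have h1 := abortBudget_le l v (onReboot Δ now s).1
      rw [abortCost_eq_zero_of_noAbort]
      · omega
      · unfold onReboot
        split_ifs
        · intro q hq
          rcases List.mem_append.1 hq with hq | hq
          · exact not_isAbort_toAll (by simp [Msg.IsAbort]) q hq
          · exact not_isAbort_toAll (by simp [Msg.IsAbort]) q hq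
        · simp
    · rw [if_neg h]; simp
  | deliver l k m =>
    simp only
    by_cases h : k = i
    swap
    · rw [if_neg h]; simp
    subst h
    rw [if_pos rfl]
    by_cases hm : ∃ u, m = .recover u
    · obtain ⟨u, rfl⟩ := hm
      simp only [receive]
      have h3 : (onRecover l u s).1 = s := rfl
      rw [h3]
      by_cases hj : l = j
      · subst hj
        rw [if_pos (.inr ⟨u, rfl⟩)]
        have h1 := abortCost_le_length l v (onRecover l u s).2
        have h2 := length_onRecover_le (l := l) (v := u) (s := s)
        omega
      · rw [abortCost_eq_zero]
        · omega
        · simp only [onRecover, List.mem_map, Prod.mk.injEq]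
          rintro ⟨m', -, rfl, -⟩
          exact hj rfl
    · push Not at hm
      exact (receive_abortCost hm).trans (Nat.le_add_right _ _)

end

/-! ### Whole executions -/

/-- Amortization: Ψ bounds what may still be spent without recoveries, w is what is spent, and each
of the recoveries counted by c adds at most B. -/
theorem sum_le_of_potential {w c Ψ : ℕ → ℕ} {B : ℕ} (h0 : w 0 + Ψ 0 ≤ B)
    (h : ∀ k, w (k + 1) + Ψ (k + 1) ≤ Ψ k + B * c (k + 1)) (K : ℕ) :
    ∑ k ∈ Finset.range (K + 1), w k ≤ B * (1 + ∑ k ∈ Finset.range (K + 1), c k) := by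
  have key : ∀ K, ∑ k ∈ Finset.range (K + 1), w k + Ψ K ≤
      B * (1 + ∑ k ∈ Finset.range (K + 1), c k) := by
    intro K
    induction K with
    | zero =>
      simp only [zero_add, Finset.sum_range_one]
      nlinarith [Nat.zero_le (B * c 0)]
    | succ K ih =>
      rw [Finset.sum_range_succ, Finset.sum_range_succ (f := c)]
      have := h K
      nlinarith
  exact (Nat.le_add_right _ _).trans (key K)

namespace IsRun

variable {f : ℕ} {Δ : ℝ} {x : Fin n → V} {E : Execution n V}

/-- The state in which a party with input `x` begins. -/
def initState (x : V) : State n V :=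
  { pers :=
      { view := 0, lock := 0, lockVal := x, key3 := 0, key3Val := x
        key2 := ⟨0, x, -1⟩, key1 := ⟨0, x, -1⟩
        sentSuggest := none, sentProof := none, sentPropose := none, sentVote := fun _ => none
        doneSent := none, lastAbort := 0, decided := none }
    tran := Transient.empty }

theorem state_zero (h : IsRun f Δ x E) {i : Fin n} (hi : i ∉ E.faulty) :
    E.state 0 i = (enterView Δ (E.clock i (E.time 0)) 1 (initState (x i))).1 :=
  congrArg Prod.fst (h.start i hi)

theorem sends_zero (h : IsRun f Δ x E) {i : Fin n} (hi : i ∉ E.faulty) :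
    E.sends 0 i = (enterView Δ (E.clock i (E.time 0)) 1 (initState (x i))).2 :=
  congrArg Prod.snd (h.start i hi)

theorem state_succ (h : IsRun f Δ x E) {i : Fin n} (hi : i ∉ E.faulty) (k : ℕ) :
    E.state (k + 1) i = (perform f Δ (E.clock i (E.time (k + 1))) (E.pick (k + 1)) i (E.state k i)
      (E.act (k + 1))).1 :=
  congrArg Prod.fst (h.step k i hi)

theorem sends_succ (h : IsRun f Δ x E) {i : Fin n} (hi : i ∉ E.faulty) (k : ℕ) :
    E.sends (k + 1) i = (perform f Δ (E.clock i (E.time (k + 1))) (E.pick (k + 1)) i (E.state k i)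
      (E.act (k + 1))).2 :=
  congrArg Prod.snd (h.step k i hi)

theorem sum_viewWords (E : Execution n V) (i j : Fin n) (v k : ℕ) :
    (((E.sends k i).filter fun q =>
      q.1 = j ∧ ¬ q.2.IsAbort ∧ (E.state k i).pers.view = v).map fun q => q.2.words).sum =
      if (E.state k i).pers.view = v then cost j (E.sends k i) else 0 := by
  split_ifs with h
  · simp only [h, and_true]
    rfl
  · simp [h]

theorem viewWords_le (h : IsRun f Δ x E) (hf : f + 1 ≤ n - f) {i : Fin n} (hi : i ∉ E.faulty)
    (j : Fin n) (v K : ℕ) :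
    E.viewWords i j v K ≤ 126 * (1 + E.recoveriesInView i j v K) := by
  unfold Execution.viewWords Execution.recoveriesInView
  rw [Finset.card_filter]
  simp only [sum_viewWords]
  -- Before view v the potential reserves the cost of entering it, during v it is the remaining
  -- budget, and afterwards nothing is left to pay.
  refine sum_le_of_potential (Ψ := fun k => if (E.state k i).pers.view < v then 126 else
    if (E.state k i).pers.view = v then budget j (E.state k i) else 0) ?_ ?_ K
  · have h1 := enterView_cost (j := j) (s := initState (n := n) (x i)) (Δ := Δ)
      (now := E.clock i (E.time 0)) (v := 1)
    rw [← h.state_zero hi, ← h.sends_zero hi] at h1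
    split_ifs <;> omega
  · intro k
    have hs := h.state_succ hi k
    have hm := h.sends_succ hi k
    have hview : (E.state k i).pers.view ≤ (E.state (k + 1) i).pers.view := by
      rw [hs]
      exact PSteps.view_le (perform_steps _ hf (h.pick_mem (k + 1)))
    have hb := budget_le j (E.state (k + 1) i)
    have hrec : E.IsRecovery i j (k + 1) ↔ (E.act (k + 1)).IsRecovery i j := Iff.rfl
    simp only [hrec]
    by_cases hv : (E.state (k + 1) i).pers.view = (E.state k i).pers.view
    · have h1 := perform_cost (j := j) (hs ▸ hv)
      rw [← hs, ← hm] at h1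
      rw [hv] at hview ⊢
      split_ifs at h1 ⊢ <;> first | omega | simp_all
    · have h1 := perform_cost_of_view_ne (j := j) (hs ▸ hv)
      rw [← hs, ← hm] at h1
      split_ifs at h1 ⊢ <;> omega

theorem abortWords_le (h : IsRun f Δ x E) {i : Fin n} (hi : i ∉ E.faulty) (j : Fin n) (v K : ℕ) :
    E.abortWords i j v K ≤ 126 * (1 + E.recoveries i j K) := by
  unfold Execution.abortWords Execution.recoveries
  rw [Finset.card_filter]
  refine sum_le_of_potential (Ψ := fun k => abortBudget i v (E.state k i)) ?_ ?_ K
  · have h1 := abortCost_eq_zero_of_noAbort (j := j) (v := v)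
      (enterView_noAbort (s := initState (n := n) (x i)) (Δ := Δ)
        (now := E.clock i (E.time 0)) (v := 1))
    have h2 := abortBudget_le i v (E.state 0 i)
    rw [← h.sends_zero hi] at h1
    change abortCost j v (E.sends 0 i) + abortBudget i v (E.state 0 i) ≤ _
    omega
  · intro k
    have h1 := perform_abortCost (f := f) (Δ := Δ) (now := E.clock i (E.time (k + 1)))
      (pick := E.pick (k + 1)) (i := i) (j := j) (s := E.state k i) (a := E.act (k + 1)) (v := v)
    rw [← h.state_succ hi, ← h.sends_succ hi] at h1
    exact h1

end IsRun

/-! ## The history of an execution -/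

namespace Execution

variable (E : Execution n V)

/-- Before event `e`, the memory of party `j` showed that `j` had sent `m`, or would send it to the
parties that join the view. -/
def Shown (e : ℕ) (j : Fin n) (m : Msg V) : Prop := ∃ e' < e, (E.state e' j).pers.Backs m

/-- The view is an integer so that locks, keys and previous keys can be put in its place directly.
-/
def Voted (e : ℕ) (j : Fin n) (r : Round) (x : V) (u : ℤ) : Prop :=
  ∃ w : ℕ, (w : ℤ) = u ∧ E.Shown e j (.vote r x w)

/-- Before event `e`, all nonfaulty members of some `n - f` parties voted for `x`. -/
def Quorum (f e : ℕ) (r : Round) (x : V) (u : ℤ) : Prop :=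
  n - f ≤ (Finset.univ.filter fun j => j ∈ E.faulty ∨ E.Voted e j r x u).card

variable {E}

theorem Shown.mono {e e' : ℕ} {j : Fin n} {m : Msg V} (h : E.Shown e j m) (he : e ≤ e') :
    E.Shown e' j m := by
  obtain ⟨k, hk, hm⟩ := h
  exact ⟨k, by omega, hm⟩

theorem Voted.mono {e e' : ℕ} {j : Fin n} {r : Round} {x : V} {u : ℤ} (h : E.Voted e j r x u)
    (he : e ≤ e') : E.Voted e' j r x u := by
  obtain ⟨w, hw, hm⟩ := h
  exact ⟨w, hw, hm.mono he⟩

theorem Quorum.mono {f e e' : ℕ} {r : Round} {x : V} {u : ℤ} (h : E.Quorum f e r x u)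
    (he : e ≤ e') : E.Quorum f e' r x u := by
  refine h.trans (Finset.card_le_card fun j hj => ?_)
  simp only [Finset.mem_filter, Finset.mem_univ, true_and] at hj ⊢
  exact hj.imp_right fun h => h.mono he

end Execution

namespace IsRun

variable {f : ℕ} {Δ : ℝ} {x : Fin n → V} {E : Execution n V}

theorem steps (h : IsRun f Δ x E) (hf : f + 1 ≤ n - f) {i : Fin n} (hi : i ∉ E.faulty) (k : ℕ) :
    PSteps f i (E.act (k + 1) = .timer i ∧
        ∃ d ∈ (E.state k i).tran.deadline, d ≤ E.clock i (E.time (k + 1)))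
      (E.state (k + 1) i).tran (E.state k i).pers (E.state (k + 1) i).pers := by
  rw [h.state_succ hi]
  exact perform_steps _ hf (h.pick_mem (k + 1))

theorem tStep (h : IsRun f Δ x E) {i : Fin n} (hi : i ∉ E.faulty) (k : ℕ) :
    TStep f Δ (E.clock i (E.time (k + 1))) i (E.state k i) (E.act (k + 1))
      (E.state (k + 1) i) := by
  rw [h.state_succ hi]
  exact perform_tStep _ _ _ _ _ _ _

theorem settled (h : IsRun f Δ x E) (hf : f + 1 ≤ n - f) {i : Fin n} (hi : i ∉ E.faulty) (k : ℕ) :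
    Settled f i (E.state k i) := by
  induction k with
  | zero =>
    rw [h.state_zero hi]
    refine enterView_settled (by omega) ?_ ?_ ?_ ?_ <;>
      simp [initState, Transient.empty, count_none, kthLargest_zero]
    omega
  | succ k ih =>
    rw [h.state_succ hi]
    exact perform_settled _ hf (h.pick_mem (k + 1)) ih

theorem view_pos (h : IsRun f Δ x E) (hf : f + 1 ≤ n - f) {i : Fin n} (hi : i ∉ E.faulty)
    (k : ℕ) : 0 < (E.state k i).pers.view :=
  (Nat.zero_le _).trans_lt (h.settled hf hi k).view

theorem sendSpec (h : IsRun f Δ x E) (hf : f + 1 ≤ n - f) {i : Fin n} (hi : i ∉ E.faulty)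
    (k : ℕ) : SendSpec i (E.state k i) (E.act (k + 1)) (E.state (k + 1) i, E.sends (k + 1) i) := by
  rw [h.step k i hi]
  exact perform_sendSpec _ _ _ _ _ _ (h.view_pos hf hi k)

theorem backs (h : IsRun f Δ x E) (hf : f + 1 ≤ n - f) {i : Fin n} (hi : i ∉ E.faulty) {k : ℕ}
    {j : Fin n} {m : Msg V} (hm : (j, m) ∈ E.sends k i) : (E.state k i).pers.Backs m := by
  cases k with
  | zero =>
    rw [h.sends_zero hi] at hm
    rw [h.state_zero hi]
    exact enterView_sound i _ _ _ _ _ hm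
  | succ k => exact (h.sendSpec hf hi k).sound _ hm

/-- Authenticated channels are used through this lemma: the message was sent at an earlier event,
where the memory of the sender backed it. -/
theorem shown_of_deliver (h : IsRun f Δ x E) (hf : f + 1 ≤ n - f) {i j : Fin n}
    (hi : i ∉ E.faulty) {k : ℕ} {m : Msg V} (hk : E.act k = .deliver i j m) : E.Shown k i m := by
  obtain ⟨k', hk', hm⟩ := h.authentic k i hi j m hk
  exact ⟨k', hk', h.backs hf hi hm⟩

theorem view_mono (h : IsRun f Δ x E) (hf : f + 1 ≤ n - f) {i : Fin n} (hi : i ∉ E.faulty)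
    {k l : ℕ} (hkl : k ≤ l) : (E.state k i).pers.view ≤ (E.state l i).pers.view := by
  induction l, hkl using Nat.le_induction with
  | base => exact le_rfl
  | succ l _ ih => exact ih.trans (h.steps hf hi l).view_le

theorem lastAbort_mono (h : IsRun f Δ x E) (hf : f + 1 ≤ n - f) {i : Fin n} (hi : i ∉ E.faulty)
    {k l : ℕ} (hkl : k ≤ l) : (E.state k i).pers.lastAbort ≤ (E.state l i).pers.lastAbort := by
  induction l, hkl using Nat.le_induction with
  | base => exact le_rfl
  | succ l _ ih => exact ih.trans (h.steps hf hi l).lastAbort_le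

theorem doneSent_mono (h : IsRun f Δ x E) (hf : f + 1 ≤ n - f) {i : Fin n} (hi : i ∉ E.faulty)
    {k l : ℕ} (hkl : k ≤ l) {y : V} (hy : (E.state k i).pers.doneSent = some y) :
    (E.state l i).pers.doneSent = some y := by
  induction l, hkl using Nat.le_induction with
  | base => exact hy
  | succ l _ ih => exact (h.steps hf hi l).doneSent_eq ih

theorem decided_mono (h : IsRun f Δ x E) (hf : f + 1 ≤ n - f) {i : Fin n} (hi : i ∉ E.faulty)
    {k l : ℕ} (hkl : k ≤ l) {y : V} (hy : (E.state k i).pers.decided = some y) :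
    (E.state l i).pers.decided = some y := by
  induction l, hkl using Nat.le_induction with
  | base => exact hy
  | succ l _ ih => exact (h.steps hf hi l).decided_eq ih

/-- Within a view, what the memory shows remains. -/
theorem backs_mono (h : IsRun f Δ x E) (hf : f + 1 ≤ n - f) {i : Fin n} (hi : i ∉ E.faulty)
    {k l : ℕ} (hkl : k ≤ l) (hv : (E.state k i).pers.view = (E.state l i).pers.view) {m : Msg V}
    (hm : (E.state k i).pers.Backs m) : (E.state l i).pers.Backs m := by
  induction l, hkl using Nat.le_induction with
  | base => exact hm
  | succ l hkl ih =>
    have h1 := h.view_mono hf hi hkl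
    have h2 := h.view_mono hf hi (Nat.le_succ l)
    simp only [Nat.succ_eq_add_one] at h2
    exact (h.steps hf hi l).backs (by omega) (ih (by omega))

/-- In a given view, a nonfaulty party votes for at most one value in each round. -/
theorem shown_vote_unique (h : IsRun f Δ x E) (hf : f + 1 ≤ n - f) {i : Fin n}
    (hi : i ∉ E.faulty) {e e' w : ℕ} {r : Round} {y z : V} (h1 : E.Shown e i (.vote r y w))
    (h2 : E.Shown e' i (.vote r z w)) : y = z := by
  obtain ⟨k, -, hk, hy⟩ := h1
  obtain ⟨l, -, hl, hz⟩ := h2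
  rcases le_total k l with hkl | hkl
  · have := (h.backs_mono hf hi hkl (by omega) (m := .vote r y w) ⟨hk, hy⟩).2
    rw [hz] at this
    exact (Option.some.inj this).symm
  · have := (h.backs_mono hf hi hkl (by omega) (m := .vote r z w) ⟨hl, hz⟩).2
    rw [hy] at this
    exact Option.some.inj this

theorem voted_unique (h : IsRun f Δ x E) (hf : f + 1 ≤ n - f) {i : Fin n}
    (hi : i ∉ E.faulty) {e e' : ℕ} {u : ℤ} {r : Round} {y z : V} (h1 : E.Voted e i r y u)
    (h2 : E.Voted e' i r z u) : y = z := by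
  obtain ⟨w, rfl, h1⟩ := h1
  obtain ⟨w', hw, h2⟩ := h2
  obtain rfl : w' = w := by exact_mod_cast hw
  exact h.shown_vote_unique hf hi h1 h2

theorem _root_.ITHS.Execution.Quorum.exists_common (h : IsRun f Δ x E) (hf : 3 * f < n)
    {e e' : ℕ} {r r' : Round} {y z : V} {u w : ℤ} (h1 : E.Quorum f e r y u)
    (h2 : E.Quorum f e' r' z w) : ∃ j ∉ E.faulty, E.Voted e j r y u ∧ E.Voted e' j r' z w := by
  obtain ⟨j, hA, hB, hj⟩ := exists_common_notMem hf h.card_faulty h1 h2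
  simp only [Finset.mem_filter, Finset.mem_univ, true_and] at hA hB
  exact ⟨j, hj, hA.resolve_left hj, hB.resolve_left hj⟩

theorem quorum_unique (h : IsRun f Δ x E) (hf : 3 * f < n)
    {e e' : ℕ} {r : Round} {y z : V} {u : ℤ} (h1 : E.Quorum f e r y u)
    (h2 : E.Quorum f e' r z u) : y = z := by
  obtain ⟨j, hj, hA, hB⟩ := h1.exists_common h hf h2
  exact h.voted_unique (by omega) hj hA hB

end IsRun

/-! ## Soundness of the transient memory -/

/-- The transient memory `t`, in view `u`, only holds messages that nonfaulty parties sent. -/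
structure TranSound (E : Execution n V) (e : ℕ) (t : Transient n V) (u : ℕ) : Prop where
  vote : ∀ j ∉ E.faulty, ∀ r x, t.voteFrom r j = some x → E.Shown e j (.vote r x u)
  proof : ∀ j ∉ E.faulty, ∀ c, t.proofFrom j = some c → E.Shown e j (.proof c u)
  suggest : ∀ j ∉ E.faulty, ∀ g, t.suggestFrom j = some g → E.Shown e j (.suggest g u)
  propose : ∀ k x, t.proposal = some (k, x) →
    ∀ j ∉ E.faulty, IsPrimary j u → E.Shown e j (.propose k x u)
  done : ∀ j ∉ E.faulty, ∀ x, t.doneFrom j = some x → E.Shown e j (.done x)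

theorem isPrimary_unique {i j : Fin n} {u : ℕ} (hi : IsPrimary i u) (hj : IsPrimary j u) :
    i = j := Fin.ext (hi.trans hj.symm)

namespace IsRun

variable {f : ℕ} {Δ : ℝ} {x : Fin n → V} {E : Execution n V}

theorem tranSound_zero (h : IsRun f Δ x E) {i : Fin n} (hi : i ∉ E.faulty) (e u : ℕ) :
    TranSound E e (E.state 0 i).tran u := by
  rw [h.state_zero hi, enterView_tran]
  constructor <;> simp [freshState, initState, Transient.empty]

/-- The view u ranges between those before and after the event because the elementary steps pass
through both with the same final transient memory. If they differ, the arrays of the view are empty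
and u is irrelevant. -/
theorem tranSound_succ (h : IsRun f Δ x E) (hf : f + 1 ≤ n - f) {i : Fin n} (hi : i ∉ E.faulty)
    {e : ℕ} (ih : TranSound E e (E.state e i).tran (E.state e i).pers.view) {u : ℕ}
    (hu : (E.state e i).pers.view ≤ u) (hu' : u ≤ (E.state (e + 1) i).pers.view) :
    TranSound E (e + 1) (E.state (e + 1) i).tran u := by
  have ht := h.tStep hi e
  refine ⟨?_, ?_, ?_, ?_, ?_⟩
  · intro j hj r y hy
    obtain ⟨hv, h1 | h1⟩ := ht.voteFrom_eq hy
    · obtain rfl : u = (E.state e i).pers.view := by omega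
      exact (ih.vote j hj r y h1).mono (Nat.le_succ e)
    · obtain rfl : u = (E.state (e + 1) i).pers.view := by omega
      exact h.shown_of_deliver hf hj h1
  · intro j hj c hc
    obtain ⟨hv, h1 | h1⟩ := ht.proofFrom_eq hc
    · obtain rfl : u = (E.state e i).pers.view := by omega
      exact (ih.proof j hj c h1).mono (Nat.le_succ e)
    · obtain rfl : u = (E.state (e + 1) i).pers.view := by omega
      exact h.shown_of_deliver hf hj h1
  · intro j hj g hg
    obtain ⟨hv, h1 | h1⟩ := ht.suggestFrom_eq hg
    · obtain rfl : u = (E.state e i).pers.view := by omega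
      exact (ih.suggest j hj g h1).mono (Nat.le_succ e)
    · obtain rfl : u = (E.state (e + 1) i).pers.view := by omega
      exact h.shown_of_deliver hf hj h1
  · intro k y hq j hj hp
    obtain ⟨hv, h1 | ⟨j', hj', h1⟩⟩ := ht.proposal_eq hq
    · obtain rfl : u = (E.state e i).pers.view := by omega
      exact (ih.propose k y h1 j hj hp).mono (Nat.le_succ e)
    · obtain rfl : u = (E.state (e + 1) i).pers.view := by omega
      obtain rfl := isPrimary_unique hp hj'
      exact h.shown_of_deliver hf hj h1
  · intro j hj y hy
    rcases ht.doneFrom_eq hy with h1 | h1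
    · exact (ih.done j hj y h1).mono (Nat.le_succ e)
    · exact h.shown_of_deliver hf hj h1

theorem tranSound (h : IsRun f Δ x E) (hf : f + 1 ≤ n - f) {i : Fin n} (hi : i ∉ E.faulty)
    (e : ℕ) : TranSound E e (E.state e i).tran (E.state e i).pers.view := by
  induction e with
  | zero => exact h.tranSound_zero hi 0 _
  | succ e ih => exact h.tranSound_succ hf hi ih (h.view_mono hf hi (Nat.le_succ e)) le_rfl

end IsRun

/-! ## Soundness of the persistent memory -/

def Round.prev : Round → Option Round
  | .echo => none
  | .key1 => some .echo
  | .key2 => some .key1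
  | .key3 => some .key2
  | .lock => some .key3

/-- The record `c` was written after quorums in round `r`. -/
structure RecSound (E : Execution n V) (f e : ℕ) (r : Round) (c : KeyRec V) : Prop where
  lt : c.prev < c.key
  key : c.key ≤ 0 ∨ E.Quorum f e r c.val c.key
  prev : c.prev ≤ 0 ∨ ∃ z, z ≠ c.val ∧ E.Quorum f e r z c.prev

/-- The persistent memory `p` of party `i` is in accordance with the events before `e`. -/
structure PSound (E : Execution n V) (f e : ℕ) (i : Fin n) (p : Persistent V) : Prop where
  rec1 : RecSound E f e .echo p.key1
  rec2 : RecSound E f e .key1 p.key2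
  key1_le : p.key1.key ≤ p.view
  key2_le : p.key2.key ≤ p.view
  key3_le : 0 ≤ p.key3 ∧ p.key3 ≤ p.view
  lock_le : 0 ≤ p.lock ∧ p.lock ≤ p.view
  fresh1 : p.sentVote .key1 = none → p.key1.key < p.view
  fresh2 : p.sentVote .key2 = none → p.key2.key < p.view
  fresh3 : p.sentVote .key3 = none → p.key3 < p.view
  lock : p.lock = 0 ∨ E.Quorum f e .key3 p.lockVal p.lock
  key3 : p.key3 = 0 ∨ E.Quorum f e .key2 p.key3Val p.key3
  votes : ∀ r' r x, r'.prev = some r → p.sentVote r' = some x → E.Quorum f e r x p.view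
  vote1 : ∀ x, p.sentVote .key1 = some x → p.key1.key = p.view ∧ p.key1.val = x
  vote2 : ∀ x, p.sentVote .key2 = some x → p.key2.key = p.view ∧ p.key2.val = x
  vote3 : ∀ x, p.sentVote .key3 = some x → p.key3 = p.view
  vote4 : ∀ x, p.sentVote .lock = some x → p.lock = p.view
  hist1 : ∀ x u, E.Voted e i .key1 x u → SupportsKey u x p.key1
  hist2 : ∀ x u, E.Voted e i .key2 x u → SupportsKey u x p.key2
  hist3 : ∀ x u, E.Voted e i .key3 x u → u ≤ p.key3
  hist4 : ∀ x u, E.Voted e i .lock x u → u ≤ p.lock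
  suggest : ∀ g, p.sentSuggest = some g →
    (g.key3 = 0 ∨ E.Quorum f e .key2 g.val3 g.key3) ∧ 0 ≤ g.key3 ∧ RecSound E f e .key1 g.key2 ∧
    (p.sentVote .key3 = none → g.key3 < p.view) ∧
    (p.sentVote .key2 = none → g.key2.key < p.view) ∧
    (∀ x (u : ℤ), u < p.view → E.Voted e i .key2 x u → SupportsKey u x g.key2) ∧
    (∀ x (u : ℤ), u < p.view → E.Voted e i .key3 x u → u ≤ g.key3)
  proof : ∀ c, p.sentProof = some c → RecSound E f e .echo c ∧ c.key < p.view ∧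
    ∀ x (u : ℤ), u < p.view → E.Voted e i .key1 x u → SupportsKey u x c
  propose : ∀ k x, p.sentPropose = some (k, x) →
    (∃ A : Finset (Fin n), n - f ≤ A.card ∧ ∀ j ∈ A, j ∉ E.faulty →
      ∃ g, E.Shown e j (.suggest g p.view) ∧ g.key3 ≤ k) ∧
    (k = 0 ∨ (k < p.view ∧ ∃ c, RecSound E f e .key1 c ∧ c.key < p.view ∧ SupportsKey k x c))
  echo : ∀ x, p.sentVote .echo = some x → ∀ j ∉ E.faulty, IsPrimary j p.view →
    ∃ k, E.Shown e j (.propose k x p.view)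
  done : ∀ x, p.doneSent = some x → ∃ u : ℕ, E.Quorum f e .lock x u
  decided : ∀ x, p.decided = some x →
    f + 1 ≤ (Finset.univ.filter fun j => j ∉ E.faulty ∧ E.Shown e j (.done x)).card

section

variable {E : Execution n V} {f e : ℕ} {i : Fin n} {p : Persistent V}

theorem RecSound.mono {e' : ℕ} {r : Round} {c : KeyRec V} (h : RecSound E f e r c) (he : e ≤ e') :
    RecSound E f e' r c :=
  ⟨h.lt, h.key.imp_right fun h => h.mono he,
    h.prev.imp_right fun ⟨z, hz, h⟩ => ⟨z, hz, h.mono he⟩⟩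

/-- When the value changes, the old key becomes `prev`, and the old quorum was for a value different
from the new one. So `prev` certifies a second value with a quorum. -/
theorem RecSound.update {r : Round} {c : KeyRec V} (h : RecSound E f e r c) {y : V} {v : ℕ}
    (hv : c.key < v) (hq : E.Quorum f e r y v) : RecSound E f e r (c.update y v) := by
  unfold KeyRec.update
  split_ifs with hy
  · exact ⟨h.lt.trans hv, .inr (by simpa [hy] using hq), h.prev⟩
  · exact ⟨hv, .inr hq, h.key.imp_right fun hk => ⟨c.val, hy, hk⟩⟩

/-- Support is never lost: with an unchanged value the key only grows, and otherwise the old key,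
which is at least u in either case, is kept as `prev`. -/
theorem SupportsKey.update {u : ℤ} {z : V} {c : KeyRec V} (h : SupportsKey u z c)
    (hlt : c.prev < c.key) {y : V} {v : ℕ} (hv : c.key < v) : SupportsKey u z (c.update y v) := by
  unfold KeyRec.update
  split_ifs with hy
  · exact h.imp_right fun ⟨h1, h2⟩ => ⟨h1.trans hv.le, h2⟩
  · rcases h with h | ⟨h, -⟩
    · exact .inl (h.trans hlt.le)
    · exact .inl h

theorem quorum_of_count {t : Transient n V} {u : ℕ} (hT : TranSound E e t u) {r : Round} {y : V}
    (hq : n - f ≤ count (t.voteFrom r) y) : E.Quorum f e r y u := by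
  refine hq.trans (Finset.card_le_card fun j hj => ?_)
  simp only [Finset.mem_filter, Finset.mem_univ, true_and] at hj ⊢
  by_cases hjf : j ∈ E.faulty
  · exact .inl hjf
  · exact .inr ⟨u, rfl, hT.vote j hjf r y hj⟩

/-- Time passes. -/
theorem PSound.succ (h : PSound E f e i p) (hp : (E.state e i).pers = p) :
    PSound E f (e + 1) i p := by
  have hq {r : Round} {y : V} {u : ℤ} (h : E.Quorum f e r y u) : E.Quorum f (e + 1) r y u :=
    h.mono (Nat.le_succ e)
  have hs {j : Fin n} {m : Msg V} (h : E.Shown e j m) : E.Shown (e + 1) j m :=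
    h.mono (Nat.le_succ e)
  have hr {r : Round} {c : KeyRec V} (h : RecSound E f e r c) : RecSound E f (e + 1) r c :=
    h.mono (Nat.le_succ e)
  -- The only votes that join the history are those in the current slots, and the fields `vote1` to
  -- `vote4` tie these to the keys and the lock.
  have hvoted {r : Round} {y : V} {u : ℤ} (h : E.Voted (e + 1) i r y u) :
      E.Voted e i r y u ∨ (u = p.view ∧ p.sentVote r = some y) := by
    obtain ⟨w, rfl, e', he', hb⟩ := h
    rcases Nat.lt_succ_iff_lt_or_eq.1 he' with h1 | rfl
    · exact .inl ⟨w, rfl, e', h1, hb⟩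
    · rw [hp] at hb
      exact .inr ⟨by rw [hb.1], hb.2⟩
  have hvoted' {r : Round} {y : V} {u : ℤ} (hu : u < p.view) (h : E.Voted (e + 1) i r y u) :
      E.Voted e i r y u := by
    rcases hvoted h with h | ⟨h, -⟩
    · exact h
    · omega
  refine { h with
    rec1 := hr h.rec1
    rec2 := hr h.rec2
    lock := h.lock.imp_right hq
    key3 := h.key3.imp_right hq
    votes := fun r' r y h1 h2 => hq (h.votes r' r y h1 h2)
    hist1 := ?_
    hist2 := ?_
    hist3 := ?_
    hist4 := ?_
    suggest := ?_
    proof := ?_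
    propose := ?_
    echo := fun y hy j hj hp => (h.echo y hy j hj hp).imp fun k hk => hs hk
    done := fun y hy => (h.done y hy).imp fun u hu => hq hu
    decided := ?_ }
  · intro y u hy
    rcases hvoted hy with h1 | ⟨rfl, h1⟩
    · exact h.hist1 y u h1
    · have := h.vote1 y h1
      exact .inr ⟨this.1.ge, this.2.symm⟩
  · intro y u hy
    rcases hvoted hy with h1 | ⟨rfl, h1⟩
    · exact h.hist2 y u h1
    · have := h.vote2 y h1
      exact .inr ⟨this.1.ge, this.2.symm⟩
  · intro y u hy
    rcases hvoted hy with h1 | ⟨rfl, h1⟩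
    · exact h.hist3 y u h1
    · exact (h.vote3 y h1).ge
  · intro y u hy
    rcases hvoted hy with h1 | ⟨rfl, h1⟩
    · exact h.hist4 y u h1
    · exact (h.vote4 y h1).ge
  · intro g hg
    obtain ⟨h1, h2, h3, h4, h5, h6, h7⟩ := h.suggest g hg
    exact ⟨h1.imp_right hq, h2, hr h3, h4, h5, fun y u hu hy => h6 y u hu (hvoted' hu hy),
      fun y u hu hy => h7 y u hu (hvoted' hu hy)⟩
  · intro c hc
    obtain ⟨h1, h2, h3⟩ := h.proof c hc
    exact ⟨hr h1, h2, fun y u hu hy => h3 y u hu (hvoted' hu hy)⟩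
  · intro k y hk
    obtain ⟨⟨A, hA, h1⟩, h2⟩ := h.propose k y hk
    refine ⟨⟨A, hA, fun j hj hjf => ?_⟩, h2.imp_right fun ⟨h3, c, h4, h5⟩ => ⟨h3, c, hr h4, h5⟩⟩
    obtain ⟨g, hg, h3⟩ := h1 j hj hjf
    exact ⟨g, hs hg, h3⟩
  · intro y hy
    refine (h.decided y hy).trans (Finset.card_le_card fun j hj => ?_)
    simp only [Finset.mem_filter, Finset.mem_univ, true_and] at hj ⊢
    exact hj.imp_right hs

/-- Keys and locks are written only on recorded quorums. On entering a view all keys are at most the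
old view, which gives the `fresh` fields; these make `key1` and `key2` strictly increase at each
update, as `RecSound` requires. What a proposal or a `done` message inherits from another party
comes from that party's invariant at an earlier event, `hpast`. -/
theorem PSound.step {fired : Prop} {t : Transient n V} {p' : Persistent V} (hn : 3 * f < n)
    (hF : E.faulty.card ≤ f) (h : PSound E f e i p) (hT : TranSound E e t p.view)
    (hpast : ∀ e' < e, ∀ j ∉ E.faulty, PSound E f e' j (E.state e' j).pers)
    (hs : PStep f i fired t p p') : PSound E f e i p' := by
  cases hs with
  | enter v hv hw =>
    have hv' : (p.view : ℤ) < v := by exact_mod_cast hv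
    refine { h with
      key1_le := h.key1_le.trans hv'.le
      key2_le := h.key2_le.trans hv'.le
      key3_le := ⟨h.key3_le.1, h.key3_le.2.trans hv'.le⟩
      lock_le := ⟨h.lock_le.1, h.lock_le.2.trans hv'.le⟩
      fresh1 := fun _ => h.key1_le.trans_lt hv'
      fresh2 := fun _ => h.key2_le.trans_lt hv'
      fresh3 := fun _ => h.key3_le.2.trans_lt hv'
      votes := by simp
      vote1 := by simp
      vote2 := by simp
      vote3 := by simp
      vote4 := by simp
      suggest := by simp
      propose := by simp
      echo := by simp
      proof := ?_ }
    simp only [Option.some.injEq]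
    rintro c rfl
    exact ⟨h.rec1, h.key1_le.trans_lt hv', fun x u _ => h.hist1 x u⟩
  | suggest _ =>
    refine { h with suggest := ?_ }
    simp only [Option.some.injEq]
    rintro g rfl
    -- A suggestion may be formed late, after votes in the same view. Hence its keys are only
    -- claimed to be below the view as long as those votes are missing.
    exact ⟨h.key3, h.key3_le.1, h.rec2, h.fresh3, h.fresh2, fun x u _ => h.hist2 x u,
      fun x u _ => h.hist3 x u⟩
  | propose j g hnone hc hj hg =>
    refine { h with propose := ?_ }
    simp only [Option.some.injEq, Prod.mk.injEq]
    rintro k y ⟨rfl, rfl⟩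
    obtain ⟨hacc, g', hg', hmax⟩ := Finset.mem_filter.1 hj
    obtain rfl : g' = g := by
      rw [Option.mem_def] at hg'
      exact Option.some.inj (hg'.symm.trans hg)
    refine ⟨⟨accepted f ⟨p, t⟩, hc, fun l hl hlf => ?_⟩, ?_⟩
    · obtain ⟨g₂, hg₂, -⟩ := (Finset.mem_filter.1 hl).2
      exact ⟨g₂, hT.suggest l hlf g₂ hg₂, hmax l hl g₂ hg₂⟩
    · obtain ⟨g₂, hg₂, h1⟩ := (Finset.mem_filter.1 hacc).2
      obtain rfl : g₂ = g' := by
        rw [Option.mem_def] at hg₂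
        exact Option.some.inj (hg₂.symm.trans hg)
      refine h1.imp_right fun ⟨h1, h2⟩ => ⟨h1, ?_⟩
      -- One of the f + 1 supporters of the accepted key is nonfaulty, so its `key2` record is
      -- sound.
      obtain ⟨l, hl, hlf⟩ := exists_notMem_of_card_lt
        (lt_of_lt_of_le (Nat.lt_succ_of_le hF) h2)
      obtain ⟨g₃, hg₃, h3, h4, h5⟩ := (Finset.mem_filter.1 hl).2
      obtain ⟨e', he', hb⟩ := hT.suggest l hlf g₃ hg₃
      exact ⟨g₃.key2, (((hpast e' he' l hlf).suggest g₃ hb.2).2.2.1).mono he'.le, h4, h5⟩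
  | echo key y hnone hp hc =>
    refine { h with
      fresh1 := by simpa using h.fresh1
      fresh2 := by simpa using h.fresh2
      fresh3 := by simpa using h.fresh3
      vote1 := by simpa using h.vote1
      vote2 := by simpa using h.vote2
      vote3 := by simpa using h.vote3
      vote4 := by simpa using h.vote4
      suggest := by simpa using h.suggest
      votes := ?_
      echo := ?_ }
    · intro r' r z hr hz
      have : r' ≠ .echo := by rintro rfl; simp [Round.prev] at hr
      dsimp only at hz
      rw [Function.update_of_ne this] at hz
      exact h.votes r' r z hr hz
    · simp only [Function.update_self, Option.some.injEq]
      rintro z rfl j hj hpj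
      exact ⟨key, hT.propose key y hp j hj hpj⟩
  | key1 y hnone hq =>
    have hfresh := h.fresh1 hnone
    have hQ := quorum_of_count hT hq
    have hupd : (p.key1.update y p.view).key = p.view ∧ (p.key1.update y p.view).val = y := by
      unfold KeyRec.update
      split_ifs with hy
      · exact ⟨rfl, hy⟩
      · exact ⟨rfl, rfl⟩
    refine { h with
      rec1 := h.rec1.update hfresh hQ
      key1_le := hupd.1.le
      fresh1 := by simp
      fresh2 := by simpa using h.fresh2
      fresh3 := by simpa using h.fresh3
      vote1 := by simpa using hupd
      vote2 := by simpa using h.vote2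
      vote3 := by simpa using h.vote3
      vote4 := by simpa using h.vote4
      hist1 := fun z u hz => (h.hist1 z u hz).update h.rec1.lt hfresh
      suggest := by simpa using h.suggest
      votes := ?_
      echo := by simpa using h.echo }
    intro r' r z hr hz
    by_cases hr' : r' = .key1
    · subst hr'
      simp only [Round.prev, Option.some.injEq, Function.update_self] at hr hz
      subst hr hz
      exact hQ
    · dsimp only at hz
      rw [Function.update_of_ne hr'] at hz
      exact h.votes r' r z hr hz
  | key2 y hnone hq =>
    have hfresh := h.fresh2 hnone
    have hQ := quorum_of_count hT hq
    have hupd : (p.key2.update y p.view).key = p.view ∧ (p.key2.update y p.view).val = y := by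
      unfold KeyRec.update
      split_ifs with hy
      · exact ⟨rfl, hy⟩
      · exact ⟨rfl, rfl⟩
    refine { h with
      rec2 := h.rec2.update hfresh hQ
      key2_le := hupd.1.le
      fresh1 := by simpa using h.fresh1
      fresh2 := by simp
      fresh3 := by simpa using h.fresh3
      vote1 := by simpa using h.vote1
      vote2 := by simpa using hupd
      vote3 := by simpa using h.vote3
      vote4 := by simpa using h.vote4
      hist2 := fun z u hz => (h.hist2 z u hz).update h.rec2.lt hfresh
      suggest := ?_
      votes := ?_
      echo := by simpa using h.echo }
    · intro r' r z hr hz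
      by_cases hr' : r' = .key2
      · subst hr'
        simp only [Round.prev, Option.some.injEq, Function.update_self] at hr hz
        subst hr hz
        exact hQ
      · dsimp only at hz
        rw [Function.update_of_ne hr'] at hz
        exact h.votes r' r z hr hz
    · intro g hg
      obtain ⟨h1, h2, h3, h4, h5, h6, h7⟩ := h.suggest g hg
      exact ⟨h1, h2, h3, by simpa using h4, by simp, h6, h7⟩
  | key3 y hnone hq =>
    have hQ := quorum_of_count hT hq
    refine { h with
      key3 := .inr hQ
      key3_le := ⟨by simp, le_rfl⟩
      fresh1 := by simpa using h.fresh1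
      fresh2 := by simpa using h.fresh2
      fresh3 := by simp
      vote1 := by simpa using h.vote1
      vote2 := by simpa using h.vote2
      vote3 := by simp
      vote4 := by simpa using h.vote4
      hist3 := fun z u hz => (h.hist3 z u hz).trans h.key3_le.2
      suggest := ?_
      votes := ?_
      echo := by simpa using h.echo }
    · intro r' r z hr hz
      by_cases hr' : r' = .key3
      · subst hr'
        simp only [Round.prev, Option.some.injEq, Function.update_self] at hr hz
        subst hr hz
        exact hQ
      · dsimp only at hz
        rw [Function.update_of_ne hr'] at hz
        exact h.votes r' r z hr hz
    · intro g hg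
      obtain ⟨h1, h2, h3, h4, h5, h6, h7⟩ := h.suggest g hg
      exact ⟨h1, h2, h3, by simp, by simpa using h5, h6, h7⟩
  | lock y hnone hq =>
    have hQ := quorum_of_count hT hq
    refine { h with
      lock := .inr hQ
      lock_le := ⟨by simp, le_rfl⟩
      fresh1 := by simpa using h.fresh1
      fresh2 := by simpa using h.fresh2
      fresh3 := by simpa using h.fresh3
      vote1 := by simpa using h.vote1
      vote2 := by simpa using h.vote2
      vote3 := by simpa using h.vote3
      vote4 := by simp
      hist4 := fun z u hz => (h.hist4 z u hz).trans h.lock_le.2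
      suggest := by simpa using h.suggest
      votes := ?_
      echo := by simpa using h.echo }
    intro r' r z hr hz
    by_cases hr' : r' = .lock
    · subst hr'
      simp only [Round.prev, Option.some.injEq, Function.update_self] at hr hz
      subst hr hz
      exact hQ
    · dsimp only at hz
      rw [Function.update_of_ne hr'] at hz
      exact h.votes r' r z hr hz
  | done y hnone hq =>
    refine { h with done := ?_ }
    simp only [Option.some.injEq]
    rintro z rfl
    rcases hq with hq | hq
    · exact ⟨p.view, quorum_of_count hT hq⟩
    -- An amplified value comes from an earlier nonfaulty sender, whose lock quorum is inherited.
    · obtain ⟨l, hl, hlf⟩ := exists_notMem_of_card_lt (lt_of_lt_of_le (Nat.lt_succ_of_le hF) hq)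
      obtain ⟨e', he', hb⟩ := hT.done l hlf _ (Finset.mem_filter.1 hl).2
      exact ((hpast e' he' l hlf).done _ hb).imp fun u hu => hu.mono he'.le
  | decide y hnone hq hd =>
    refine { h with decided := ?_ }
    simp only [Option.some.injEq]
    rintro z rfl
    refine (succ_le_card_sdiff hn hF hq).trans (Finset.card_le_card fun l hl => ?_)
    simp only [Finset.mem_sdiff, Finset.mem_filter, Finset.mem_univ, true_and] at hl ⊢
    exact ⟨hl.2, hT.done l hl.2 _ hl.1⟩
  | abort u hu => exact { h with }

end

/-- Induction along elementary steps, keeping track of the views. -/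
theorem PSteps.induct {f : ℕ} {i : Fin n} {fired : Prop} {t : Transient n V} {a b : Persistent V}
    {P : Persistent V → Prop} (h : PSteps f i fired t a b) (ha : P a)
    (hstep : ∀ p p', a.view ≤ p.view → p'.view ≤ b.view → PSteps f i fired t p' b →
      PStep f i fired t p p' → P p → P p') : P b := by
  have key : ∀ p, PSteps f i fired t p b → a.view ≤ p.view → P p → P b := by
    intro p hp
    induction hp using Relation.ReflTransGen.head_induction_on with
    | refl => exact fun _ h => h
    | head h1 h2 ih =>
      intro hv hP
      exact ih (hv.trans h1.view_le) (hstep _ _ hv (PSteps.view_le h2) h2 h1 hP)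
  exact key a h le_rfl ha

namespace IsRun

variable {f : ℕ} {Δ : ℝ} {x : Fin n → V} {E : Execution n V}

theorem pSound (h : IsRun f Δ x E) (hf : 3 * f < n) (e : ℕ) :
    ∀ i ∉ E.faulty, PSound E f e i (E.state e i).pers := by
  induction e using Nat.strong_induction_on with
  | _ e ih =>
    intro i hi
    cases e with
    | zero =>
      rw [h.state_zero hi]
      have h0 : ∀ r y u, ¬ E.Voted 0 i r y u := by
        rintro r y u ⟨w, -, e', he', -⟩
        exact absurd he' (Nat.not_lt_zero _)
      have hfresh : PSound E f 0 i (freshState Δ (E.clock i (E.time 0)) 1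
          (initState (n := n) (x i))).pers := by
        constructor <;> simp [freshState, initState, h0]
        · exact ⟨by simp, .inl le_rfl, .inl (by simp)⟩
        · exact ⟨by simp, .inl le_rfl, .inl (by simp)⟩
        · exact ⟨by simp, .inl le_rfl, .inl (by simp)⟩
      rw [enterView_eq]
      refine PSteps.induct (P := PSound E f 0 i) (f := f) (i := i) (fired := False)
        (trySuggest_steps (Transient.empty) (freshState Δ (E.clock i (E.time 0)) 1
          (initState (n := n) (x i)))) hfresh fun p p' _ _ _ hs hp => ?_
      refine hp.step hf h.card_faulty ?_ (by simp) hs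
      constructor <;> simp [Transient.empty]
    | succ e =>
      have hff : f + 1 ≤ n - f := by omega
      -- First the history is extended by the state at event e with the memory unchanged; then the
      -- elementary steps of the event follow.
      refine PSteps.induct (P := PSound E f (e + 1) i) (h.steps hff hi e)
        ((ih e (Nat.lt_succ_self e) i hi).succ rfl) fun p p' hv hv' _ hs hp => ?_
      refine hp.step hf h.card_faulty ?_ ih hs
      exact h.tranSound_succ hff hi (h.tranSound hff hi e) hv (hs.view_le.trans hv')

end IsRun

/-! ## Agreement -/

namespace IsRun

variable {f : ℕ} {Δ : ℝ} {x : Fin n → V} {E : Execution n V}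

/-- A quorum contains a nonfaulty party (it meets itself in one), and that party voted only after a
quorum of the preceding round. -/
theorem quorum_prev (h : IsRun f Δ x E) (hf : 3 * f < n) {e : ℕ} {r r' : Round} {y : V} {u : ℤ}
    (hr : r'.prev = some r) (hq : E.Quorum f e r' y u) : E.Quorum f e r y u := by
  obtain ⟨j, hj, ⟨w, rfl, e', he', hw, hb⟩, -⟩ := hq.exists_common h hf hq
  have := (h.pSound hf e' j hj).votes r' r y hr hb
  rw [hw]
  exact this.mono he'.le

theorem quorum_echo (h : IsRun f Δ x E) (hf : 3 * f < n) {e : ℕ} {r : Round} {y : V} {u : ℤ}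
    (hq : E.Quorum f e r y u) : E.Quorum f e .echo y u := by
  cases r with
  | echo => exact hq
  | key1 => exact h.quorum_prev hf rfl hq
  | key2 => exact h.quorum_prev hf rfl (h.quorum_prev hf rfl hq)
  | key3 => exact h.quorum_prev hf rfl (h.quorum_prev hf rfl (h.quorum_prev hf rfl hq))
  | lock =>
    exact h.quorum_prev hf rfl (h.quorum_prev hf rfl (h.quorum_prev hf rfl
      (h.quorum_prev hf rfl hq)))

theorem quorum_pos (h : IsRun f Δ x E) (hf : 3 * f < n) {e : ℕ} {r : Round} {y : V} {u : ℤ}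
    (hq : E.Quorum f e r y u) : 0 < u := by
  obtain ⟨j, hj, ⟨w, rfl, e', he', hw, hb⟩, -⟩ := hq.exists_common h hf hq
  have := h.view_pos (by omega) hj e'
  rw [hw]
  exact_mod_cast this

theorem sentVote_zero (h : IsRun f Δ x E) {i : Fin n} (hi : i ∉ E.faulty) (r : Round) :
    (E.state 0 i).pers.sentVote r = none := by
  rw [h.state_zero hi, enterView_eq]
  simp only [Eff.andThen]
  rw [trySuggest_pers]
  rfl

/-- Once `n - f` parties have locked a value, the later quorums are for the same value. -/
theorem eq_of_lock_quorum (h : IsRun f Δ x E) (hf : 3 * f < n) {e₀ : ℕ} {a : V} {v : ℤ}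
    (hL : E.Quorum f e₀ .lock a v) (e : ℕ) :
    ∀ z u, v ≤ u → E.Quorum f e .echo z u → z = a := by
  have hff : f + 1 ≤ n - f := by omega
  have hv0 := h.quorum_pos hf hL
  induction e using Nat.strong_induction_on with
  | _ e ih =>
  intro z u hu hz
  rcases hu.eq_or_lt with rfl | hu
  · exact h.quorum_unique hf hz (h.quorum_echo hf hL)
  -- The party i locked a in view v' and echoed z in the later view w.
  obtain ⟨i, hi, ⟨v', rfl, e₂, -, hv', hb'⟩, ⟨w, rfl, e', he', hw, hb⟩⟩ := hL.exists_common h hf hz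
  have hu' : v' < w := by exact_mod_cast hu
  -- The inner induction goes back to the elementary step in which i filled its echo slot, since the
  -- echo condition is known only there.
  have key : ∀ e₁ < e, (E.state e₁ i).pers.view = w →
      (E.state e₁ i).pers.sentVote .echo = some z → z = a := by
    intro e₁ he₁
    induction e₁ with
    | zero => intro _ h1; simp [h.sentVote_zero hi] at h1
    | succ e₁ ihe =>
      have hind := PSteps.induct
        (P := fun p => PSound E f (e₁ + 1) i p ∧
          (p.view = w → p.sentVote .echo = some z → z = a))
        (h.steps hff hi e₁)
        ⟨(h.pSound hf e₁ i hi).succ rfl, ihe (by omega)⟩ ?_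
      · exact hind.2
      intro p p' hpv hpv' _ hs ⟨hp, hpz⟩
      have hT := h.tranSound_succ hff hi (h.tranSound hff hi e₁) hpv (hs.view_le.trans hpv')
      refine ⟨hp.step hf h.card_faulty hT (fun e'' _ j hj => h.pSound hf e'' j hj) hs, ?_⟩
      cases hs with
      | enter => simp
      | echo key y hnone hprop hc =>
        simp only [Function.update_self, Option.some.injEq]
        rintro hpw rfl
        -- The views of i do not decrease and v' < w, so the lock vote precedes the echo.
        have hvoted : E.Voted (e₁ + 1) i .lock a v' := by
          refine ⟨v', rfl, e₂, ?_, hv', hb'⟩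
          by_contra hlt
          have := h.view_mono hff hi (not_lt.1 hlt)
          have := hpv'
          simp only at this
          omega
        have hlock := hp.hist4 a v' hvoted
        have hq : E.Quorum f (e₁ + 1) .key3 p.lockVal p.lock :=
          hp.lock.resolve_left (by omega)
        -- The current lock is from view v' or later, and the quorum behind it is complete before
        -- event e₁ + 1 < e.
        have hval : p.lockVal = a := ih (e₁ + 1) he₁ _ _ hlock (h.quorum_echo hf hq)
        rcases hc with hc | hc | ⟨-, -, hc⟩
        · simp only at hc; omega
        · exact hc.trans hval
        -- A nonfaulty proof that opens the lock witnesses echo quorums before event e₁ + 1 in views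
        -- at least v': either two for different values, or one for a value other than a. Both
        -- contradict the induction hypothesis.
        · obtain ⟨j, hj, hjf⟩ := exists_notMem_of_card_lt
            (lt_of_lt_of_le (Nat.lt_succ_of_le h.card_faulty) hc)
          obtain ⟨c, hc, hlt, -, hsup⟩ := (Finset.mem_filter.1 hj).2
          obtain ⟨e₃, he₃, -, hcb⟩ := hT.proof j hjf c hc
          have hrec := ((h.pSound hf e₃ j hjf).proof c hcb).1.mono he₃.le
          simp only [SupportsOpening] at hsup
          rcases hsup with hsup | ⟨hsup, hne⟩
          · obtain ⟨z', hz', hq'⟩ := hrec.prev.resolve_left (by omega)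
            have h1 := ih (e₁ + 1) he₁ _ _ (by omega) hq'
            have h2 := ih (e₁ + 1) he₁ _ _ (by omega) (hrec.key.resolve_left (by omega))
            exact absurd (h1.trans h2.symm) hz'
          · have h2 := ih (e₁ + 1) he₁ _ _ (by omega) (hrec.key.resolve_left (by omega))
            exact absurd (h2.trans hval.symm) hne
      | key1 | key2 | key3 | lock => simpa using hpz
      | _ => exact hpz
  exact key e' he' hw.symm hb

/-- Both values have lock quorums, and the one in the earlier view dictates the value of the other.
-/
theorem done_unique (h : IsRun f Δ x E) (hf : 3 * f < n) {i j : Fin n} (hi : i ∉ E.faulty)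
    (hj : j ∉ E.faulty) {k l : ℕ} {a b : V} (ha : (E.state k i).pers.doneSent = some a)
    (hb : (E.state l j).pers.doneSent = some b) : a = b := by
  obtain ⟨u, hu⟩ := (h.pSound hf k i hi).done a ha
  obtain ⟨w, hw⟩ := (h.pSound hf l j hj).done b hb
  rcases le_total (u : ℤ) w with huw | huw
  · exact (h.eq_of_lock_quorum hf hu l b w huw (h.quorum_echo hf hw)).symm
  · exact h.eq_of_lock_quorum hf hw k a u huw (h.quorum_echo hf hu)

theorem exists_done_of_decided (h : IsRun f Δ x E) (hf : 3 * f < n) {i : Fin n}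
    (hi : i ∉ E.faulty) {k : ℕ} {a : V} (ha : (E.state k i).pers.decided = some a) :
    ∃ j ∉ E.faulty, ∃ l, (E.state l j).pers.doneSent = some a := by
  have h1 := (h.pSound hf k i hi).decided a ha
  obtain ⟨j, hj⟩ := Finset.card_pos.1 ((Nat.succ_pos f).trans_le h1)
  obtain ⟨hjf, e, -, hb⟩ := (Finset.mem_filter.1 hj).2
  exact ⟨j, hjf, e, hb⟩

theorem agreement (h : IsRun f Δ x E) (hf : 3 * f < n) {i j : Fin n} (hi : i ∉ E.faulty)
    (hj : j ∉ E.faulty) {k l : ℕ} {a b : V} (ha : (E.state k i).pers.decided = some a)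
    (hb : (E.state l j).pers.decided = some b) : a = b := by
  obtain ⟨i', hi', k', hk'⟩ := h.exists_done_of_decided hf hi ha
  obtain ⟨j', hj', l', hl'⟩ := h.exists_done_of_decided hf hj hb
  exact h.done_unique hf hi' hj' hk' hl'

end IsRun

/-! ## Validity -/

/-- All values that a party may propagate are equal to `a`. -/
structure Persistent.Only (a : V) (p : Persistent V) : Prop where
  key3 : p.key3Val = a
  suggest : ∀ g, p.sentSuggest = some g → g.val3 = a
  propose : ∀ k x, p.sentPropose = some (k, x) → x = a
  vote : ∀ r x, p.sentVote r = some x → x = a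
  done : ∀ x, p.doneSent = some x → x = a
  decided : ∀ x, p.decided = some x → x = a

theorem exists_of_count_pos {a : Fin n → Option V} {y : V} (h : 0 < count a y) :
    ∃ j, a j = some y := by
  obtain ⟨j, hj⟩ := Finset.card_pos.1 h
  exact ⟨j, (Finset.mem_filter.1 hj).2⟩

/-- Without faulty parties every proposed or voted value is copied from an earlier message. The
values of locks and of `key1` and `key2` need no tracking: they are only compared, never proposed.
-/
theorem Persistent.Only.step {E : Execution n V} {f e : ℕ} {i : Fin n} {fired : Prop}
    {t : Transient n V} {p p' : Persistent V} {a : V} (hn : 0 < n - f) (hE : E.faulty = ∅)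
    (h : p.Only a) (hT : TranSound E e t p.view)
    (hpast : ∀ e' < e, ∀ j, (E.state e' j).pers.Only a)
    (hs : PStep f i fired t p p') : p'.Only a := by
  have hmem (j : Fin n) : j ∉ E.faulty := by simp [hE]
  have hvote {r : Round} {y : V} (hq : n - f ≤ count (t.voteFrom r) y) : y = a := by
    obtain ⟨j, hj⟩ := exists_of_count_pos (hn.trans_le hq)
    obtain ⟨e', he', -, hb⟩ := hT.vote j (hmem j) r y hj
    exact (hpast e' he' j).vote r y hb
  have hdone {y : V} (hq : 0 < count t.doneFrom y) : y = a := by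
    obtain ⟨j, hj⟩ := exists_of_count_pos hq
    obtain ⟨e', he', hb⟩ := hT.done j (hmem j) y hj
    exact (hpast e' he' j).done y hb
  have hupd {r : Round} {y : V} (hy : y = a) :
      ∀ r' z, Function.update p.sentVote r (some y) r' = some z → z = a := by
    intro r' z hz
    by_cases hr : r' = r
    · subst hr
      rw [Function.update_self, Option.some.injEq] at hz
      exact hz.symm.trans hy
    · rw [Function.update_of_ne hr] at hz
      exact h.vote r' z hz
  cases hs with
  | enter => exact { h with suggest := by simp, propose := by simp, vote := by simp }
  | suggest =>
    refine { h with suggest := ?_ }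
    simp only [Option.some.injEq]
    rintro g rfl
    exact h.key3
  | propose j g _ _ _ hg =>
    refine { h with propose := ?_ }
    simp only [Option.some.injEq, Prod.mk.injEq]
    rintro k y ⟨rfl, rfl⟩
    obtain ⟨e', he', -, hb⟩ := hT.suggest j (hmem j) g hg
    exact (hpast e' he' j).suggest g hb
  | echo key y _ hp _ =>
    have hnpos : 0 < n := by omega
    obtain ⟨e', he', -, hb⟩ := hT.propose key y hp ⟨p.view % n, Nat.mod_lt _ hnpos⟩ (hmem _) rfl
    exact { h with vote := hupd ((hpast e' he' _).propose key y hb) }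
  | key1 y _ hq => exact { h with vote := hupd (hvote hq) }
  | key2 y _ hq => exact { h with vote := hupd (hvote hq) }
  | key3 y _ hq => exact { h with vote := hupd (hvote hq), key3 := hvote hq }
  | lock y _ hq => exact { h with vote := hupd (hvote hq) }
  | done y _ hq =>
    refine { h with done := ?_ }
    simp only [Option.some.injEq]
    rintro z rfl
    exact hq.elim hvote fun hq => hdone (by omega)
  | decide y _ hq =>
    refine { h with decided := ?_ }
    simp only [Option.some.injEq]
    rintro z rfl
    exact hdone (by omega)
  | abort u hu => exact { h with }

theorem IsRun.only {f : ℕ} {Δ : ℝ} {x : Fin n → V} {E : Execution n V} (h : IsRun f Δ x E)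
    (hf : 3 * f < n) (hE : E.faulty = ∅) {a : V} (hx : ∀ i, x i = a) (e : ℕ) :
    ∀ i, (E.state e i).pers.Only a := by
  induction e using Nat.strong_induction_on with
  | _ e ih =>
    intro i
    have hi : i ∉ E.faulty := by simp [hE]
    have hff : f + 1 ≤ n - f := by omega
    cases e with
    | zero =>
      rw [h.state_zero hi, enterView_eq]
      have hfresh : (freshState Δ (E.clock i (E.time 0)) 1
          (initState (n := n) (x i))).pers.Only a := by
        constructor <;> simp [freshState, initState, hx]
      refine PSteps.induct (P := Persistent.Only a) (f := f) (i := i) (fired := False)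
        (trySuggest_steps (Transient.empty) (freshState Δ (E.clock i (E.time 0)) 1
          (initState (n := n) (x i)))) hfresh fun p p' _ _ _ hs hp => ?_
      refine hp.step (e := 0) (by omega) hE ?_ (by simp) hs
      constructor <;> simp [Transient.empty]
    | succ e =>
      refine PSteps.induct (P := Persistent.Only a) (h.steps hff hi e)
        (ih e (Nat.lt_succ_self e) i) fun p p' hv hv' _ hs hp => ?_
      refine hp.step (by omega) hE ?_ ih hs
      exact h.tranSound_succ hff hi (h.tranSound hff hi e) hv (hs.view_le.trans hv')

/-! ## Announcements -/

namespace IsRun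

variable {f : ℕ} {Δ : ℝ} {x : Fin n → V} {E : Execution n V}

theorem view_zero (h : IsRun f Δ x E) {i : Fin n} (hi : i ∉ E.faulty) :
    (E.state 0 i).pers.view = 1 := by
  rw [h.state_zero hi]; simp

theorem tran_zero (h : IsRun f Δ x E) {i : Fin n} (hi : i ∉ E.faulty) :
    (E.state 0 i).tran =
      { (Transient.empty : Transient n V) with
        deadline := some (E.clock i (E.time 0) + 11 * Δ) } := by
  rw [h.state_zero hi, enterView_tran]; rfl

theorem lastAbort_zero (h : IsRun f Δ x E) {i : Fin n} (hi : i ∉ E.faulty) :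
    (E.state 0 i).pers.lastAbort = 0 := by
  rw [h.state_zero hi, enterView_lastAbort]; rfl

theorem doneSent_zero (h : IsRun f Δ x E) {i : Fin n} (hi : i ∉ E.faulty) :
    (E.state 0 i).pers.doneSent = none := by
  rw [h.state_zero hi, enterView_eq]
  simp only [Eff.andThen, trySuggest_doneSent]
  rfl

theorem decided_zero (h : IsRun f Δ x E) {i : Fin n} (hi : i ∉ E.faulty) :
    (E.state 0 i).pers.decided = none := by
  rw [h.state_zero hi, enterView_eq]
  simp only [Eff.andThen]
  rw [trySuggest_pers]
  rfl

theorem sentProof_zero (h : IsRun f Δ x E) {i : Fin n} (hi : i ∉ E.faulty) :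
    (E.state 0 i).pers.sentProof ≠ none := by
  rw [h.state_zero hi, enterView_eq]
  simp only [Eff.andThen]
  rw [trySuggest_pers]
  simp [freshState]

theorem sentProof_ne_none (h : IsRun f Δ x E) (hf : f + 1 ≤ n - f) {i : Fin n} (hi : i ∉ E.faulty)
    (e : ℕ) : (E.state e i).pers.sentProof ≠ none := by
  induction e with
  | zero => exact h.sentProof_zero hi
  | succ e ih =>
    refine PSteps.induct (P := fun p => p.sentProof ≠ none) (h.steps hf hi e) ih
      fun p p' _ _ _ hs hp => ?_
    cases hs with
    | enter => simp
    | _ => exact hp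

/-- A party thus never falls silent by terminating: its `done` has been announced, and it repeats it
to recovering parties. -/
theorem doneSent_ne_none_of_decided (h : IsRun f Δ x E) (hf : f + 1 ≤ n - f) {i : Fin n}
    (hi : i ∉ E.faulty) (e : ℕ) :
    (E.state e i).pers.decided ≠ none → (E.state e i).pers.doneSent ≠ none := by
  induction e with
  | zero => simp [h.decided_zero hi]
  | succ e ih =>
    refine PSteps.induct (P := fun p => p.decided ≠ none → p.doneSent ≠ none) (h.steps hf hi e) ih
      fun p p' _ _ _ hs hp => ?_
    cases hs with
    | decide _ _ _ hd => exact fun _ => hd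
    | done => simp
    | _ => exact hp

/-- Entries for others stem from received messages, bounded by a sender's `lastAbort`, which never
decreases even in reboots; the own entry is raised together with `lastAbort`. -/
theorem highestAbort_le_lastAbort (h : IsRun f Δ x E) (hf : f + 1 ≤ n - f) {i j : Fin n}
    (hi : i ∉ E.faulty) (hj : j ∉ E.faulty) (e : ℕ) :
    (E.state e i).tran.highestAbort j ≤ (E.state e j).pers.lastAbort := by
  induction e with
  | zero => simp [h.tran_zero hi, Transient.empty]
  | succ e ih =>
    have hm := h.lastAbort_mono hf hj (Nat.le_succ e)
    rcases (h.tStep hi e).highestAbort_le j with h1 | h1 | ⟨rfl, h1⟩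
    · exact h1.trans (ih.trans hm)
    · obtain ⟨e', he', hb⟩ := h.shown_of_deliver hf hj h1
      exact le_trans hb (h.lastAbort_mono hf hj he'.le)
    · exact h1

theorem highestRequest_le_view (h : IsRun f Δ x E) (hf : f + 1 ≤ n - f) {i j : Fin n}
    (hi : i ∉ E.faulty) (hj : j ∉ E.faulty) (e : ℕ) :
    (E.state e i).tran.highestRequest j ≤ (E.state e j).pers.view := by
  induction e with
  | zero => simp [h.tran_zero hi, Transient.empty]
  | succ e ih =>
    rcases (h.tStep hi e).highestRequest_le j with h1 | h1
    · exact h1.trans (ih.trans (h.view_mono hf hj (Nat.le_succ e)))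
    · obtain ⟨e', he', hb⟩ := h.shown_of_deliver hf hj h1
      exact hb.le.trans (h.view_mono hf hj he'.le)

theorem exists_sends_done (h : IsRun f Δ x E) (hf : f + 1 ≤ n - f) {i : Fin n}
    (hi : i ∉ E.faulty) {y : V} (j : Fin n) (e : ℕ) (hy : (E.state e i).pers.doneSent = some y) :
    ∃ e' ≤ e, (j, .done y) ∈ E.sends e' i := by
  induction e with
  | zero => simp [h.doneSent_zero hi] at hy
  | succ e ih =>
    rcases (h.sendSpec hf hi e).announces.done y hy with h1 | h1
    · obtain ⟨e', he', hm⟩ := ih h1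
      exact ⟨e', he'.trans (Nat.le_succ e), hm⟩
    · exact ⟨e + 1, le_rfl, h1 j⟩

theorem exists_sends_abort (h : IsRun f Δ x E) (hf : f + 1 ≤ n - f) {i : Fin n}
    (hi : i ∉ E.faulty) (j : Fin n) (e : ℕ) (ha : 0 < (E.state e i).pers.lastAbort) :
    ∃ e' ≤ e, (j, .abort (E.state e i).pers.lastAbort) ∈ E.sends e' i := by
  induction e with
  | zero => simp [h.lastAbort_zero hi] at ha
  | succ e ih =>
    rcases (h.sendSpec hf hi e).announces.abort with h1 | h1
    · simp only at h1
      rw [h1] at ha ⊢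
      obtain ⟨e', he', hm⟩ := ih ha
      exact ⟨e', he'.trans (Nat.le_succ e), hm⟩
    · exact ⟨e + 1, le_rfl, h1 j⟩

/-- What a party that has joined the view is to get has been sent while it had joined. -/
theorem exists_sends_of_mem_currentMsgs (h : IsRun f Δ x E) (hf : f + 1 ≤ n - f) {i : Fin n}
    (hi : i ∉ E.faulty) {j : Fin n} {m : Msg V} (e : ℕ)
    (hj : (E.state e i).tran.highestRequest j = (E.state e i).pers.view)
    (hm : m ∈ currentMsgs (E.state e i).pers j) :
    ∃ e' ≤ e, (j, m) ∈ E.sends e' i ∧ (E.state e' i).pers.view = (E.state e i).pers.view ∧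
      (E.state e' i).tran.highestRequest j = (E.state e' i).pers.view := by
  induction e with
  | zero =>
    rw [h.view_zero hi, h.tran_zero hi] at hj
    simp [Transient.empty] at hj
  | succ e ih =>
    rcases (h.sendSpec hf hi e).covers j m hj hm with ⟨h1, h2, h3⟩ | h1
    · obtain ⟨e', he', h4, h5, h6⟩ := ih h2 h3
      exact ⟨e', he'.trans (Nat.le_succ e), h4, h5.trans h1.symm, h6⟩
    · exact ⟨e + 1, le_rfl, h1, rfl, hj⟩

theorem exists_sends_request (h : IsRun f Δ x E) (hf : f + 1 ≤ n - f) {i : Fin n}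
    (hi : i ∉ E.faulty) (e : ℕ) :
    ∃ e' ≤ e, (E.state e' i).pers.view = (E.state e i).pers.view ∧
      ∀ j, (j, .request (E.state e i).pers.view) ∈ E.sends e' i := by
  induction e with
  | zero =>
    refine ⟨0, le_rfl, rfl, fun j => ?_⟩
    rw [h.view_zero hi, h.sends_zero hi]
    exact mem_enterView_request j
  | succ e ih =>
    by_cases hv : (E.state (e + 1) i).pers.view = (E.state e i).pers.view
    · obtain ⟨e', he', h1, h2⟩ := ih
      rw [hv]
      exact ⟨e', he'.trans (Nat.le_succ e), h1, h2⟩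
    · exact ⟨e + 1, le_rfl, rfl, fun j => (h.sendSpec hf hi e).request hv j⟩

theorem sends_of_reboot (h : IsRun f Δ x E) {i : Fin n} (hi : i ∉ E.faulty) {e : ℕ}
    (ha : E.act (e + 1) = .reboot i) (hd : (E.state e i).pers.decided = none) (j : Fin n) :
    (j, .recover (E.state e i).pers.view) ∈ E.sends (e + 1) i := by
  rw [h.sends_succ hi, ha]
  simp [perform, onReboot, hd, mem_toAll]

theorem decided_eq_none (h : IsRun f Δ x E) (hf : f + 1 ≤ n - f) {i : Fin n} (hi : i ∉ E.faulty)
    {k l : ℕ} (hkl : k ≤ l) (hd : (E.state l i).pers.decided = none) :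
    (E.state k i).pers.decided = none := by
  by_contra hne
  obtain ⟨y, hy⟩ := Option.ne_none_iff_exists'.1 hne
  rw [h.decided_mono hf hi hkl hy] at hd
  cases hd

theorem exists_succ_of_deliver (h : IsRun f Δ x E) {i j : Fin n} {m : Msg V} {l : ℕ}
    (ha : E.act l = .deliver i j m) : ∃ l', l = l' + 1 := by
  refine Nat.exists_eq_succ_of_ne_zero fun hl => ?_
  rw [hl, h.act_zero] at ha
  cases ha

end IsRun

/-! ## The timing of events -/

/-- The last event up to time `t`. -/
def Execution.last (E : Execution n V) (t : ℝ) : ℕ := sInf {N | t < E.time (N + 1)}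

/-- The infimum is attained because the times are unbounded, and for t ≥ 0 event 0 is not later than
t. -/
theorem IsRun.le_last_iff {f : ℕ} {Δ : ℝ} {x : Fin n → V} {E : Execution n V}
    (h : IsRun f Δ x E) {t : ℝ} (ht : 0 ≤ t) {l : ℕ} : l ≤ E.last t ↔ E.time l ≤ t := by
  have hne : {N | t < E.time (N + 1)}.Nonempty := by
    obtain ⟨k, hk⟩ := h.time_unbounded t
    exact ⟨k, hk.trans_le (h.time_mono (Nat.le_succ k))⟩
  have hlast : t < E.time (E.last t + 1) := Nat.sInf_mem hne
  constructor
  · intro hl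
    by_contra! hc
    cases l with
    | zero => rw [h.time_zero] at hc; linarith
    | succ l =>
      have : E.last t ≤ l := Nat.sInf_le (s := {N | t < E.time (N + 1)}) hc
      omega
  · intro hl
    by_contra! hc
    have := h.time_mono (show E.last t + 1 ≤ l by omega)
    linarith

/-- View `v` has a nonfaulty primary and starts with event `k`, after `gst`; messages arrive within
`δ`; recoveries are complete when the view starts. -/
structure IsPromptView (f : ℕ) (Δ : ℝ) (x : Fin n → V) (E : Execution n V) (δ : ℝ) (v k : ℕ) :
    Prop where
  run : IsRun f Δ x E
  resilient : 3 * f < n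
  pos : 0 < δ
  lt : δ < Δ
  delivers : E.DeliversWithin δ
  view_pos : 0 < v
  starts : E.StartsAt v k
  gst_le : E.gst ≤ E.time k
  reboot : ∀ l, ∀ i ∉ E.faulty, E.act l = .reboot i → E.time l ≤ E.time k + 12 * δ →
    max (E.time l) E.gst + 2 * δ ≤ E.time k

/-- The last event in the first `m` periods of length `δ` after event `k`. -/
def Execution.stage (E : Execution n V) (δ : ℝ) (k m : ℕ) : ℕ := E.last (E.time k + m * δ)

namespace IsPromptView

variable {f : ℕ} {Δ : ℝ} {x : Fin n → V} {E : Execution n V} {δ : ℝ} {v k : ℕ}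

theorem succ_le (G : IsPromptView f Δ x E δ v k) : f + 1 ≤ n - f := by
  have := G.resilient
  omega

theorem le_stage_iff (G : IsPromptView f Δ x E δ v k) {l m : ℕ} :
    l ≤ E.stage δ k m ↔ E.time l ≤ E.time k + m * δ := by
  refine G.run.le_last_iff ?_
  have h1 := G.run.gst_nonneg.trans G.gst_le
  have h2 := mul_nonneg (Nat.cast_nonneg' (α := ℝ) m) G.pos.le
  linarith

theorem time_stage_le (G : IsPromptView f Δ x E δ v k) (m : ℕ) :
    E.time (E.stage δ k m) ≤ E.time k + m * δ := G.le_stage_iff.1 le_rfl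

theorem stage_mono (G : IsPromptView f Δ x E δ v k) {m m' : ℕ} (h : m ≤ m') :
    E.stage δ k m ≤ E.stage δ k m' := by
  have h1 := G.time_stage_le m
  have h2 := mul_le_mul_of_nonneg_right (Nat.cast_le (α := ℝ).2 h) G.pos.le
  rw [G.le_stage_iff]
  linarith

theorem le_stage (G : IsPromptView f Δ x E δ v k) (m : ℕ) : k ≤ E.stage δ k m := by
  have h2 := mul_nonneg (Nat.cast_nonneg' (α := ℝ) m) G.pos.le
  rw [G.le_stage_iff]
  linarith

/-- A reboot at a time s in this range would satisfy s + 2δ ≤ T, although s ≥ T. -/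
theorem not_reboot (G : IsPromptView f Δ x E δ v k) {i : Fin n} (hi : i ∉ E.faulty) {l : ℕ}
    (hl : k ≤ l) (hl' : l ≤ E.stage δ k 12) : E.act l ≠ .reboot i := by
  intro ha
  have h1 := G.reboot l i hi ha (by simpa using G.le_stage_iff.1 hl')
  have h2 := G.run.time_mono hl
  have h3 := le_max_left (E.time l) E.gst
  have := G.pos
  linarith

theorem le_of_view (G : IsPromptView f Δ x E δ v k) {i : Fin n} (hi : i ∉ E.faulty) {l : ℕ}
    (hl : v ≤ (E.state l i).pers.view) : k ≤ l := by
  by_contra! hc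
  have := G.starts.2 l hc i hi
  omega

theorem clock_eq (G : IsPromptView f Δ x E δ v k) {i : Fin n} (hi : i ∉ E.faulty) {l : ℕ}
    (hl : k ≤ l) : E.clock i (E.time l) = E.time l :=
  G.run.clock_sync i hi _ (G.gst_le.trans (G.run.time_mono hl))

/-- As `gst` is not after the start of the view, even messages sent before `gst` obey the count in
periods. -/
theorem exists_arrival (G : IsPromptView f Δ x E δ v k) {i j : Fin n} (hi : i ∉ E.faulty)
    (hj : j ∉ E.faulty) {m : Msg V} {e c : ℕ} (hm : (j, m) ∈ E.sends e i)
    (he : e ≤ E.stage δ k c) :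
    ∃ l, e < l ∧ l ≤ E.stage δ k (c + 1) ∧ E.act l = .deliver i j m := by
  obtain ⟨l, hl, ha, ht⟩ := G.delivers e i hi j hj m hm
  refine ⟨l, hl, ?_, ha⟩
  have h1 := G.le_stage_iff.1 he
  have h2 := mul_nonneg (Nat.cast_nonneg' (α := ℝ) c) G.pos.le
  have h3 : max (E.time e) E.gst ≤ E.time k + c * δ := max_le h1 (by linarith [G.gst_le])
  rw [G.le_stage_iff]
  push_cast
  linarith

/-- The party with state `s` has not left view `v`, and its timer does not expire before time `t`. -/
structure Quiet (E : Execution n V) (v : ℕ) (t : ℝ) (s : State n V) : Prop where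
  view : s.pers.view ≤ v
  lastAbort : s.pers.lastAbort < v
  highestAbort : ∀ j ∉ E.faulty, s.tran.highestAbort j < v
  deadline : ∀ d, s.tran.deadline = some d → s.pers.view = v → t ≤ d

/-- Until the timers of view `v` expire, no nonfaulty party leaves the view. -/
theorem quiet (G : IsPromptView f Δ x E δ v k) (e : ℕ) (he : E.time e < E.time k + 11 * Δ) :
    ∀ i ∉ E.faulty, Quiet E v (E.time k + 11 * Δ) (E.state e i) := by
  induction e with
  | zero =>
    intro i hi
    have hv := G.run.view_zero hi
    have hpos := G.view_pos
    refine ⟨by omega, by rw [G.run.lastAbort_zero hi]; exact hpos, fun j _ => ?_, ?_⟩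
    · rw [G.run.tran_zero hi]; exact hpos
    · intro d hd hvd
      -- If a party begins in view v, the view starts with event 0, so its first deadline is 11Δ
      -- after the start.
      have hk : k = 0 := by simpa using G.le_of_view hi hvd.ge
      subst hk
      rw [G.run.tran_zero hi, G.clock_eq hi le_rfl] at hd
      simp only [Option.some.injEq] at hd
      exact hd.le
  | succ e ih =>
    intro i hi
    have hff := G.succ_le
    have ih' := ih ((G.run.time_mono (Nat.le_succ e)).trans_lt he)
    have ihi := ih' i hi
    have ht := G.run.tStep hi e
    have hF := G.run.card_faulty
    have habort : ∀ j ∉ E.faulty, j ≠ i → (E.state (e + 1) i).tran.highestAbort j < v := by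
      intro j hj hji
      rcases ht.highestAbort_le j with h1 | h1 | ⟨rfl, h1⟩
      · exact h1.trans_lt (ihi.highestAbort j hj)
      · obtain ⟨e', he', hb⟩ := G.run.shown_of_deliver hff hj h1
        exact (le_trans hb (G.run.lastAbort_mono hff hj (Nat.lt_succ_iff.1 he'))).trans_lt
          (ih' j hj).lastAbort
      · exact absurd rfl hji
    have hlast : (E.state (e + 1) i).pers.lastAbort < v := by
      refine PSteps.induct (P := fun p => p.lastAbort < v) (G.run.steps hff hi e) ihi.lastAbort
        fun p p' hpv hpv' _ hs hp => ?_
      cases hs with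
      | abort u hu =>
        refine max_lt hp ?_
        -- A timer either belongs to a view below v or is the timer of v, which is not due yet;
        -- amplification needs another nonfaulty party that announced an abort for the view in
        -- question.
        rcases hu with ⟨⟨ha, d, hd, hle⟩, rfl⟩ | hu
        · have hview : (E.state (e + 1) i).pers.view = (E.state e i).pers.view := by
            by_contra hne
            obtain ⟨j, w, h1⟩ := ht.exists_abort hne
            rw [ha] at h1
            cases h1
          simp only at hpv'
          rcases ihi.view.lt_or_eq with h1 | h1
          · omega
          · have h2 := ihi.deadline d hd h1
            have h3 := G.le_of_view hi h1.ge
            rw [G.clock_eq hi (h3.trans (Nat.le_succ e))] at hle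
            linarith
        · obtain ⟨j, hj, hjf⟩ := exists_notMem_of_card_lt
            (lt_of_lt_of_le (Nat.lt_succ_of_le hF) hu)
          obtain ⟨h1, h2⟩ := (Finset.mem_filter.1 hj).2
          exact h2.trans_lt (habort j hjf h1)
      | _ => exact hp
    have habort' : ∀ j ∉ E.faulty, (E.state (e + 1) i).tran.highestAbort j < v := by
      intro j hj
      by_cases hji : j = i
      · subst hji
        exact (G.run.highestAbort_le_lastAbort hff hj hj (e + 1)).trans_lt hlast
      · exact habort j hj hji
    refine ⟨?_, hlast, habort', ?_⟩
    · by_contra! hc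
      have hne : (E.state (e + 1) i).pers.view ≠ (E.state e i).pers.view := by
        have := ihi.view
        omega
      generalize E.act (e + 1) = a at ht
      cases ht with
      -- Leaving view v takes n - f entries that are at least v, one of them of a nonfaulty party.
      | enter j w h1 h2 h3 h4 h5 =>
        have h6 : v ≤ kthLargest (n - f) (E.state (e + 1) i).tran.highestAbort := by
          rw [h3]
          simp only
          omega
        rw [le_kthLargest_iff G.view_pos (by omega)] at h6
        obtain ⟨l, hl, hlf⟩ := exists_notMem_of_card_lt (F := E.faulty)
          (lt_of_lt_of_le (by omega) h6)
        have h7 := habort' l hlf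
        have h8 := (Finset.mem_filter.1 hl).2
        omega
      | reboot d hd ht hp => exact hne (by rw [hp])
      | _ => exact hne ‹_›
    · intro d hd hvd
      rcases ht.deadline_eq hd with ⟨h1, h2⟩ | h1
      · exact ihi.deadline d h2 (h1.symm.trans hvd)
      · have h2 := G.le_of_view hi hvd.ge
        rw [G.clock_eq hi h2] at h1
        have := G.run.time_mono h2
        linarith

theorem quiet_stage (G : IsPromptView f Δ x E δ v k) {e : ℕ} (he : e ≤ E.stage δ k 11) {i : Fin n}
    (hi : i ∉ E.faulty) : Quiet E v (E.time k + 11 * Δ) (E.state e i) := by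
  refine G.quiet e ?_ i hi
  have h1 := G.le_stage_iff.1 he
  have h2 := G.lt
  push_cast at h1
  linarith

/-- Messages that a party announces reach all parties, which remember them: a recovering party gets
them again. -/
theorem exists_relay (G : IsPromptView f Δ x E δ v k) {i j : Fin n} (hi : i ∉ E.faulty)
    (hj : j ∉ E.faulty) {c : ℕ} (hc : c < 12)
    (hd : (E.state (E.stage δ k (c + 1)) j).pers.decided = none) {Q : Msg V → Prop} {e : ℕ}
    (he : e ≤ E.stage δ k c) (h1 : ∃ m, Q m ∧ (j, m) ∈ E.sends e i)
    (h2 : ∀ l u, e < l → E.act l = .deliver j i (.recover u) → ∃ m, Q m ∧ (j, m) ∈ E.sends l i) :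
    ∃ l m, Q m ∧ E.act l = .deliver i j m ∧ l ≤ E.stage δ k (c + 1) ∧
      ∀ b, l < b → b ≤ E.stage δ k (c + 1) → E.act b ≠ .reboot j := by
  obtain ⟨m, hm, hs⟩ := h1
  obtain ⟨l, hel, hl, ha⟩ := G.exists_arrival hi hj hs he
  by_cases hr : ∀ b, l < b → b ≤ E.stage δ k (c + 1) → E.act b ≠ .reboot j
  · exact ⟨l, m, hm, ha, hl, hr⟩
  push Not at hr
  obtain ⟨b₀, hb₀, hb₀', hab₀⟩ := hr
  let S := (Finset.range (E.stage δ k (c + 1) + 1)).filter fun b => l < b ∧ E.act b = .reboot j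
  have hS : S.Nonempty :=
    ⟨b₀, Finset.mem_filter.2 ⟨Finset.mem_range.2 (Nat.lt_succ_of_le hb₀'), hb₀, hab₀⟩⟩
  -- After its last reboot b the receiver asks again; question and answer take 2δ and are over when
  -- the view starts, and by maximality of b no reboot erases the answer.
  obtain ⟨b, hb, hmax⟩ := Finset.exists_max_image S id hS
  obtain ⟨hbr, hlb, hab⟩ := Finset.mem_filter.1 hb
  have hbs : b ≤ E.stage δ k (c + 1) := Nat.lt_succ_iff.1 (Finset.mem_range.1 hbr)
  obtain ⟨b, rfl⟩ : ∃ b', b = b' + 1 := ⟨b - 1, by omega⟩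
  have hbd := G.run.decided_eq_none G.succ_le hj ((Nat.le_succ b).trans hbs) hd
  have htime := G.reboot (b + 1) j hj hab (by
    have := G.le_stage_iff.1 (hbs.trans (G.stage_mono (show c + 1 ≤ 12 by omega)))
    simpa using this)
  obtain ⟨l₁, hl₁, hal₁, ht₁⟩ := G.delivers _ j hj i hi _ (G.run.sends_of_reboot hj hab hbd i)
  obtain ⟨m', hm', hs'⟩ := h2 l₁ _ (by omega) hal₁
  obtain ⟨l₂, hl₂, hal₂, ht₂⟩ := G.delivers _ i hi j hj _ hs'
  have hpos := G.pos
  have h3 : max (E.time l₁) E.gst ≤ max (E.time (b + 1)) E.gst + δ :=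
    max_le ht₁ (by linarith [le_max_right (E.time (b + 1)) E.gst])
  refine ⟨l₂, m', hm', hal₂, ?_, fun b' hb' hb'' hab' => ?_⟩
  · rw [G.le_stage_iff]
    have := mul_nonneg (Nat.cast_nonneg' (α := ℝ) (c + 1)) hpos.le
    linarith
  · have := hmax b' (Finset.mem_filter.2
      ⟨Finset.mem_range.2 (Nat.lt_succ_of_le hb''), by omega, hab'⟩)
    simp only [id] at this
    omega

/-- The message may have been sent long before the view, and the receiver may have rebooted since;
hence the detour through `exists_relay`. -/
theorem doneFrom_ne_none (G : IsPromptView f Δ x E δ v k) {i j : Fin n} (hi : i ∉ E.faulty)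
    (hj : j ∉ E.faulty) {c : ℕ} (hc : c < 12)
    (hd : (E.state (E.stage δ k (c + 1)) j).pers.decided = none)
    (hs : (E.state (E.stage δ k c) i).pers.doneSent ≠ none) :
    (E.state (E.stage δ k (c + 1)) j).tran.doneFrom i ≠ none := by
  obtain ⟨y, hy⟩ := Option.ne_none_iff_exists'.1 hs
  have hff := G.succ_le
  obtain ⟨e, he, hm⟩ := G.run.exists_sends_done hff hi j _ hy
  obtain ⟨l, m, rfl, ha, hl, hr⟩ := G.exists_relay hi hj hc hd (Q := fun m => m = .done y) he
    ⟨_, rfl, hm⟩ fun l u hel hau => by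
      obtain ⟨l, rfl⟩ : ∃ l', l = l' + 1 := ⟨l - 1, by omega⟩
      exact ⟨_, rfl, ((G.run.sendSpec hff hi l).reply j u hau).1 y
        (G.run.doneSent_mono hff hi (Nat.lt_succ_iff.1 hel) (G.run.backs hff hi hm))⟩
  obtain ⟨l, rfl⟩ := G.run.exists_succ_of_deliver ha
  have hdl := G.run.decided_eq_none hff hj ((Nat.le_succ l).trans hl) hd
  have h1 : (E.state (l + 1) j).tran.doneFrom i ≠ none := by
    rw [G.run.state_succ hj, ha]
    exact perform_done hdl
  refine Nat.le_induction (P := fun b _ => b ≤ E.stage δ k (c + 1) →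
    (E.state b j).tran.doneFrom i ≠ none) (fun _ => h1) (fun b hb ih hb' => ?_) _ hl le_rfl
  exact (G.run.tStep hj b).doneFrom_mono (hr _ (by omega) hb') (ih (by omega))

theorem le_highestAbort (G : IsPromptView f Δ x E δ v k) {i j : Fin n} (hi : i ∉ E.faulty)
    (hj : j ∉ E.faulty) {c : ℕ} (hc : c < 12)
    (hd : (E.state (E.stage δ k (c + 1)) j).pers.decided = none) {a : ℕ}
    (hs : a ≤ (E.state (E.stage δ k c) i).pers.lastAbort) :
    a ≤ (E.state (E.stage δ k (c + 1)) j).tran.highestAbort i := by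
  rcases Nat.eq_zero_or_pos a with rfl | hpos
  · exact Nat.zero_le _
  have hff := G.succ_le
  obtain ⟨e, he, hm⟩ := G.run.exists_sends_abort hff hi j _ (hpos.trans_le hs)
  obtain ⟨l, m, ⟨u, hu, rfl⟩, ha, hl, hr⟩ := G.exists_relay hi hj hc hd
    -- A reply carries the highest abort, which may have grown; any view that is at least a serves.
    (Q := fun m => ∃ u, a ≤ u ∧ m = .abort u) he ⟨_, ⟨_, hs, rfl⟩, hm⟩ fun l u hel hau => by
      obtain ⟨l, rfl⟩ : ∃ l', l = l' + 1 := ⟨l - 1, by omega⟩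
      have h1 : a ≤ (E.state l i).pers.lastAbort := (hs.trans (G.run.backs hff hi hm)).trans
        (G.run.lastAbort_mono hff hi (Nat.lt_succ_iff.1 hel))
      exact ⟨_, ⟨_, h1, rfl⟩, ((G.run.sendSpec hff hi l).reply j u hau).2 (by omega)⟩
  obtain ⟨l, rfl⟩ := G.run.exists_succ_of_deliver ha
  have hdl := G.run.decided_eq_none hff hj ((Nat.le_succ l).trans hl) hd
  have h1 : a ≤ (E.state (l + 1) j).tran.highestAbort i := by
    rw [G.run.state_succ hj, ha]
    exact hu.trans (perform_abort hdl)
  refine Nat.le_induction (P := fun b _ => b ≤ E.stage δ k (c + 1) →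
    a ≤ (E.state b j).tran.highestAbort i) (fun _ => h1) (fun b hb ih hb' => ?_) _ hl le_rfl
  exact (ih (by omega)).trans ((G.run.tStep hj b).highestAbort_mono (hr _ (by omega) hb') i)

/-! ### Termination after the first `done` messages -/

theorem exists_nonfaulty (G : IsPromptView f Δ x E δ v k) : ∃ i, i ∉ E.faulty := by
  have h1 := sub_le_card_compl (n := n) G.run.card_faulty
  have h2 := G.resilient
  obtain ⟨i, hi⟩ := Finset.card_pos.1 (show 0 < (Finset.univ \ E.faulty).card by omega)
  exact ⟨i, (Finset.mem_sdiff.1 hi).2⟩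

/-- All `done` messages of nonfaulty parties are the same. -/
theorem exists_doneFrom_eq (G : IsPromptView f Δ x E δ v k) :
    ∃ y, ∀ i ∉ E.faulty, ∀ j ∉ E.faulty, ∀ e, (E.state e i).tran.doneFrom j ≠ none →
      (E.state e i).tran.doneFrom j = some y := by
  by_cases hex : ∃ y, ∃ j ∉ E.faulty, ∃ e, (E.state e j).pers.doneSent = some y
  · obtain ⟨y, j, hj, e, hy⟩ := hex
    refine ⟨y, fun i hi l hl e' he' => ?_⟩
    obtain ⟨z, hz⟩ := Option.ne_none_iff_exists'.1 he'
    obtain ⟨e'', -, hb⟩ := (G.run.tranSound G.succ_le hi e').done l hl z hz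
    rw [hz, G.run.done_unique G.resilient hl hj hb hy]
  · obtain ⟨j, hj⟩ := G.exists_nonfaulty
    -- If no nonfaulty party ever sends `done`, the claim is vacuous and any value will do.
    refine ⟨x j, fun i hi l hl e' he' => ?_⟩
    obtain ⟨z, hz⟩ := Option.ne_none_iff_exists'.1 he'
    obtain ⟨e'', -, hb⟩ := (G.run.tranSound G.succ_le hi e').done l hl z hz
    exact absurd ⟨z, l, hl, e'', hb⟩ hex

theorem doneSent_succ (G : IsPromptView f Δ x E δ v k) {c : ℕ} (hc : c < 12)
    (hs : f + 1 ≤ (Finset.univ.filter fun j => j ∉ E.faulty ∧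
      (E.state (E.stage δ k c) j).pers.doneSent ≠ none).card) {i : Fin n} (hi : i ∉ E.faulty) :
    (E.state (E.stage δ k (c + 1)) i).pers.doneSent ≠ none := by
  by_cases hd : (E.state (E.stage δ k (c + 1)) i).pers.decided = none
  · obtain ⟨y, hy⟩ := G.exists_doneFrom_eq
    refine (G.run.settled G.succ_le hi _).done y (hs.trans (Finset.card_le_card fun j hj => ?_))
    simp only [Finset.mem_filter, Finset.mem_univ, true_and] at hj ⊢
    exact hy i hi j hj.1 _ (G.doneFrom_ne_none hj.1 hi hc hd hj.2)
  · exact G.run.doneSent_ne_none_of_decided G.succ_le hi _ hd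

theorem decided_succ (G : IsPromptView f Δ x E δ v k) {c : ℕ} (hc : c < 12)
    (hs : ∀ j ∉ E.faulty, (E.state (E.stage δ k c) j).pers.doneSent ≠ none) {i : Fin n}
    (hi : i ∉ E.faulty) : (E.state (E.stage δ k (c + 1)) i).pers.decided ≠ none := by
  intro hd
  obtain ⟨y, hy⟩ := G.exists_doneFrom_eq
  refine (G.run.settled G.succ_le hi _).decide y
    ((sub_le_card_compl G.run.card_faulty).trans (Finset.card_le_card fun j hj => ?_)) hd
  simp only [Finset.mem_filter, Finset.mem_univ, true_and, Finset.mem_sdiff] at hj ⊢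
  exact hy i hi j hj _ (G.doneFrom_ne_none hj hi hc hd (hs j hj))

theorem decided_of_doneSent (G : IsPromptView f Δ x E δ v k)
    (hs : f + 1 ≤ (Finset.univ.filter fun j => j ∉ E.faulty ∧
      (E.state (E.stage δ k 10) j).pers.doneSent ≠ none).card) {i : Fin n} (hi : i ∉ E.faulty) :
    (E.state (E.stage δ k 12) i).pers.decided ≠ none :=
  G.decided_succ (by omega) (fun _ hj => G.doneSent_succ (by omega) hs hj) hi

end IsPromptView

/-! ## The course of a prompt view -/

namespace IsPromptView

variable {f : ℕ} {Δ : ℝ} {x : Fin n → V} {E : Execution n V} {δ : ℝ} {v k : ℕ}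

theorem decided_eq_none (G : IsPromptView f Δ x E δ v k)
    (hA : ∀ i ∉ E.faulty, (E.state (E.stage δ k 10) i).pers.decided = none) {i : Fin n}
    (hi : i ∉ E.faulty) {c : ℕ} (hc : c ≤ 10) :
    (E.state (E.stage δ k c) i).pers.decided = none :=
  G.run.decided_eq_none G.succ_le hi (G.stage_mono hc) (hA i hi)

theorem view_eq (G : IsPromptView f Δ x E δ v k) {i : Fin n} (hi : i ∉ E.faulty) {l l' : ℕ}
    (hl : v ≤ (E.state l i).pers.view) (hll : l ≤ l') (hl' : l' ≤ E.stage δ k 11) :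
    (E.state l' i).pers.view = v :=
  le_antisymm (G.quiet_stage hl' hi).view (hl.trans (G.run.view_mono G.succ_le hi hll))

/-- The first party to enter v saw n - f entries that are at least v - 1, of which f + 1 belong to
nonfaulty parties. After one period these reach everybody and are amplified; after another,
everybody sees n - f such entries. -/
theorem view_stage_two (G : IsPromptView f Δ x E δ v k)
    (hA : ∀ i ∉ E.faulty, (E.state (E.stage δ k 10) i).pers.decided = none) {i : Fin n}
    (hi : i ∉ E.faulty) : (E.state (E.stage δ k 2) i).pers.view = v := by
  have hff := G.succ_le
  have hF := G.run.card_faulty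
  have hpos := G.view_pos
  suffices h : v ≤ (E.state (E.stage δ k 2) i).pers.view from
    G.view_eq hi h le_rfl (G.stage_mono (by omega))
  by_cases hv1 : v = 1
  -- View 1 needs no aborts: all parties begin in it.
  · subst hv1
    exact G.run.view_pos hff hi _
  obtain ⟨i₀, hi₀, hv₀⟩ := G.starts.1
  obtain ⟨k', rfl⟩ : ∃ k', k = k' + 1 := by
    refine Nat.exists_eq_succ_of_ne_zero fun hk => ?_
    subst hk
    rw [G.run.view_zero hi₀] at hv₀
    omega
  have hlt := G.starts.2 k' (Nat.lt_succ_self k') i₀ hi₀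
  have h1 : v - 1 ≤ kthLargest (n - f) (E.state (k' + 1) i₀).tran.highestAbort := by
    have ht := G.run.tStep hi₀ k'
    generalize E.act (k' + 1) = a at ht
    cases ht with
    | enter j w h1 h2 h3 h4 h5 =>
      rw [h3]
      simp only
      omega
    | reboot d hd ht hp => rw [hp] at hv₀; omega
    | _ => omega
  rw [le_kthLargest_iff (by omega) (by omega)] at h1
  have h2 := succ_le_card_sdiff G.resilient hF h1
  have h3 : ∀ j ∉ E.faulty, v - 1 ≤ (E.state (E.stage δ (k' + 1) 1) j).pers.lastAbort := by
    intro j hj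
    refine le_trans ?_ (G.run.highestAbort_le_lastAbort hff hj hj _)
    refine le_trans ?_ (G.run.settled hff hj _).abort
    rw [le_kthLargest_iff (by omega) (by omega)]
    refine h2.trans (Finset.card_le_card fun l hl => ?_)
    simp only [Finset.mem_sdiff, Finset.mem_filter, Finset.mem_univ, true_and] at hl ⊢
    refine G.le_highestAbort (c := 0) hl.2 hj (by omega) (G.decided_eq_none hA hj (by omega)) ?_
    exact (hl.1.trans (G.run.highestAbort_le_lastAbort hff hi₀ hl.2 _)).trans
      (G.run.lastAbort_mono hff hl.2 (G.le_stage 0))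
  have h4 : v - 1 ≤ kthLargest (n - f) (E.state (E.stage δ (k' + 1) 2) i).tran.highestAbort := by
    rw [le_kthLargest_iff (by omega) (by omega)]
    refine (sub_le_card_compl hF).trans (Finset.card_le_card fun j hj => ?_)
    simp only [Finset.mem_sdiff, Finset.mem_filter, Finset.mem_univ, true_and] at hj ⊢
    exact G.le_highestAbort (c := 1) hj hi (by omega) (G.decided_eq_none hA hi (by omega)) (h3 j hj)
  have h5 := (G.run.settled hff hi (E.stage δ (k' + 1) 2)).view
  omega

theorem view_stage (G : IsPromptView f Δ x E δ v k)
    (hA : ∀ i ∉ E.faulty, (E.state (E.stage δ k 10) i).pers.decided = none) {i : Fin n}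
    (hi : i ∉ E.faulty) {c : ℕ} (hc : 2 ≤ c) (hc' : c ≤ 11) :
    (E.state (E.stage δ k c) i).pers.view = v :=
  G.view_eq hi (G.view_stage_two hA hi).ge (G.stage_mono hc) (G.stage_mono hc')

/-- During a prompt view, no reboot and no change of the view interferes. -/
theorem persists (G : IsPromptView f Δ x E δ v k) {i : Fin n} (hi : i ∉ E.faulty)
    {R : State n V → Prop}
    (hR : ∀ e, E.act (e + 1) ≠ .reboot i →
      (E.state (e + 1) i).pers.view = (E.state e i).pers.view →
      R (E.state e i) → R (E.state (e + 1) i)) {l l' : ℕ}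
    (hv : v ≤ (E.state l i).pers.view) (hll : l ≤ l') (hl' : l' ≤ E.stage δ k 11)
    (h : R (E.state l i)) : R (E.state l' i) := by
  have hk := G.le_of_view hi hv
  refine Nat.le_induction (P := fun b _ => b ≤ E.stage δ k 11 → R (E.state b i))
    (fun _ => h) (fun b hb ih hb' => ?_) _ hll hl'
  refine hR b (G.not_reboot hi (by omega) (hb'.trans (G.stage_mono (by omega)))) ?_
    (ih (by omega))
  rw [G.view_eq hi hv hb (by omega), G.view_eq hi hv (by omega) hb']

/-- The request sent on entering, by period 2, arrives by period 3 and is not erased; larger entries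
are impossible since no nonfaulty party has passed v. -/
theorem highestRequest_eq (G : IsPromptView f Δ x E δ v k)
    (hA : ∀ i ∉ E.faulty, (E.state (E.stage δ k 10) i).pers.decided = none) {i j : Fin n}
    (hi : i ∉ E.faulty) (hj : j ∉ E.faulty) {c : ℕ} (hc : 3 ≤ c) (hc' : c ≤ 10) :
    (E.state (E.stage δ k c) i).tran.highestRequest j = v := by
  have hff := G.succ_le
  refine le_antisymm ((G.run.highestRequest_le_view hff hi hj _).trans
    (G.quiet_stage (G.stage_mono (by omega)) hj).view) ?_
  obtain ⟨e, he, hve, hm⟩ := G.run.exists_sends_request hff hj (E.stage δ k 2)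
  rw [G.view_stage_two hA hj] at hve hm
  obtain ⟨l, hel, hl, ha⟩ := G.exists_arrival hj hi (hm i) he
  obtain ⟨l, rfl⟩ := G.run.exists_succ_of_deliver ha
  have hlc : l + 1 ≤ E.stage δ k c := hl.trans (G.stage_mono hc)
  have hdl := G.run.decided_eq_none hff hi ((Nat.le_succ l).trans hlc)
    (G.decided_eq_none hA hi hc')
  have hk := G.le_of_view hj hve.ge
  have h1 : v ≤ (E.state (l + 1) i).tran.highestRequest j := by
    rw [G.run.state_succ hi, ha]
    exact perform_request hdl
  refine Nat.le_induction (P := fun b _ => b ≤ E.stage δ k c →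
    v ≤ (E.state b i).tran.highestRequest j) (fun _ => h1) (fun b hb ih hb' => ?_) _ hlc le_rfl
  exact (ih (by omega)).trans ((G.run.tStep hi b).highestRequest_mono
    (G.not_reboot hi (by omega) (hb'.trans (G.stage_mono (by omega)))) j)

/-- From the time when all parties have joined the view, its messages arrive in the next period. -/
theorem exists_receipt (G : IsPromptView f Δ x E δ v k)
    (hA : ∀ i ∉ E.faulty, (E.state (E.stage δ k 10) i).pers.decided = none) {i j : Fin n}
    (hi : i ∉ E.faulty) (hj : j ∉ E.faulty) {c : ℕ} (hc : 3 ≤ c) (hc' : c < 10) {m : Msg V}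
    (hm : m.IsMeantFor j) (hb : (E.state (E.stage δ k c) i).pers.Backs m) :
    ∃ l, l + 1 ≤ E.stage δ k (c + 1) ∧ E.act (l + 1) = .deliver i j m ∧
      (E.state l j).pers.view = v ∧ (E.state l j).pers.decided = none := by
  have hff := G.succ_le
  have hvi := G.view_stage hA hi (show 2 ≤ c by omega) (by omega)
  obtain ⟨e, he, hs, hve, hr⟩ := G.run.exists_sends_of_mem_currentMsgs hff hi _
    ((G.highestRequest_eq hA hi hj hc hc'.le).trans hvi.symm) (mem_currentMsgs.2 ⟨hm, hb⟩)
  obtain ⟨l, hel, hl, ha⟩ := G.exists_arrival hi hj hs he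
  obtain ⟨l, rfl⟩ := G.run.exists_succ_of_deliver ha
  -- Messages go only to parties whose request for v was received, so the recipient is in view v and
  -- does not ignore them.
  have hvj := G.run.highestRequest_le_view hff hi hj e
  rw [hr, hve, hvi] at hvj
  refine ⟨l, hl, ha, ?_, ?_⟩
  · refine G.view_eq hj hvj (by omega) ?_
    have := G.stage_mono (show c + 1 ≤ 11 by omega)
    omega
  · exact G.run.decided_eq_none hff hj ((Nat.le_succ l).trans hl)
      (G.decided_eq_none hA hj (by omega))

theorem voteFrom_ne_none (G : IsPromptView f Δ x E δ v k)
    (hA : ∀ i ∉ E.faulty, (E.state (E.stage δ k 10) i).pers.decided = none) {i j : Fin n}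
    (hi : i ∉ E.faulty) (hj : j ∉ E.faulty) {c : ℕ} (hc : 3 ≤ c) (hc' : c < 10) {r : Round}
    (h : (E.state (E.stage δ k c) i).pers.sentVote r ≠ none) :
    (E.state (E.stage δ k (c + 1)) j).tran.voteFrom r i ≠ none := by
  obtain ⟨y, hy⟩ := Option.ne_none_iff_exists'.1 h
  have hvi := G.view_stage hA hi (show 2 ≤ c by omega) (by omega)
  obtain ⟨l, hl, ha, hv, hd⟩ := G.exists_receipt hA hi hj hc hc' (m := .vote r y v) trivial
    ⟨hvi.symm, hy⟩
  refine G.persists hj (R := fun s => s.tran.voteFrom r i ≠ none)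
    (fun e ha hv h => (G.run.tStep hj e).voteFrom_mono ha hv h)
    (hv.ge.trans (G.run.view_mono G.succ_le hj (Nat.le_succ l))) hl (G.stage_mono (by omega)) ?_
  rw [Nat.succ_eq_add_one, G.run.state_succ hj, ha, ← hv]
  exact perform_vote hd

theorem proofFrom_ne_none (G : IsPromptView f Δ x E δ v k)
    (hA : ∀ i ∉ E.faulty, (E.state (E.stage δ k 10) i).pers.decided = none) {i j : Fin n}
    (hi : i ∉ E.faulty) (hj : j ∉ E.faulty) {c : ℕ} (hc : 3 ≤ c) (hc' : c < 10) :
    (E.state (E.stage δ k (c + 1)) j).tran.proofFrom i ≠ none := by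
  obtain ⟨y, hy⟩ := Option.ne_none_iff_exists'.1
    (G.run.sentProof_ne_none G.succ_le hi (E.stage δ k c))
  have hvi := G.view_stage hA hi (show 2 ≤ c by omega) (by omega)
  obtain ⟨l, hl, ha, hv, hd⟩ := G.exists_receipt hA hi hj hc hc' (m := .proof y v) trivial
    ⟨hvi.symm, hy⟩
  refine G.persists hj (R := fun s => s.tran.proofFrom i ≠ none)
    (fun e ha hv h => (G.run.tStep hj e).proofFrom_mono ha hv h)
    (hv.ge.trans (G.run.view_mono G.succ_le hj (Nat.le_succ l))) hl (G.stage_mono (by omega)) ?_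
  rw [Nat.succ_eq_add_one, G.run.state_succ hj, ha, ← hv]
  exact perform_proof hd

theorem suggestFrom_ne_none (G : IsPromptView f Δ x E δ v k)
    (hA : ∀ i ∉ E.faulty, (E.state (E.stage δ k 10) i).pers.decided = none) {i p : Fin n}
    (hi : i ∉ E.faulty) (hp : p ∉ E.faulty) (hpv : IsPrimary p v) :
    (E.state (E.stage δ k 4) p).tran.suggestFrom i ≠ none := by
  have hvi := G.view_stage hA hi (show 2 ≤ 3 by omega) (by omega)
  have h1 := (G.run.settled G.succ_le hi (E.stage δ k 3)).suggest p (by rw [hvi]; exact hpv)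
    ((G.highestRequest_eq hA hi hp le_rfl (by omega)).trans hvi.symm)
  obtain ⟨y, hy⟩ := Option.ne_none_iff_exists'.1 h1
  obtain ⟨l, hl, ha, hv, hd⟩ := G.exists_receipt hA hi hp le_rfl (by omega) (m := .suggest y v)
    hpv ⟨hvi.symm, hy⟩
  refine G.persists hp (R := fun s => s.tran.suggestFrom i ≠ none)
    (fun e ha hv h => (G.run.tStep hp e).suggestFrom_mono ha hv h)
    (hv.ge.trans (G.run.view_mono G.succ_le hp (Nat.le_succ l))) hl (G.stage_mono (by omega)) ?_
  rw [Nat.succ_eq_add_one, G.run.state_succ hp, ha, ← hv]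
  exact perform_suggest hd (hv ▸ hpv)

theorem proposal_ne_none (G : IsPromptView f Δ x E δ v k)
    (hA : ∀ i ∉ E.faulty, (E.state (E.stage δ k 10) i).pers.decided = none) {p j : Fin n}
    (hp : p ∉ E.faulty) (hpv : IsPrimary p v) (hj : j ∉ E.faulty)
    (h : (E.state (E.stage δ k 4) p).pers.sentPropose ≠ none) :
    (E.state (E.stage δ k 5) j).tran.proposal ≠ none := by
  obtain ⟨⟨q, y⟩, hy⟩ := Option.ne_none_iff_exists'.1 h
  have hvp := G.view_stage hA hp (show 2 ≤ 4 by omega) (by omega)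
  obtain ⟨l, hl, ha, hv, hd⟩ := G.exists_receipt hA hp hj (show 3 ≤ 4 by omega) (by omega)
    (m := .propose q y v) trivial ⟨hvp.symm, hy⟩
  refine G.persists hj (R := fun s => s.tran.proposal ≠ none)
    (fun e ha hv h => (G.run.tStep hj e).proposal_mono ha hv h)
    (hv.ge.trans (G.run.view_mono G.succ_le hj (Nat.le_succ l))) hl (G.stage_mono (by omega)) ?_
  rw [Nat.succ_eq_add_one, G.run.state_succ hj, ha, ← hv]
  exact perform_propose hd (hv ▸ hpv)

/-! ### The proposal -/

/-- The proposal of the primary, when some party votes. -/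
theorem sentPropose_of_quorum (G : IsPromptView f Δ x E δ v k)
    (hA : ∀ i ∉ E.faulty, (E.state (E.stage δ k 10) i).pers.decided = none) {p : Fin n}
    (hp : p ∉ E.faulty) (hpv : IsPrimary p v) {c : ℕ} (hc : 2 ≤ c) (hc' : c ≤ 11) {e : ℕ}
    (he : e ≤ E.stage δ k c + 1) {r : Round} {y : V} (hq : E.Quorum f e r y v) :
    ∃ q, (E.state (E.stage δ k c) p).pers.sentPropose = some (q, y) := by
  obtain ⟨j, hj, ⟨w, hw, e', he', hwv, hb⟩, -⟩ := (G.run.quorum_echo G.resilient hq).exists_common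
    G.run G.resilient hq
  obtain rfl : w = v := by exact_mod_cast hw
  obtain ⟨q, e'', he'', hb'⟩ := (G.run.pSound G.resilient e' j hj).echo y hb p hp (hwv ▸ hpv)
  exact ⟨q, (G.run.backs_mono G.succ_le hp (by omega)
    (by rw [G.view_stage hA hp hc hc', ← hb'.1, hwv]) hb').2⟩

/-- Without a proposal there are no echoes of nonfaulty parties and so no quorums in view v, hence
all suggested keys are below v. A nonzero suggested key3 is backed by a quorum of `key2` votes, and
its nonfaulty voters support it in their own suggestions. So all nonfaulty suggestions are accepted,
and the primary must have proposed. -/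
theorem sentPropose_ne_none (G : IsPromptView f Δ x E δ v k)
    (hA : ∀ i ∉ E.faulty, (E.state (E.stage δ k 10) i).pers.decided = none) {p : Fin n}
    (hp : p ∉ E.faulty) (hpv : IsPrimary p v) :
    (E.state (E.stage δ k 4) p).pers.sentPropose ≠ none := by
  intro hnone
  have hff := G.succ_le
  have hF := G.run.card_faulty
  have hvp := G.view_stage hA hp (show 2 ≤ 4 by omega) (by omega)
  -- A vote in any round after the echo would need a quorum, which leads back to a proposal.
  have hvote : ∀ r' r, r'.prev = some r → ∀ j ∉ E.faulty, ∀ e ≤ E.stage δ k 4,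
      (E.state e j).pers.view = v → (E.state e j).pers.sentVote r' = none := by
    intro r' r hr j hj e he hve
    by_contra hne
    obtain ⟨y, hy⟩ := Option.ne_none_iff_exists'.1 hne
    have hq := (G.run.pSound G.resilient e j hj).votes r' r y hr hy
    rw [hve] at hq
    obtain ⟨q, hq'⟩ := G.sentPropose_of_quorum hA hp hpv (by omega) (by omega)
      (he.trans (Nat.le_succ _)) hq
    rw [hnone] at hq'
    cases hq'
  have hsug : ∀ j ∉ E.faulty, ∃ g, (E.state (E.stage δ k 4) p).tran.suggestFrom j = some g ∧
      (g.key3 = 0 ∨ E.Quorum f (E.stage δ k 4) .key2 g.val3 g.key3) ∧ g.key3 < v ∧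
      g.key2.prev < g.key2.key ∧ g.key2.key < v ∧
      ∀ y (u : ℤ), u < v → ∀ e, E.Voted e j .key2 y u → SupportsKey u y g.key2 := by
    intro j hj
    obtain ⟨g, hg⟩ := Option.ne_none_iff_exists'.1 (G.suggestFrom_ne_none hA hj hp hpv)
    obtain ⟨e, he, hev, hb⟩ := (G.run.tranSound hff hp _).suggest j hj g hg
    rw [hvp] at hev
    obtain ⟨h1, -, h2, h3, h4, h5, -⟩ := (G.run.pSound G.resilient e j hj).suggest g hb
    rw [← hev] at h3 h4 h5
    refine ⟨g, hg, h1.imp_right fun h => h.mono he.le, h3 (hvote .key3 .key2 rfl j hj e he.le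
      hev.symm), h2.lt, h4 (hvote .key2 .key1 rfl j hj e he.le hev.symm), ?_⟩
    rintro y u hu e' ⟨w, rfl, e'', -, hw, hb'⟩
    refine h5 y w hu ⟨w, rfl, e'', ?_, hw, hb'⟩
    by_contra! hc
    have := G.run.view_mono hff hj hc
    have : w < v := by exact_mod_cast hu
    omega
  refine (G.run.settled hff hp (E.stage δ k 4)).propose ?_ hnone
  refine (sub_le_card_compl hF).trans (Finset.card_le_card fun j hj => ?_)
  simp only [Finset.mem_sdiff, Finset.mem_univ, true_and] at hj
  obtain ⟨g, hg, h1, h2, -⟩ := hsug j hj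
  refine Finset.mem_filter.2 ⟨Finset.mem_univ _, g, hg, h1.imp_right fun hq => ?_⟩
  rw [hvp]
  -- The f + 1 supporters are the nonfaulty members of the quorum behind the suggested key.
  refine ⟨h2, (succ_le_card_sdiff G.resilient hF hq).trans (Finset.card_le_card fun l hl => ?_)⟩
  simp only [Finset.mem_sdiff, Finset.mem_filter, Finset.mem_univ, true_and] at hl ⊢
  obtain ⟨g', hg', -, -, h3, h4, h5⟩ := hsug l hl.2
  rw [hvp]
  exact ⟨g', hg', h3, h4, h5 _ _ h2 _ (hl.1.resolve_left hl.2)⟩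

end IsPromptView

/-! ### Opening the locks, and the rounds up to the decision -/

namespace IsPromptView

variable {f : ℕ} {Δ : ℝ} {x : Fin n → V} {E : Execution n V} {δ : ℝ} {v k : ℕ}

/-- An earlier quorum in round `key1` convinces the parties locked on another value. -/
theorem openLock (G : IsPromptView f Δ x E δ v k)
    (hA : ∀ i ∉ E.faulty, (E.state (E.stage δ k 10) i).pers.decided = none) {j : Fin n}
    (hj : j ∉ E.faulty) {z : V} {u : ℤ} (hq : E.Quorum f (E.stage δ k 5) .key1 z u)
    (hu : u < v) (hlock : (E.state (E.stage δ k 5) j).pers.lock ≤ u)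
    (hz : z ≠ (E.state (E.stage δ k 5) j).pers.lockVal) :
    OpenLock f (E.state (E.stage δ k 5) j) := by
  have hff := G.succ_le
  have hvj := G.view_stage hA hj (show 2 ≤ 5 by omega) (by omega)
  refine (succ_le_card_sdiff G.resilient G.run.card_faulty hq).trans
    (Finset.card_le_card fun l hl => ?_)
  simp only [Finset.mem_sdiff, Finset.mem_filter, Finset.mem_univ, true_and] at hl ⊢
  obtain ⟨c, hc⟩ := Option.ne_none_iff_exists'.1
    (G.proofFrom_ne_none hA hl.2 hj (show 3 ≤ 4 by omega) (by omega))
  obtain ⟨e, he, hev, hb⟩ := (G.run.tranSound hff hj _).proof l hl.2 c hc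
  rw [hvj] at hev ⊢
  obtain ⟨h1, h2, h3⟩ := (G.run.pSound G.resilient e l hl.2).proof c hb
  rw [← hev] at h2 h3
  obtain ⟨w, rfl, e', -, hw, hb'⟩ := hl.1.resolve_left hl.2
  refine ⟨c, hc, h1.lt, h2, ?_⟩
  -- The vote was cast in an earlier view, hence before the proof was shown, so the proof remembers
  -- it.
  have hvoted : E.Voted e l .key1 z w := by
    refine ⟨w, rfl, e', ?_, hw, hb'⟩
    by_contra! hc
    have := G.run.view_mono hff hl.2 hc
    have : w < v := by exact_mod_cast hu
    omega
  rcases h3 z w hu hvoted with h4 | ⟨h4, rfl⟩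
  · exact .inl (hlock.trans h4)
  · exact .inr ⟨hlock.trans h4, hz⟩

/-- An older lock is backed by a quorum of `key3` votes, which meets the n - f accepted suggestions
in a nonfaulty party; so the maximal key q is at least the lock. The sound `key2` record that
supported q then yields a quorum of `key1` votes, from the lock's view or later, for a value other
than the locked one. -/
theorem canEcho (G : IsPromptView f Δ x E δ v k)
    (hA : ∀ i ∉ E.faulty, (E.state (E.stage δ k 10) i).pers.decided = none) {p j : Fin n}
    (hp : p ∉ E.faulty) (hpv : IsPrimary p v) (hj : j ∉ E.faulty) {q : ℤ} {y : V}
    (hy : (E.state (E.stage δ k 5) p).pers.sentPropose = some (q, y)) :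
    CanEcho f (E.state (E.stage δ k 5) j) q y := by
  have hvj := G.view_stage hA hj (show 2 ≤ 5 by omega) (by omega)
  have hvp := G.view_stage hA hp (show 2 ≤ 5 by omega) (by omega)
  have hpj := G.run.pSound G.resilient (E.stage δ k 5) j hj
  have hval {r : Round} {z : V} (hq : E.Quorum f (E.stage δ k 5) r z v) : z = y := by
    obtain ⟨q', hq'⟩ := G.sentPropose_of_quorum hA hp hpv (c := 5) (by omega) (by omega)
      (Nat.le_succ _) hq
    rw [hy, Option.some.injEq, Prod.mk.injEq] at hq'
    exact hq'.2.symm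
  by_cases h0 : (E.state (E.stage δ k 5) j).pers.lock = 0
  · exact .inl h0
  have hlq := hpj.lock.resolve_left h0
  by_cases hne : y = (E.state (E.stage δ k 5) j).pers.lockVal
  · exact .inr (.inl hne)
  have hlv : (E.state (E.stage δ k 5) j).pers.lock < v := by
    -- A lock set in view v itself is on the proposed value.
    refine lt_of_le_of_ne (hpj.lock_le.2.trans_eq (by rw [hvj])) fun heq => hne ?_
    rw [heq] at hlq
    exact (hval hlq).symm
  obtain ⟨⟨A, hAc, hA'⟩, hk⟩ := (G.run.pSound G.resilient _ p hp).propose q y hy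
  rw [hvp] at hA' hk
  obtain ⟨l, hlA, hlB, hlf⟩ := exists_common_notMem G.resilient G.run.card_faulty hAc hlq
  obtain ⟨g, ⟨e, he, hev, hb⟩, hgq⟩ := hA' l hlA hlf
  obtain ⟨w, hw, e', -, hw', hb'⟩ := (Finset.mem_filter.1 hlB).2.resolve_left hlf
  rw [← hw] at hlv
  have hlq' : (E.state (E.stage δ k 5) j).pers.lock ≤ q := by
    refine le_trans ?_ hgq
    rw [← hw]
    refine ((G.run.pSound G.resilient e l hlf).suggest g hb).2.2.2.2.2.2 _ w (by rwa [← hev])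
      ⟨w, rfl, e', ?_, hw', hb'⟩
    by_contra! hc
    have := G.run.view_mono G.succ_le hlf hc
    have : w < v := by exact_mod_cast hlv
    omega
  have hpos : 0 < q := (lt_of_le_of_ne hpj.lock_le.1 (Ne.symm h0)).trans_le hlq'
  obtain ⟨hqv, c, hc, hcv, hsup⟩ := hk.resolve_left hpos.ne'
  refine .inr (.inr ⟨by rwa [hvj], hlq', ?_⟩)
  have hlt := hc.lt
  rcases hsup with hsup | ⟨hsup, rfl⟩
  -- If `prev` is large, two different values have had quorums since q, and at least one differs
  -- from the locked value.
  · by_cases hcl : c.val = (E.state (E.stage δ k 5) j).pers.lockVal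
    · obtain ⟨z, hz, hqz⟩ := hc.prev.resolve_left (hpos.trans_le hsup).not_ge
      exact G.openLock hA hj hqz (by omega) (by omega) (fun h => hz (h.trans hcl.symm))
    · exact G.openLock hA hj (hc.key.resolve_left (by omega)) (by omega) (by omega) hcl
  · exact G.openLock hA hj (hc.key.resolve_left (by omega)) (by omega) (by omega) hne

/-- All nonfaulty parties that vote in a prompt view vote for the proposal. -/
theorem vote_eq (G : IsPromptView f Δ x E δ v k)
    (hA : ∀ i ∉ E.faulty, (E.state (E.stage δ k 10) i).pers.decided = none) {p j : Fin n}
    (hp : p ∉ E.faulty) (hpv : IsPrimary p v) (hj : j ∉ E.faulty) {q : ℤ} {y : V}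
    (hy : (E.state (E.stage δ k 10) p).pers.sentPropose = some (q, y)) {e : ℕ}
    (he : e ≤ E.stage δ k 10) {r : Round} {z : V}
    (hz : (E.state e j).pers.Backs (.vote r z v)) : z = y := by
  have hvp := G.view_stage hA hp (show 2 ≤ 10 by omega) (by omega)
  obtain ⟨hve, hz⟩ := hz
  have hps := G.run.pSound G.resilient e j hj
  have hquorum {r' : Round} (hr : r.prev = some r') : z = y := by
    have hq := hps.votes r r' z hr hz
    rw [← hve] at hq
    obtain ⟨q', hq'⟩ := G.sentPropose_of_quorum hA hp hpv (c := 10) (by omega) (by omega)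
      (he.trans (Nat.le_succ _)) hq
    rw [hy, Option.some.injEq, Prod.mk.injEq] at hq'
    exact hq'.2.symm
  cases r with
  | echo =>
    obtain ⟨q', e', he', hb⟩ := hps.echo z hz p hp (hve ▸ hpv)
    have := (G.run.backs_mono G.succ_le hp (he'.le.trans he)
      (by rw [hvp, ← hb.1, ← hve]) hb).2
    rw [hy, Option.some.injEq, Prod.mk.injEq] at this
    exact this.2.symm
  | _ => exact hquorum rfl

/-- Each round takes at most one period. -/
theorem reacted (G : IsPromptView f Δ x E δ v k)
    (hA : ∀ i ∉ E.faulty, (E.state (E.stage δ k 10) i).pers.decided = none) {p : Fin n}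
    (hp : p ∉ E.faulty) (hpv : IsPrimary p v) {q : ℤ} {y : V}
    (hy : (E.state (E.stage δ k 10) p).pers.sentPropose = some (q, y)) {c : ℕ} (hc : 3 ≤ c)
    (hc' : c < 10) {r : Round}
    (hr : ∀ j ∉ E.faulty, (E.state (E.stage δ k c) j).pers.sentVote r ≠ none) {i : Fin n}
    (hi : i ∉ E.faulty) : (E.state (E.stage δ k (c + 1)) i).pers.Reacted r := by
  refine (G.run.settled G.succ_le hi _).quorum r y
    ((sub_le_card_compl G.run.card_faulty).trans (Finset.card_le_card fun j hj => ?_))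
  simp only [Finset.mem_sdiff, Finset.mem_filter, Finset.mem_univ, true_and] at hj ⊢
  obtain ⟨z, hz⟩ := Option.ne_none_iff_exists'.1 (G.voteFrom_ne_none hA hj hi hc hc' (hr j hj))
  obtain ⟨e, he, hb⟩ := (G.run.tranSound G.succ_le hi _).vote j hj r z hz
  rw [G.view_stage hA hi (show 2 ≤ c + 1 by omega) (by omega)] at hb
  rw [hz, G.vote_eq hA hp hpv hj hy (he.le.trans (G.stage_mono (by omega))) hb]

/-- The timetable in periods: proposal by 4, echo by 5, `key1` by 6, `key2` by 7, `key3` by 8,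
`lock` by 9, `done` by 10. -/
theorem doneSent_ne_none (G : IsPromptView f Δ x E δ v k)
    (hA : ∀ i ∉ E.faulty, (E.state (E.stage δ k 10) i).pers.decided = none) {p : Fin n}
    (hp : p ∉ E.faulty) (hpv : IsPrimary p v) {i : Fin n} (hi : i ∉ E.faulty) :
    (E.state (E.stage δ k 10) i).pers.doneSent ≠ none := by
  obtain ⟨⟨q, y⟩, hy⟩ := Option.ne_none_iff_exists'.1 (G.sentPropose_ne_none hA hp hpv)
  have hvp {c : ℕ} (hc : 2 ≤ c) (hc' : c ≤ 11) := G.view_stage hA hp hc hc'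
  have hlater : ∀ c, 4 ≤ c → c ≤ 10 →
      (E.state (E.stage δ k c) p).pers.sentPropose = some (q, y) := fun c hc hc' =>
    (G.run.backs_mono G.succ_le hp (G.stage_mono hc)
      (by rw [hvp (by omega) (by omega), hvp (by omega) (by omega)])
      (m := .propose q y v) ⟨(hvp (by omega) (by omega)).symm, hy⟩).2
  have hecho : ∀ j ∉ E.faulty, (E.state (E.stage δ k 5) j).pers.sentVote .echo ≠ none := by
    intro j hj
    obtain ⟨⟨q', y'⟩, hq⟩ := Option.ne_none_iff_exists'.1
      (G.proposal_ne_none hA hp hpv hj (by rw [hy]; simp))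
    have hvj := G.view_stage hA hj (show 2 ≤ 5 by omega) (by omega)
    obtain ⟨e, he, hb⟩ := (G.run.tranSound G.succ_le hj _).propose q' y' hq p hp
      (by rw [hvj]; exact hpv)
    have := (G.run.backs_mono G.succ_le hp he.le
      (by rw [hvp (by omega) (by omega), ← hb.1, hvj]) hb).2
    exact (G.run.settled G.succ_le hj _).echo q' y' hq (G.canEcho hA hp hpv hj this)
  have hy' := hlater 10 (by omega) le_rfl
  have h6 := fun j hj => G.reacted hA hp hpv hy' (c := 5) (by omega) (by omega) hecho (i := j) hj
  have h7 := fun j hj => G.reacted hA hp hpv hy' (c := 6) (by omega) (by omega) h6 (i := j) hj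
  have h8 := fun j hj => G.reacted hA hp hpv hy' (c := 7) (by omega) (by omega) h7 (i := j) hj
  have h9 := fun j hj => G.reacted hA hp hpv hy' (c := 8) (by omega) (by omega) h8 (i := j) hj
  exact G.reacted hA hp hpv hy' (c := 9) (by omega) (by omega) h9 hi

/-- Optimistic responsiveness. -/
theorem decided_ne_none (G : IsPromptView f Δ x E δ v k) {p : Fin n} (hp : p ∉ E.faulty)
    (hpv : IsPrimary p v) {i : Fin n} (hi : i ∉ E.faulty) :
    (E.state (E.stage δ k 12) i).pers.decided ≠ none := by
  refine G.decided_of_doneSent ?_ hi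
  by_cases hA : ∀ i ∉ E.faulty, (E.state (E.stage δ k 10) i).pers.decided = none
  · refine (G.succ_le.trans (sub_le_card_compl G.run.card_faulty)).trans
      (Finset.card_le_card fun j hj => ?_)
    simp only [Finset.mem_sdiff, Finset.mem_filter, Finset.mem_univ, true_and] at hj ⊢
    exact ⟨hj, G.doneSent_ne_none hA hp hpv hj⟩
  -- If somebody has decided by then, the course of the view need not be followed: f + 1 nonfaulty
  -- parties have already sent `done`.
  · push Not at hA
    obtain ⟨j, hj, hd⟩ := hA
    obtain ⟨a, ha⟩ := Option.ne_none_iff_exists'.1 hd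
    refine ((G.run.pSound G.resilient _ j hj).decided a ha).trans
      (Finset.card_le_card fun l hl => ?_)
    simp only [Finset.mem_filter, Finset.mem_univ, true_and] at hl ⊢
    obtain ⟨hlf, e, he, hb⟩ := hl
    have hb' : (E.state e l).pers.doneSent = some a := hb
    exact ⟨hlf, by simp [G.run.doneSent_mono G.succ_le hlf he.le hb']⟩

end IsPromptView

end ITHS

end

theorem mainTheorem3 :
    ∃ C : ℕ, ∀ (n f : ℕ), 3 * f < n → ∀ (V : Type*) (x : Fin n → V) (Δ : ℝ), 0 < Δ →
      ∀ E : ITHS.Execution n V, ITHS.IsRun f Δ x E →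
        -- Communication: messages have at most seven words; a constant number of words is sent
        -- to each party in each view and for the change of each view.
        (∀ i ∉ E.faulty, ∀ k j m, (j, m) ∈ E.sends k i → m.words ≤ 7) ∧
        (∀ i ∉ E.faulty, ∀ j v K,
          E.viewWords i j v K ≤ C * (1 + E.recoveriesInView i j v K) ∧
          E.abortWords i j v K ≤ C * (1 + E.recoveries i j K)) ∧
        -- Memory: linear overall, of which a constant part is persistent.
        (∀ i ∉ E.faulty, ∀ k,
          (E.state k i).totalWords ≤ C * n ∧ (E.state k i).persistentWords ≤ C) ∧
        -- Reboots, which erase all but the persistent memory, do not affect the decisions.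
        (∀ i ∉ E.faulty, ∀ j ∉ E.faulty, ∀ k l a b,
          (E.state k i).pers.decided = some a → (E.state l j).pers.decided = some b → a = b) ∧
        (E.faulty = ∅ → ∀ a, (∀ i, x i = a) →
          ∀ i k b, (E.state k i).pers.decided = some b → b = a) ∧
        -- Optimistic responsiveness.
        (∀ δ : ℝ, 0 < δ → δ < Δ → E.DeliversWithin δ →
          ∀ v k, 0 < v → E.StartsAt v k → E.gst ≤ E.time k →
            (∃ p ∉ E.faulty, ITHS.IsPrimary p v) →
            (∀ l, ∀ i ∉ E.faulty, E.act l = .reboot i → E.time l ≤ E.time k + C * δ →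
              max (E.time l) E.gst + 2 * δ ≤ E.time k) →
            ∀ i ∉ E.faulty, ∃ l, E.time l ≤ E.time k + C * δ ∧
              ∃ a, (E.state l i).pers.decided = some a) := by
  -- The constants needed are 126 for communication, 50 and 29 for memory, and 12 periods; 200
  -- exceeds them all.
  refine ⟨200, fun n f hf V x Δ _ E h => ?_⟩
  have hff : f + 1 ≤ n - f := by omega
  refine ⟨fun _ _ _ _ m _ => m.words_le_seven, fun i hi j v K => ⟨?_, ?_⟩, fun i _ k => ⟨?_, ?_⟩,
    fun i hi j hj k l a b => h.agreement hf hi hj,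
    fun hE a hx i k => (h.only hf hE hx k i).decided, ?_⟩
  · exact (h.viewWords_le hff hi j v K).trans (Nat.mul_le_mul_right _ (by norm_num))
  · exact (h.abortWords_le hi j v K).trans (Nat.mul_le_mul_right _ (by norm_num))
  · exact ((E.state k i).totalWords_le (by omega)).trans (Nat.mul_le_mul_right _ (by norm_num))
  · exact (E.state k i).persistentWords_le.trans (by norm_num)
  · intro δ hδ hδΔ hdel v k hv hstart hgst ⟨p, hp, hpv⟩ hreboot i hi
    -- The assumption on reboots covers 200 periods, of which only the first 12 are used.
    have hle : (12 : ℝ) * δ ≤ (200 : ℕ) * δ := by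
      push_cast
      linarith
    have G : ITHS.IsPromptView f Δ x E δ v k :=
      ⟨h, hf, hδ, hδΔ, hdel, hv, hstart, hgst,
        fun l i hi hr hl => hreboot l i hi hr (by linarith)⟩
    refine ⟨E.stage δ k 12, ?_, Option.ne_none_iff_exists'.1 (G.decided_ne_none hp hpv hi)⟩
    have := G.time_stage_le 12
    push_cast at this hle ⊢
    linarith
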